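/- Let $q\in\mathbb C^\times$ with $|q|\ne 1$; fix a value of $\log q$, put $q^{x}=e^{x\log q}$ and $\tau=\frac{\log q}{2\pi i}$. Let $S\mathfrak S_q$ be the Lie superalgebra (supercommutator) of $2\times2$ supermatrices over the algebra with basis $z^rT_q^k$ $(r,k\in\mathbb Z)$ and $T_qz=qzT_q$; its basis is $z^rT_q^kM_{ij}$ $(i,j\in\{1,2\})$, where $M_{11},M_{22}$ are even and $M_{12},M_{21}$ odd. Let $\widehat{S\mathfrak S}_q=S\mathfrak S_q\oplus\mathbb C\,C$ be its central extension by the super-skew-symmetric cocycle $\psi$ that vanishes on all pairs of basis elements except $$\psi\big(z^rT_q^kM_{ij},\,z^{-r}T_q^{-k}M_{ji}\big)=-(-1)^i\,r\,q^{-rk}.$$ For $m\in\mathbb Z_{\ge0}$ let $R_m=\mathbb C[t]/(t^{m+1})$, and let $\mathfrak{gl}_{\infty|\infty}[m]$ be the Lie superalgebra of matrices $(a_{ij})_{i,j\in\frac12\mathbb Z}$ over $R_m$ with $a_{ij}=0$ for $|i-j|\gg0$, where $E_{ij}$ is even if $i-j\in\mathbb Z$ and odd otherwise. Let $\widehat{\mathfrak{gl}}_{\infty|\infty}[m]=\mathfrak{gl}_{\infty|\infty}[m]\oplus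 R_m$ be its central extension by the cocycle $\mathrm{Str}([J,A]B)$, where $J=\sum_{r\le0}E_{rr}$ and $\mathrm{Str}(A)=\sum_{r}(-1)^{2r}a_{rr}$. It is $\frac12\mathbb Z$-graded: $E_{ij}$ has degree $j-i$ and $R_m$ has degree $0$. For $s=q^{a}$, $a\in\mathbb C$, let $\widehat\varphi_s^{[m]}:\widehat{S\mathfrak S}_q\to\widehat{\mathfrak{gl}}_{\infty|\infty}[m]$ be the homomorphism with $C\mapsto1\in R_m$ and $$z^rT_q^kM_{ij}\mapsto\sum_{n\in\mathbb Z}(sq^{-n+t})^k\,E_{n-r-\frac{i-1}2,\;n-\frac{j-1}2}\;-\;\delta_{r,0}\,\delta_{ij}\,(1-\delta_{k,0})\,(-1)^i\,\frac{q^{ak}}{1-q^k}\,q^{kt},$$ where $q^{kt}=\sum_{l=0}^m\frac{(k\log q)^l}{l!}t^l$, $(sq^{-n+t})^k=q^{ak-nk}q^{kt}$, and the last term lies in the centre $R_m$ (it is absent if $k=0$). Let $\vec m=(m_1,\dots,m_N)\in\mathbb Z_{\ge0}^N$ and $\vec s=(s_1,\dots,s_N)$ with $s_i=q^{a_i}$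 and $a_i-a_j\notin\mathbb Z+\tau^{-1}\mathbb Z$ for $i\ne j$. Put $\widehat{\mathfrak{gl}}_{\infty|\infty}[\vec m]=\bigoplus_{i=1}^N\widehat{\mathfrak{gl}}_{\infty|\infty}[m_i]$ and $\widehat\varphi_{\vec s}^{[\vec m]}=\bigoplus_{i=1}^N\widehat\varphi_{s_i}^{[m_i]}:\widehat{S\mathfrak S}_q\to\widehat{\mathfrak{gl}}_{\infty|\infty}[\vec m]$; every $\widehat{\mathfrak{gl}}_{\infty|\infty}[\vec m]$-module is regarded as an $\widehat{S\mathfrak S}_q$-module through this homomorphism. **Theorem.** (1) Let $V$ be a quasifinite $\widehat{\mathfrak{gl}}_{\infty|\infty}[\vec m]$-module, that is, a $\frac12\mathbb Z$-graded module with finite-dimensional homogeneous components. Then every $\widehat{S\mathfrak S}_q$-submodule of $V$ (graded or not) is a $\widehat{\mathfrak{gl}}_{\infty|\infty}[\vec m]$-submodule. (2) In particular, for each $i$ let $\lambda_i\in(\widehat{\mathfrak{gl}}_{\infty|\infty}[m_i])_0^*$ be such that the irreducible highest weight module $L(\widehat{\mathfrak{gl}}_{\infty|\infty}[m_i],\lambda_i)$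 is quasifinite. Then the $\widehat{S\mathfrak S}_q$-module $L_{\vec s}^{[\vec m]}(\vec\lambda)=\bigotimes_{i=1}^NL(\widehat{\mathfrak{gl}}_{\infty|\infty}[m_i],\lambda_i)$ is irreducible. -/

import Mathlib

namespace QPDO

/-- The sign `(-1)^α` of a class modulo two. -/
def sgn (α : ZMod 2) : ℂ := if α = 0 then 1 else -1

/-- A Lie superalgebra over `ℂ`. The `ℤ/2`-grading is recorded by its parity involution, so that
the part of parity `α` is the eigenspace `{x | parity x = (-1)^α x}`. -/
class LieSuperalgebra (g : Type*) [AddCommGroup g] [Module ℂ g] where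
  parity : g →ₗ[ℂ] g
  parity_parity : ∀ x, parity (parity x) = x
  bracket : g →ₗ[ℂ] g →ₗ[ℂ] g
  parity_bracket : ∀ x y, parity (bracket x y) = bracket (parity x) (parity y)
  bracket_skew : ∀ (α β : ZMod 2) (x y : g), parity x = sgn α • x → parity y = sgn β • y →
    bracket x y = -(sgn (α * β) • bracket y x)
  bracket_jacobi : ∀ (α β : ZMod 2) (x y z : g), parity x = sgn α • x → parity y = sgn β • y →
    bracket x (bracket y z) = bracket (bracket x y) z + sgn (α * β) • bracket y (bracket x z)

/-- An even homomorphism of Lie superalgebras. -/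
structure SuperHom (g h : Type*) [AddCommGroup g] [Module ℂ g] [LieSuperalgebra g]
    [AddCommGroup h] [Module ℂ h] [LieSuperalgebra h] where
  toLin : g →ₗ[ℂ] h
  map_parity : ∀ x, toLin (LieSuperalgebra.parity x) = LieSuperalgebra.parity (toLin x)
  map_bracket : ∀ x y, toLin (LieSuperalgebra.bracket x y) =
    LieSuperalgebra.bracket (toLin x) (toLin y)

/-- A module over a Lie superalgebra: a superspace `V` (with its parity involution) and an action
with `g_α V_β ⊆ V_{α+β}` and `[x,y] v = x (y v) - (-1)^{αβ} y (x v)` for `x ∈ g_α`, `y ∈ g_β`. -/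
structure SuperRep (g V : Type*) [AddCommGroup g] [Module ℂ g] [LieSuperalgebra g]
    [AddCommGroup V] [Module ℂ V] where
  action : g →ₗ[ℂ] Module.End ℂ V
  parity : Module.End ℂ V
  parity_parity : ∀ v, parity (parity v) = v
  parity_action : ∀ x v, parity (action x v) = action (LieSuperalgebra.parity x) (parity v)
  action_bracket : ∀ (α β : ZMod 2) (x y : g), LieSuperalgebra.parity x = sgn α • x →
    LieSuperalgebra.parity y = sgn β • y → ∀ v, action (LieSuperalgebra.bracket x y) v =
      action x (action y v) - sgn (α * β) • action y (action x v)

namespace SuperRep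

variable {g h V : Type*} [AddCommGroup g] [Module ℂ g] [LieSuperalgebra g]
  [AddCommGroup h] [Module ℂ h] [LieSuperalgebra h] [AddCommGroup V] [Module ℂ V]

/-- The `g`-module obtained from an `h`-module through a homomorphism `g → h`. -/
def pullback (ρ : SuperRep h V) (f : SuperHom g h) : SuperRep g V where
  action := ρ.action ∘ₗ f.toLin
  parity := ρ.parity
  parity_parity := ρ.parity_parity
  parity_action x v := by simp [ρ.parity_action, f.map_parity]
  action_bracket α β x y hx hy v := by
    simp only [LinearMap.comp_apply, f.map_bracket]
    exact ρ.action_bracket α β _ _ (by rw [← f.map_parity, hx, map_smul])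
      (by rw [← f.map_parity, hy, map_smul]) v

/-- The subspace `U` is a submodule. It need not be compatible with any grading of `V`. -/
def IsSubmodule (ρ : SuperRep g V) (U : Submodule ℂ V) : Prop :=
  ∀ x : g, ∀ u ∈ U, ρ.action x u ∈ U

/-- Irreducibility: `V ≠ 0`, and no submodule, graded or not, other than `0` and `V`. -/
def IsIrreducible (ρ : SuperRep g V) : Prop :=
  Nontrivial V ∧ ∀ U : Submodule ℂ V, ρ.IsSubmodule U → U = ⊥ ∨ U = ⊤

/-- `V = ⨁ deg n` is a gradation of the module `V`, compatible with the gradation `gr` of `g`.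
Half-integer degrees are doubled: `gr n` and `deg n` are the parts of degree `n / 2`. -/
def IsGrading (gr : ℤ → Submodule ℂ g) (ρ : SuperRep g V) (deg : ℤ → Submodule ℂ V) : Prop :=
  DirectSum.IsInternal deg ∧ ∀ i j : ℤ, ∀ x ∈ gr i, ∀ v ∈ deg j, ρ.action x v ∈ deg (i + j)

/-- Quasifinite modules: graded modules with finite-dimensional homogeneous parts. -/
def IsQuasifinite (gr : ℤ → Submodule ℂ g) (ρ : SuperRep g V) : Prop :=
  ∃ deg : ℤ → Submodule ℂ V, IsGrading gr ρ deg ∧ ∀ n, FiniteDimensional ℂ (deg n)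

/-- `V = ⨁ deg n` is a highest weight module with highest weight `wt ∈ (g_0)^*`. The last clause
says that `V = U(g_-) v`: the only subspace that contains `v` and is stable under `g_-` is `V`. -/
def IsHighestWeight (gr : ℤ → Submodule ℂ g) (ρ : SuperRep g V) (deg : ℤ → Submodule ℂ V)
    (wt : Module.Dual ℂ (gr 0)) : Prop :=
  IsGrading gr ρ deg ∧ ∃ v : V, v ≠ 0 ∧ deg 0 = Submodule.span ℂ {v} ∧
    (∀ x : gr 0, ρ.action (x : g) v = wt x • v) ∧
    (∀ n : ℤ, 0 < n → ∀ x ∈ gr n, ρ.action x v = 0) ∧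
    ∀ W : Submodule ℂ V, v ∈ W →
      (∀ n : ℤ, n < 0 → ∀ x ∈ gr n, ∀ w ∈ W, ρ.action x w ∈ W) → W = ⊤

/-- `V` is the irreducible highest weight module `L(g, wt)`: a highest weight module without
graded submodules other than `0` and `V`, and it is quasifinite. -/
def IsQuasifiniteIrreducibleHighestWeight (gr : ℤ → Submodule ℂ g) (ρ : SuperRep g V)
    (wt : Module.Dual ℂ (gr 0)) : Prop :=
  ∃ deg : ℤ → Submodule ℂ V, IsHighestWeight gr ρ deg wt ∧
    (∀ n, FiniteDimensional ℂ (deg n)) ∧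
    ∀ U : Submodule ℂ V, ρ.IsSubmodule U → U = ⨆ n, U ⊓ deg n → U = ⊥ ∨ U = ⊤

end SuperRep

/-- Data for the central extension by `Z` of the Lie superalgebra of an associative superalgebra
`A`: the parity involution `σ`, an even derivation `D` with values in an ideal `I`, and a
supertrace `str` on `I`, which give the cocycle `(x, y) ↦ str (D x * y)`. -/
structure TraceData (A Z : Type*) [NonUnitalRing A] [Module ℂ A] [IsScalarTower ℂ A A]
    [SMulCommClass ℂ A A] [AddCommGroup Z] [Module ℂ Z] where
  σ : A →ₗ[ℂ] A
  σ_σ : ∀ x, σ (σ x) = x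
  σ_mul : ∀ x y, σ (x * y) = σ x * σ y
  D : A →ₗ[ℂ] A
  D_mul : ∀ x y, D (x * y) = D x * y + x * D y
  σ_D : ∀ x, σ (D x) = D (σ x)
  I : Submodule ℂ A
  D_mem : ∀ x, D x ∈ I
  mul_mem_left : ∀ x y, x ∈ I → x * y ∈ I
  mul_mem_right : ∀ x y, y ∈ I → x * y ∈ I
  str : A → Z
  str_add : ∀ x y, x ∈ I → y ∈ I → str (x + y) = str x + str y
  str_smul : ∀ (c : ℂ) x, x ∈ I → str (c • x) = c • str x
  str_σ : ∀ x, x ∈ I → str (σ x) = str x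
  str_D : ∀ x, str (D x) = 0
  str_comm : ∀ (α β : ZMod 2) (x y : A), σ x = sgn α • x → σ y = sgn β • y → x ∈ I →
    str (x * y) = sgn (α * β) • str (y * x)

/-- The supercommutator, in a form that is bilinear on the nose: it is `x y - (-1)^{αβ} y x` if
`x`, `y` have parities `α`, `β`. -/
noncomputable def superComm {A : Type*} [NonUnitalRing A] [Module ℂ A] (σ : A →ₗ[ℂ] A) (x y : A) :
    A :=
  x * y - y * x + (2⁻¹ : ℂ) • ((y - σ y) * (x - σ x))

theorem ZMod2_cases (α : ZMod 2) : α = 0 ∨ α = 1 := by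
  revert α; decide

theorem superComm_of_homogeneous {A : Type*} [NonUnitalRing A] [Module ℂ A]
    [IsScalarTower ℂ A A] [SMulCommClass ℂ A A] (σ : A →ₗ[ℂ] A)
    (α β : ZMod 2) (x y : A) (hx : σ x = sgn α • x) (hy : σ y = sgn β • y) :
    superComm σ x y = x * y - sgn (α * β) • (y * x) := by
  rcases ZMod2_cases α with rfl | rfl <;> rcases ZMod2_cases β with rfl | rfl <;>
    simp only [sgn, if_true, one_ne_zero, if_false, one_smul, neg_smul, mul_zero,
      mul_one] at hx hy ⊢ <;> simp only [superComm, hx, hy, sub_self, mul_zero, zero_mul,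
      smul_zero, add_zero]
  rw [sub_neg_eq_add, sub_neg_eq_add, ← two_smul ℂ y, ← two_smul ℂ x, smul_mul_smul_comm,
    smul_smul]
  have : (2⁻¹ * (2 * 2) : ℂ) = 2 := by norm_num
  rw [this, two_smul]; abel

theorem sgn_mul_self (α : ZMod 2) : sgn α * sgn α = 1 := by
  unfold sgn; split_ifs <;> norm_num

theorem sgn_add (α β : ZMod 2) : sgn (α + β) = sgn α * sgn β := by
  rcases ZMod2_cases α with rfl | rfl <;> rcases ZMod2_cases β with rfl | rfl
  · simp [sgn]
  · simp [sgn]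
  · simp [sgn]
  · have : (1 + 1 : ZMod 2) = 0 := by decide
    simp [sgn, this]

namespace TraceData

variable {A Z : Type*} [NonUnitalRing A] [Module ℂ A] [IsScalarTower ℂ A A]
    [SMulCommClass ℂ A A] [AddCommGroup Z] [Module ℂ Z] (T : TraceData A Z)

theorem D_mul_mem (x y : A) : T.D x * y ∈ T.I := T.mul_mem_left _ _ (T.D_mem x)

theorem str_sub (x y : A) (hx : x ∈ T.I) (hy : y ∈ T.I) : T.str (x - y) = T.str x - T.str y := by
  rw [sub_eq_add_neg, ← neg_one_smul ℂ y, T.str_add _ _ hx (T.I.smul_mem _ hy),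
    T.str_smul _ _ hy, neg_one_smul, sub_eq_add_neg]

/-- The cocycle `(x, y) ↦ str (D x * y)`. -/
noncomputable def cocycle : A →ₗ[ℂ] A →ₗ[ℂ] Z :=
  LinearMap.mk₂ ℂ (fun x y => T.str (T.D x * y))
    (fun x x' y => by
      simp only [map_add, add_mul]; exact T.str_add _ _ (T.D_mul_mem _ _) (T.D_mul_mem _ _))
    (fun c x y => by
      simp only [map_smul, smul_mul_assoc]; exact T.str_smul _ _ (T.D_mul_mem _ _))
    (fun x y y' => by
      simp only [mul_add]; exact T.str_add _ _ (T.D_mul_mem _ _) (T.D_mul_mem _ _))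
    (fun c x y => by
      simp only [mul_smul_comm]; exact T.str_smul _ _ (T.D_mul_mem _ _))

/-- The bracket `[(x, c), (y, d)] = ([x, y], str (D x * y))` on `A × Z`. -/
noncomputable def extBracket : (A × Z) →ₗ[ℂ] (A × Z) →ₗ[ℂ] (A × Z) :=
  LinearMap.mk₂ ℂ (fun x y => (superComm T.σ x.1 y.1, T.cocycle x.1 y.1))
    (fun x x' y => by
      ext
      · simp only [superComm, Prod.fst_add, map_add, add_mul, mul_add, sub_mul, mul_sub,
          smul_add, smul_sub]; abel
      · simp)
    (fun c x y => by
      ext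
      · simp only [superComm, Prod.smul_fst, map_smul, smul_mul_assoc, mul_smul_comm, mul_sub,
          sub_mul, smul_add, smul_sub, smul_comm c (2⁻¹ : ℂ)]
      · simp)
    (fun x y y' => by
      ext
      · simp only [superComm, Prod.fst_add, map_add, add_mul, mul_add, sub_mul, mul_sub,
          smul_add, smul_sub]; abel
      · simp)
    (fun c x y => by
      ext
      · simp only [superComm, Prod.smul_fst, map_smul, smul_mul_assoc, mul_smul_comm, mul_sub,
          sub_mul, smul_add, smul_sub, smul_comm c (2⁻¹ : ℂ)]
      · simp)

theorem cocycle_skew (α β : ZMod 2) (x y : A) (hx : T.σ x = sgn α • x) (hy : T.σ y = sgn β • y) :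
    T.cocycle x y = -(sgn (α * β) • T.cocycle y x) := by
  have hDy : T.σ (T.D y) = sgn β • T.D y := by rw [T.σ_D, hy, map_smul]
  have h1 : T.cocycle y x = sgn (β * α) • T.str (x * T.D y) :=
    T.str_comm β α _ _ hDy hx (T.D_mem y)
  have h2 : T.str (T.D x * y) + T.str (x * T.D y) = 0 := by
    rw [← T.str_add _ _ (T.D_mul_mem _ _) (T.mul_mem_right _ _ (T.D_mem y)), ← T.D_mul, T.str_D]
  rw [h1, smul_smul, mul_comm β α, sgn_mul_self, one_smul]
  exact eq_neg_of_add_eq_zero_left h2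

theorem superComm_parity (α β : ZMod 2) (x y : A) (hx : T.σ x = sgn α • x)
    (hy : T.σ y = sgn β • y) :
    T.σ (superComm T.σ x y) = sgn (α + β) • superComm T.σ x y := by
  rw [superComm_of_homogeneous _ α β x y hx hy, map_sub, map_smul, T.σ_mul, T.σ_mul, hx, hy,
    sgn_add, smul_mul_smul_comm, smul_mul_smul_comm, mul_comm (sgn β), smul_sub,
    smul_comm (sgn (α * β))]

/-- Any element is the sum of an even and an odd one. -/
theorem exists_decomp (z : A) : ∃ z0 z1 : A, T.σ z0 = sgn 0 • z0 ∧ T.σ z1 = sgn 1 • z1 ∧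
    z = z0 + z1 := by
  refine ⟨(2⁻¹ : ℂ) • (z + T.σ z), (2⁻¹ : ℂ) • (z - T.σ z), ?_, ?_, ?_⟩
  · simp [sgn, T.σ_σ, add_comm]
  · simp [sgn, T.σ_σ, ← smul_neg]
  · rw [← smul_add, add_add_sub_cancel, ← two_smul ℂ z, smul_smul]; norm_num

theorem jacobi_homogeneous (α β γ : ZMod 2) (x y z : A) (hx : T.σ x = sgn α • x)
    (hy : T.σ y = sgn β • y) (hz : T.σ z = sgn γ • z) :
    superComm T.σ x (superComm T.σ y z) = superComm T.σ (superComm T.σ x y) z +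
      sgn (α * β) • superComm T.σ y (superComm T.σ x z) := by
  rw [superComm_of_homogeneous _ α (β + γ) x _ hx (T.superComm_parity β γ y z hy hz),
    superComm_of_homogeneous _ (α + β) γ _ z (T.superComm_parity α β x y hx hy) hz,
    superComm_of_homogeneous _ β (α + γ) y _ hy (T.superComm_parity α γ x z hx hz),
    superComm_of_homogeneous _ β γ y z hy hz, superComm_of_homogeneous _ α β x y hx hy,
    superComm_of_homogeneous _ α γ x z hx hz]
  simp only [mul_add, add_mul, sgn_add, mul_comm β α]
  have h := sgn_mul_self (α * β)
  generalize sgn (α * β) = p at *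
  generalize sgn (α * γ) = r at *
  generalize sgn (β * γ) = s at *
  simp only [mul_sub, sub_mul, smul_sub, smul_smul, mul_smul_comm, smul_mul_assoc, mul_assoc]
  have h3 : p * (p * s) = s := by rw [← mul_assoc, h, one_mul]
  have h4 : p * (p * (s * r)) = r * s := by rw [← mul_assoc, h, one_mul, mul_comm]
  simp only [h3, h4]
  module

theorem cocycle_jacobi (α β γ : ZMod 2) (x y z : A) (hx : T.σ x = sgn α • x)
    (hy : T.σ y = sgn β • y) (hz : T.σ z = sgn γ • z) :
    T.cocycle x (superComm T.σ y z) = T.cocycle (superComm T.σ x y) z +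
      sgn (α * β) • T.cocycle y (superComm T.σ x z) := by
  have hDx : T.σ (T.D x) = sgn α • T.D x := by rw [T.σ_D, hx, map_smul]
  have hDy : T.σ (T.D y) = sgn β • T.D y := by rw [T.σ_D, hy, map_smul]
  have e1 : T.str (T.D y * z * x) = sgn ((β + γ) * α) • T.str (x * (T.D y * z)) :=
    T.str_comm (β + γ) α _ _ (by rw [T.σ_mul, hDy, hz, smul_mul_smul_comm, sgn_add]) hx
      (T.D_mul_mem _ _)
  have e2 : T.str (T.D x * z * y) = sgn ((α + γ) * β) • T.str (y * (T.D x * z)) :=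
    T.str_comm (α + γ) β _ _ (by rw [T.σ_mul, hDx, hz, smul_mul_smul_comm, sgn_add]) hy
      (T.D_mul_mem _ _)
  have c : ∀ u v, T.cocycle u v = T.str (T.D u * v) := fun u v => rfl
  have c2 : ∀ u v w, T.cocycle (u * v) w = T.str (T.D u * (v * w)) + T.str (u * (T.D v * w)) := by
    intro u v w
    rw [c, T.D_mul, add_mul, T.str_add, mul_assoc, mul_assoc]
    · exact T.mul_mem_left _ _ (T.D_mul_mem _ _)
    · exact T.mul_mem_left _ _ (T.mul_mem_right _ _ (T.D_mem _))
  rw [superComm_of_homogeneous _ β γ y z hy hz, superComm_of_homogeneous _ α β x y hx hy,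
    superComm_of_homogeneous _ α γ x z hx hz]
  simp only [map_sub, map_smul, LinearMap.sub_apply, LinearMap.smul_apply, c2]
  simp only [c, ← mul_assoc] at *
  rw [e1, e2]
  simp only [add_mul, sgn_add, mul_comm β α, mul_comm γ α, mul_comm γ β]
  have h := sgn_mul_self (α * β)
  have h' := sgn_mul_self (α * γ)
  have h'' := sgn_mul_self (β * γ)
  generalize sgn (α * β) = p at *
  generalize sgn (α * γ) = r at *
  generalize sgn (β * γ) = s at *
  simp only [smul_sub, smul_add, smul_smul]
  have h3 : s * (p * s) = p := by rw [mul_left_comm, h'', mul_one]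
  have h4 : p * (r * (p * r)) = 1 := by
    linear_combination (p * p) * h' + h
  simp only [h3, h4, one_smul]
  abel

/-- The central extension `A ⊕ Z` of the Lie superalgebra of `A`; the centre `Z` is even. -/
@[reducible] noncomputable def lieSuperalgebra : LieSuperalgebra (A × Z) where
  parity := T.σ.prodMap LinearMap.id
  parity_parity x := by simp [T.σ_σ]
  bracket := T.extBracket
  parity_bracket x y := by
    ext
    · simp [extBracket, superComm, T.σ_mul]
    · change T.str (T.D x.1 * y.1) = T.str (T.D (T.σ x.1) * T.σ y.1)
      rw [← T.σ_D, ← T.σ_mul, T.str_σ _ (T.D_mul_mem _ _)]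
  bracket_skew α β x y hx hy := by
    have hx' : T.σ x.1 = sgn α • x.1 := congrArg Prod.fst hx
    have hy' : T.σ y.1 = sgn β • y.1 := congrArg Prod.fst hy
    ext
    · change superComm T.σ x.1 y.1 = -(sgn (α * β) • superComm T.σ y.1 x.1)
      rw [superComm_of_homogeneous _ α β _ _ hx' hy', superComm_of_homogeneous _ β α _ _ hy' hx',
        smul_sub, smul_smul, mul_comm β α, sgn_mul_self, one_smul, neg_sub]
    · exact T.cocycle_skew α β _ _ hx' hy'
  bracket_jacobi α β x y z hx hy := by
    have hx' : T.σ x.1 = sgn α • x.1 := congrArg Prod.fst hx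
    have hy' : T.σ y.1 = sgn β • y.1 := congrArg Prod.fst hy
    obtain ⟨z0, z1, h0, h1, hz⟩ := T.exists_decomp z.1
    have hz' : z = (z0, z.2) + (z1, 0) := by ext <;> simp [hz]
    have key : ∀ (γ : ZMod 2) (w : A) (d : Z), T.σ w = sgn γ • w →
        T.extBracket x (T.extBracket y (w, d)) = T.extBracket (T.extBracket x y) (w, d) +
          sgn (α * β) • T.extBracket y (T.extBracket x (w, d)) := by
      intro γ w d hw
      ext
      · exact T.jacobi_homogeneous α β γ _ _ _ hx' hy' hw
      · exact T.cocycle_jacobi α β γ _ _ _ hx' hy' hw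
    rw [hz']
    simp only [map_add, smul_add]
    rw [key 0 z0 _ h0, key 1 z1 _ h1]
    abel

end TraceData

/-! Band matrices, with rows and columns indexed by `½ℤ`. The integer `p` stands for the index
`p / 2`. -/

/-- The matrix has finitely many non-zero diagonals. -/
def IsBand {R : Type*} [CommRing R] (A : ℤ → ℤ → R) : Prop :=
  ∃ b : ℤ, ∀ p q, A p q ≠ 0 → |p - q| ≤ b

/-- The superalgebra of matrices `(a_{pq})` over `R` with `a_{pq} = 0` for `|p - q| ≫ 0`. -/
structure Band (R : Type*) [CommRing R] where
  entry : ℤ → ℤ → R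
  isBand : IsBand entry

namespace Band

variable {R : Type*} [CommRing R]

@[ext] theorem ext {A B : Band R} (h : ∀ p q, A.entry p q = B.entry p q) : A = B := by
  cases A; cases B; congr; funext p q; exact h p q

theorem isBand_add {A B : ℤ → ℤ → R} (hA : IsBand A) (hB : IsBand B) :
    IsBand fun p q => A p q + B p q := by
  obtain ⟨a, ha⟩ := hA
  obtain ⟨b, hb⟩ := hB
  refine ⟨max a b, fun p q h => ?_⟩
  by_cases h1 : A p q = 0
  · refine (hb p q fun h2 => h ?_).trans (le_max_right _ _)
    simp [h1, h2]
  · exact (ha p q h1).trans (le_max_left _ _)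

theorem isBand_of_imp {A B : ℤ → ℤ → R} (hA : IsBand A) (h : ∀ p q, A p q = 0 → B p q = 0) :
    IsBand B := by
  obtain ⟨a, ha⟩ := hA
  exact ⟨a, fun p q hp => ha p q fun h0 => hp (h p q h0)⟩

theorem exists_ne_zero {f : ℤ → R} (h : ∑ᶠ l, f l ≠ 0) : ∃ l, f l ≠ 0 := by
  by_contra h0
  push Not at h0
  exact h ((finsum_congr h0).trans finsum_zero)

theorem isBand_mul {A B : ℤ → ℤ → R} (hA : IsBand A) (hB : IsBand B) :
    IsBand fun p q => ∑ᶠ l, A p l * B l q := by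
  obtain ⟨a, ha⟩ := hA
  obtain ⟨b, hb⟩ := hB
  refine ⟨a + b, fun p q h => ?_⟩
  obtain ⟨l, hl⟩ := exists_ne_zero h
  have h1 := ha p l (left_ne_zero_of_mul hl)
  have h2 := hb l q (right_ne_zero_of_mul hl)
  calc |p - q| = |(p - l) + (l - q)| := by ring_nf
    _ ≤ _ := (abs_add_le _ _).trans (add_le_add h1 h2)

instance : Zero (Band R) := ⟨⟨fun _ _ => 0, 0, fun _ _ h => absurd rfl h⟩⟩
instance : Add (Band R) := ⟨fun A B => ⟨fun p q => A.entry p q + B.entry p q,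
  isBand_add A.isBand B.isBand⟩⟩
instance : Neg (Band R) := ⟨fun A => ⟨fun p q => -A.entry p q,
  isBand_of_imp A.isBand (by simp)⟩⟩
/-- The product of matrices; the sum is finite. -/
noncomputable instance : Mul (Band R) := ⟨fun A B => ⟨fun p q => ∑ᶠ l, A.entry p l * B.entry l q,
  isBand_mul A.isBand B.isBand⟩⟩

@[simp] theorem zero_entry (p q : ℤ) : (0 : Band R).entry p q = 0 := rfl
@[simp] theorem add_entry (A B : Band R) (p q : ℤ) :
    (A + B).entry p q = A.entry p q + B.entry p q := rfl
@[simp] theorem neg_entry (A : Band R) (p q : ℤ) : (-A).entry p q = -A.entry p q := rfl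
theorem mul_entry (A B : Band R) (p q : ℤ) :
    (A * B).entry p q = ∑ᶠ l, A.entry p l * B.entry l q := rfl

theorem row_finite (A : Band R) (p : ℤ) : (Function.support fun l => A.entry p l).Finite := by
  obtain ⟨a, ha⟩ := A.isBand
  refine (Set.finite_Icc (p - a) (p + a)).subset fun l hl => ?_
  have := abs_le.1 (ha p l hl)
  exact ⟨by linarith, by linarith⟩

theorem col_finite (A : Band R) (q : ℤ) : (Function.support fun l => A.entry l q).Finite := by
  obtain ⟨a, ha⟩ := A.isBand
  refine (Set.finite_Icc (q - a) (q + a)).subset fun l hl => ?_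
  have := abs_le.1 (ha l q hl)
  exact ⟨by linarith, by linarith⟩

theorem mul_finite (A B : Band R) (p q : ℤ) :
    (Function.support fun l => A.entry p l * B.entry l q).Finite :=
  (A.row_finite p).subset fun _ hl => left_ne_zero_of_mul hl

theorem mul_entry_eq_sum (A B : Band R) (p q : ℤ) (s : Finset ℤ)
    (hs : ∀ l, A.entry p l ≠ 0 → l ∈ s) :
    (A * B).entry p q = ∑ l ∈ s, A.entry p l * B.entry l q :=
  finsum_eq_sum_of_support_subset _ fun l hl => hs l (left_ne_zero_of_mul hl)

theorem mul_entry_eq_sum' (A B : Band R) (p q : ℤ) (s : Finset ℤ)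
    (hs : ∀ l, B.entry l q ≠ 0 → l ∈ s) :
    (A * B).entry p q = ∑ l ∈ s, A.entry p l * B.entry l q :=
  finsum_eq_sum_of_support_subset _ fun l hl => hs l (right_ne_zero_of_mul hl)

instance : AddCommGroup (Band R) where
  add_assoc A B C := by ext; simp [add_assoc]
  zero_add A := by ext; simp
  add_zero A := by ext; simp
  add_comm A B := by ext; simp [add_comm]
  neg_add_cancel A := by ext; simp
  nsmul := nsmulRec
  zsmul := zsmulRec

@[simp] theorem sub_entry (A B : Band R) (p q : ℤ) :
    (A - B).entry p q = A.entry p q - B.entry p q := by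
  rw [sub_eq_add_neg, sub_eq_add_neg]; rfl

noncomputable instance : NonUnitalRing (Band R) where
  left_distrib A B C := by
    ext p q
    simp only [mul_entry, add_entry, mul_add]
    exact finsum_add_distrib (mul_finite A B p q) (mul_finite A C p q)
  right_distrib A B C := by
    ext p q
    simp only [mul_entry, add_entry, add_mul]
    exact finsum_add_distrib (mul_finite A C p q) (mul_finite B C p q)
  zero_mul A := by ext; simp [mul_entry]
  mul_zero A := by ext; simp [mul_entry]
  mul_assoc A B C := by
    ext p q
    rw [mul_entry_eq_sum' (A * B) C p q (C.col_finite q).toFinset (by simp),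
      mul_entry_eq_sum A (B * C) p q (A.row_finite p).toFinset (by simp)]
    have h1 : ∀ l, (A * B).entry p l = ∑ k ∈ (A.row_finite p).toFinset,
        A.entry p k * B.entry k l := fun l => mul_entry_eq_sum A B p l _ (by simp)
    have h2 : ∀ k, (B * C).entry k q = ∑ l ∈ (C.col_finite q).toFinset,
        B.entry k l * C.entry l q := fun k => mul_entry_eq_sum' B C k q _ (by simp)
    simp only [h1, h2, Finset.sum_mul, Finset.mul_sum]
    rw [Finset.sum_comm]
    simp only [mul_assoc]

/-- The matrix `J = ∑_{p ≤ 0} E_{pp}`. -/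
def J : Band R := ⟨fun p q => if p = q ∧ p ≤ 0 then 1 else 0, 0, fun p q h => by
  by_cases hpq : p = q
  · simp [hpq]
  · simp [hpq] at h⟩

theorem J_mul_entry (A : Band R) (p q : ℤ) :
    (J * A).entry p q = (if p ≤ 0 then 1 else 0) * A.entry p q := by
  rw [mul_entry_eq_sum J A p q {p}]
  · simp [J]
  · intro l hl
    by_contra h
    refine hl ?_
    have : p ≠ l := fun e => h (by simp [e])
    simp [J, this]

theorem mul_J_entry (A : Band R) (p q : ℤ) :
    (A * J).entry p q = (if q ≤ 0 then 1 else 0) * A.entry p q := by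
  rw [mul_entry_eq_sum' A J p q {q}]
  · simp [J]
  · intro l hl
    by_contra h
    refine hl ?_
    have : l ≠ q := fun e => h (by simp [e])
    simp [J, this]

variable [Algebra ℂ R]

instance : SMul ℂ (Band R) := ⟨fun c A => ⟨fun p q => c • A.entry p q,
  isBand_of_imp A.isBand (by intro p q h; simp [h])⟩⟩

@[simp] theorem smul_entry (c : ℂ) (A : Band R) (p q : ℤ) :
    (c • A).entry p q = c • A.entry p q := rfl

instance : Module ℂ (Band R) where
  one_smul A := by ext; simp
  mul_smul c d A := by ext; simp [mul_smul]
  smul_zero c := by ext; simp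
  smul_add c A B := by ext; simp
  add_smul c d A := by ext; simp [add_smul]
  zero_smul A := by ext; simp

instance : IsScalarTower ℂ (Band R) (Band R) := ⟨fun c A B => by
  ext p q
  simp only [smul_eq_mul, mul_entry, smul_entry, smul_mul_assoc]
  exact (smul_finsum' c (mul_finite A B p q)).symm⟩

instance : SMulCommClass ℂ (Band R) (Band R) := ⟨fun c A B => by
  ext p q
  simp only [smul_eq_mul, mul_entry, smul_entry, mul_smul_comm]
  exact (smul_finsum' c (mul_finite A B p q))⟩

/-- The parity involution: `E_{pq}` is even if `p - q` is even (the difference of the indices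
`p / 2` and `q / 2` is then an integer), and odd otherwise. -/
def parity : Band R →ₗ[ℂ] Band R where
  toFun A := ⟨fun p q => sgn ((p - q : ℤ) : ZMod 2) • A.entry p q,
    isBand_of_imp A.isBand (by intro p q h; simp [h])⟩
  map_add' A B := by ext; simp
  map_smul' c A := by ext; simp [smul_comm c]

@[simp] theorem parity_entry (A : Band R) (p q : ℤ) :
    (parity A).entry p q = sgn ((p - q : ℤ) : ZMod 2) • A.entry p q := rfl

/-- The supertrace `∑_p (-1)^p a_{pp}`, used for matrices with finitely many non-zero entries. -/
noncomputable def str (A : Band R) : R := ∑ᶠ p : ℤ, sgn (p : ZMod 2) • A.entry p p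

/-- The derivation `A ↦ [J, A]` (`J` is even). -/
noncomputable def adJ : Band R →ₗ[ℂ] Band R where
  toFun A := J * A - A * J
  map_add' A B := by rw [mul_add, add_mul]; abel
  map_smul' c A := by simp [mul_smul_comm, smul_mul_assoc, smul_sub]

theorem adJ_entry (A : Band R) (p q : ℤ) :
    (adJ A).entry p q = ((if p ≤ 0 then 1 else 0) - (if q ≤ 0 then 1 else 0)) * A.entry p q := by
  change (J * A - A * J).entry p q = _
  rw [sub_entry, J_mul_entry, mul_J_entry, sub_mul]

/-- Matrices with finitely many non-zero entries. -/
def finiteSupport : Submodule ℂ (Band R) where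
  carrier := {A | ∃ c : ℤ, ∀ p q, A.entry p q ≠ 0 → |p| ≤ c ∧ |q| ≤ c}
  zero_mem' := ⟨0, fun p q h => absurd rfl h⟩
  add_mem' := by
    rintro A B ⟨a, ha⟩ ⟨b, hb⟩
    refine ⟨max a b, fun p q h => ?_⟩
    by_cases h1 : A.entry p q = 0
    · have := hb p q fun h2 => h (by simp [h1, h2])
      exact ⟨this.1.trans (le_max_right _ _), this.2.trans (le_max_right _ _)⟩
    · have := ha p q h1
      exact ⟨this.1.trans (le_max_left _ _), this.2.trans (le_max_left _ _)⟩
  smul_mem' := by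
    rintro c A ⟨a, ha⟩
    exact ⟨a, fun p q h => ha p q fun h0 => h (by simp [h0])⟩

theorem diag_finite {A : Band R} (hA : A ∈ finiteSupport) :
    (Function.support fun p : ℤ => sgn (p : ZMod 2) • A.entry p p).Finite := by
  obtain ⟨a, ha⟩ := hA
  refine (Set.finite_Icc (-a) a).subset fun p hp => ?_
  refine abs_le.1 (ha p p fun h => hp ?_).1
  simp [h]

theorem sgn_mul_sgn_smul (α : ZMod 2) (x : R) : sgn α • sgn α • x = x := by
  rw [smul_smul, sgn_mul_self, one_smul]

/-- An entry of a homogeneous matrix vanishes off its parity. -/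
theorem entry_eq_zero_of_parity {A : Band R} {α : ZMod 2} (hA : parity A = sgn α • A) {p q : ℤ}
    (h : ((p - q : ℤ) : ZMod 2) ≠ α) : A.entry p q = 0 := by
  have h1 : (parity A).entry p q = (sgn α • A).entry p q := by rw [hA]
  simp only [parity_entry, smul_entry] at h1
  have key : ∀ β γ : ZMod 2, β ≠ γ → sgn β = -sgn γ := by
    intro β γ hne
    rcases ZMod2_cases β with rfl | rfl <;> rcases ZMod2_cases γ with rfl | rfl <;>
      simp_all [sgn]
  rw [key _ _ h, neg_smul] at h1
  have h2 : (2 : ℂ) • sgn α • A.entry p q = 0 := by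
    rw [two_smul]; nth_rewrite 1 [← h1]; simp
  have h3 : sgn α • A.entry p q = 0 := (smul_eq_zero_iff_right two_ne_zero).1 h2
  rw [← sgn_mul_sgn_smul α (A.entry p q), h3, smul_zero]

theorem str_comm' (α β : ZMod 2) (x y : Band R) (hx : parity x = sgn α • x)
    (hy : parity y = sgn β • y) (hI : x ∈ finiteSupport) :
    str (x * y) = sgn (α * β) • str (y * x) := by
  obtain ⟨c, hc⟩ := hI
  set s := Finset.Icc (-c) c
  have e1 : str (x * y) = ∑ p ∈ s, ∑ l ∈ s, sgn (p : ZMod 2) • (x.entry p l * y.entry l p) := by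
    rw [str, finsum_eq_sum_of_support_subset (s := s)]
    · refine Finset.sum_congr rfl fun p _ => ?_
      rw [mul_entry_eq_sum x y p p s, Finset.smul_sum]
      intro l hl
      exact Finset.mem_Icc.2 (abs_le.1 (hc p l hl).2)
    · intro p hp
      by_contra h
      refine hp ?_
      have : (x * y).entry p p = 0 := by
        rw [mul_entry]
        refine (finsum_congr fun l => ?_).trans finsum_zero
        have : x.entry p l = 0 := by
          by_contra h0
          exact h (Finset.mem_coe.2 (Finset.mem_Icc.2 (abs_le.1 (hc p l h0).1)))
        rw [this, zero_mul]
      simp [this]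
  have e2 : str (y * x) = ∑ p ∈ s, ∑ l ∈ s, sgn (p : ZMod 2) • (y.entry p l * x.entry l p) := by
    rw [str, finsum_eq_sum_of_support_subset (s := s)]
    · refine Finset.sum_congr rfl fun p _ => ?_
      rw [mul_entry_eq_sum' y x p p s, Finset.smul_sum]
      intro l hl
      exact Finset.mem_Icc.2 (abs_le.1 (hc l p hl).1)
    · intro p hp
      by_contra h
      refine hp ?_
      have : (y * x).entry p p = 0 := by
        rw [mul_entry]
        refine (finsum_congr fun l => ?_).trans finsum_zero
        have : x.entry l p = 0 := by
          by_contra h0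
          exact h (Finset.mem_coe.2 (Finset.mem_Icc.2 (abs_le.1 (hc l p h0).2)))
        rw [this, mul_zero]
      simp [this]
  rw [e1, e2, Finset.smul_sum, Finset.sum_comm]
  refine Finset.sum_congr rfl fun l _ => ?_
  rw [Finset.smul_sum]
  refine Finset.sum_congr rfl fun p _ => ?_
  by_cases hp : ((p - l : ℤ) : ZMod 2) = α
  · by_cases hl : ((l - p : ℤ) : ZMod 2) = β
    · have : sgn (p : ZMod 2) = sgn (α * β) * sgn (l : ZMod 2) := by
        rw [← hp, ← hl]
        push_cast
        generalize (p : ZMod 2) = p'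
        generalize (l : ZMod 2) = l'
        have h2 : (1 + 1 : ZMod 2) = 0 := by decide
        rcases ZMod2_cases p' with rfl | rfl <;> rcases ZMod2_cases l' with rfl | rfl <;>
          simp [sgn]
      rw [this, mul_comm (x.entry p l), mul_smul]
    · rw [entry_eq_zero_of_parity hy hl]; simp
  · rw [entry_eq_zero_of_parity hx hp]; simp

theorem mul_mem_finiteSupport_left (x y : Band R) (hx : x ∈ finiteSupport) :
    x * y ∈ finiteSupport := by
  obtain ⟨c, hc⟩ := hx
  obtain ⟨b, hb⟩ := y.isBand
  refine ⟨c + |b|, fun p q h => ?_⟩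
  obtain ⟨l, hl⟩ := exists_ne_zero h
  have h1 := hc p l (left_ne_zero_of_mul hl)
  have h2 := hb l q (right_ne_zero_of_mul hl)
  have h3 := le_abs_self b
  have h4 := abs_nonneg b
  have h5 := abs_sub_abs_le_abs_sub q l
  rw [abs_sub_comm q l] at h5
  constructor <;> linarith [h1.1, h1.2]

theorem mul_mem_finiteSupport_right (x y : Band R) (hy : y ∈ finiteSupport) :
    x * y ∈ finiteSupport := by
  obtain ⟨c, hc⟩ := hy
  obtain ⟨b, hb⟩ := x.isBand
  refine ⟨c + |b|, fun p q h => ?_⟩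
  obtain ⟨l, hl⟩ := exists_ne_zero h
  have h1 := hc l q (right_ne_zero_of_mul hl)
  have h2 := hb p l (left_ne_zero_of_mul hl)
  have h3 := le_abs_self b
  have h4 := abs_nonneg b
  have h5 := abs_sub_abs_le_abs_sub p l
  constructor <;> linarith [h1.1, h1.2]

theorem adJ_mem (x : Band R) : adJ x ∈ finiteSupport := by
  obtain ⟨b, hb⟩ := x.isBand
  refine ⟨b, fun p q h => ?_⟩
  rw [adJ_entry] at h
  have h1 := abs_le.1 (hb p q (right_ne_zero_of_mul h))
  have h2 := left_ne_zero_of_mul h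
  have h3 : (p ≤ 0 ∧ 0 < q) ∨ (0 < p ∧ q ≤ 0) := by
    by_contra h4
    apply h2
    split_ifs <;> first | omega | simp
  rw [abs_le, abs_le]
  omega

/-- The data of the central extension by the cocycle `Str ([J, A] B)` with values in `R`. -/
noncomputable def traceData (R : Type*) [CommRing R] [Algebra ℂ R] : TraceData (Band R) R where
  σ := parity
  σ_σ x := by ext; simp [smul_smul, sgn_mul_self]
  σ_mul x y := by
    ext p q
    simp only [parity_entry, mul_entry]
    rw [smul_finsum' _ (mul_finite x y p q)]
    refine finsum_congr fun l => ?_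
    rw [smul_mul_smul_comm, ← sgn_add, ← Int.cast_add, sub_add_sub_cancel]
  D := adJ
  D_mul x y := by
    change J * (x * y) - x * y * J = (J * x - x * J) * y + x * (J * y - y * J)
    simp only [sub_mul, mul_sub, mul_assoc]
    abel
  σ_D x := by
    ext p q
    simp [adJ_entry]
  I := finiteSupport
  D_mem := adJ_mem
  mul_mem_left := mul_mem_finiteSupport_left
  mul_mem_right := mul_mem_finiteSupport_right
  str := str
  str_add x y hx hy := by
    simp only [str, add_entry, smul_add]
    exact finsum_add_distrib (diag_finite hx) (diag_finite hy)
  str_smul c x hx := by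
    simp only [str, smul_entry]
    rw [smul_finsum' _ (diag_finite hx)]
    exact finsum_congr fun p => smul_comm _ _ _
  str_σ x _ := by simp [str, sgn]
  str_D x := by simp [str, adJ_entry]
  str_comm := str_comm'

end Band

/-- The truncated polynomial algebra `R_m = ℂ[t] / (t^{m+1})`. -/
abbrev TruncPoly (m : ℕ) : Type :=
  Polynomial ℂ ⧸ Ideal.span {(Polynomial.X : Polynomial ℂ) ^ (m + 1)}

/-- The central extension of `gl_{∞|∞}[m]` by `R_m`: pairs of a band matrix over `R_m` and an
element of `R_m`. -/
def GlHat (m : ℕ) : Type := Band (TruncPoly m) × TruncPoly m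

namespace GlHat

noncomputable instance (m : ℕ) : AddCommGroup (GlHat m) :=
  inferInstanceAs (AddCommGroup (Band (TruncPoly m) × TruncPoly m))
noncomputable instance (m : ℕ) : Module ℂ (GlHat m) :=
  inferInstanceAs (Module ℂ (Band (TruncPoly m) × TruncPoly m))
/-- The bracket is `[(A, c), (B, d)] = ([A, B], Str ([J, A] B))`. -/
noncomputable instance (m : ℕ) : LieSuperalgebra (GlHat m) :=
  (Band.traceData (TruncPoly m)).lieSuperalgebra

/-- The principal gradation: `E_{pq}` has degree `(q - p) / 2`, the centre `R_m` has degree `0`.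
The submodule `gr m n` is the part of degree `n / 2`. -/
def gr (m : ℕ) (n : ℤ) : Submodule ℂ (GlHat m) where
  carrier := {x | (∀ p q, q - p ≠ n → x.1.entry p q = 0) ∧ (n ≠ 0 → x.2 = 0)}
  zero_mem' := ⟨fun _ _ _ => rfl, fun _ => rfl⟩
  add_mem' := by
    rintro x y ⟨hx, hx'⟩ ⟨hy, hy'⟩
    refine ⟨fun p q h => ?_, fun h => ?_⟩
    · change x.1.entry p q + y.1.entry p q = 0
      rw [hx p q h, hy p q h, add_zero]
    · change x.2 + y.2 = 0
      rw [hx' h, hy' h, add_zero]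
  smul_mem' := by
    rintro c x ⟨hx, hx'⟩
    refine ⟨fun p q h => ?_, fun h => ?_⟩
    · change c • x.1.entry p q = 0
      rw [hx p q h, smul_zero]
    · change c • x.2 = 0
      rw [hx' h, smul_zero]

end GlHat

/-! The Lie superalgebra of quantum pseudo-differential operators. -/

/-- The associative superalgebra of `2 × 2` supermatrices of quantum pseudo-differential operators.
It has the basis `z^r T_q^k M_{ij}`, indexed by `(r, k, i, j)`. Here `0 : Fin 2` and `1 : Fin 2`
stand for the matrix indices `1` and `2`. -/
structure QOp (q : ℂˣ) where
  coeff : (ℤ × ℤ × Fin 2 × Fin 2) →₀ ℂ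

namespace QOp

variable {q : ℂˣ}

/-- Index set of the basis. -/
abbrev Idx : Type := ℤ × ℤ × Fin 2 × Fin 2

@[ext] theorem ext {x y : QOp q} (h : x.coeff = y.coeff) : x = y := by
  cases x; cases y; congr

theorem coeff_injective : Function.Injective (QOp.coeff (q := q)) := fun _ _ h => ext h

instance : Zero (QOp q) := ⟨⟨0⟩⟩
noncomputable instance : Add (QOp q) := ⟨fun x y => ⟨x.coeff + y.coeff⟩⟩
noncomputable instance : Neg (QOp q) := ⟨fun x => ⟨-x.coeff⟩⟩
noncomputable instance : Sub (QOp q) := ⟨fun x y => ⟨x.coeff - y.coeff⟩⟩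
noncomputable instance : SMul ℂ (QOp q) := ⟨fun c x => ⟨c • x.coeff⟩⟩
noncomputable instance : SMul ℕ (QOp q) := ⟨fun c x => ⟨c • x.coeff⟩⟩
noncomputable instance : SMul ℤ (QOp q) := ⟨fun c x => ⟨c • x.coeff⟩⟩

noncomputable instance : AddCommGroup (QOp q) :=
  coeff_injective.addCommGroup QOp.coeff rfl (fun _ _ => rfl) (fun _ => rfl) (fun _ _ => rfl)
    (fun _ _ => rfl) (fun _ _ => rfl)

/-- The coefficients, as an additive map. -/
noncomputable def coeffHom : QOp q →+ (Idx →₀ ℂ) where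
  toFun := QOp.coeff
  map_zero' := rfl
  map_add' _ _ := rfl

noncomputable instance : Module ℂ (QOp q) :=
  coeff_injective.module ℂ coeffHom (fun _ _ => rfl)

/-- The linear identification with the space of coefficients. -/
noncomputable def equiv (q : ℂˣ) : QOp q ≃ₗ[ℂ] (Idx →₀ ℂ) where
  toFun := QOp.coeff
  invFun f := ⟨f⟩
  map_add' _ _ := rfl
  map_smul' _ _ := rfl

/-- The basis element `z^r T_q^k M_{ij}`. -/
noncomputable def mono (q : ℂˣ) (r k : ℤ) (i j : Fin 2) : QOp q :=
  ⟨Finsupp.single (r, k, i, j) 1⟩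

/-- The basis of the elements `z^r T_q^k M_{ij}`. -/
noncomputable def basis (q : ℂˣ) : Module.Basis Idx ℂ (QOp q) := ⟨equiv q⟩

@[simp] theorem basis_apply (q : ℂˣ) (x : Idx) :
    basis q x = mono q x.1 x.2.1 x.2.2.1 x.2.2.2 := by
  apply (equiv q).injective
  exact (equiv q).apply_symm_apply _

theorem constr_mono {E : Type*} [AddCommGroup E] [Module ℂ E] (f : Idx → E) (r k : ℤ)
    (i j : Fin 2) : (basis q).constr ℂ f (mono q r k i j) = f (r, k, i, j) := by
  have h := (basis q).constr_basis ℂ f (r, k, i, j)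
  rwa [basis_apply] at h

/-- The bilinear product with
`(z^r T^k M_{ij}) (z^{r'} T^{k'} M_{i'j'}) = δ_{j i'} q^{k r'} z^{r+r'} T^{k+k'} M_{ij'}`. -/
noncomputable def mulLin (q : ℂˣ) : QOp q →ₗ[ℂ] QOp q →ₗ[ℂ] QOp q :=
  (basis q).constr ℂ fun x => (basis q).constr ℂ fun y =>
    if x.2.2.2 = y.2.2.1 then
      ((q : ℂ) ^ (x.2.1 * y.1)) • mono q (x.1 + y.1) (x.2.1 + y.2.1) x.2.2.1 y.2.2.2
    else 0

theorem mulLin_mono (r k r' k' : ℤ) (i j i' j' : Fin 2) :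
    mulLin q (mono q r k i j) (mono q r' k' i' j') =
      if j = i' then ((q : ℂ) ^ (k * r')) • mono q (r + r') (k + k') i j' else 0 := by
  simp [mulLin, constr_mono]

noncomputable instance : Mul (QOp q) := ⟨fun x y => mulLin q x y⟩

theorem mono_mul_mono (r k r' k' : ℤ) (i j i' j' : Fin 2) :
    mono q r k i j * mono q r' k' i' j' =
      if j = i' then ((q : ℂ) ^ (k * r')) • mono q (r + r') (k + k') i j' else 0 :=
  mulLin_mono r k r' k' i j i' j'

/-- Two linear maps agree if they agree on the basis. -/
theorem linear_ext {E : Type*} [AddCommGroup E] [Module ℂ E] {f g : QOp q →ₗ[ℂ] E}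
    (h : ∀ r k i j, f (mono q r k i j) = g (mono q r k i j)) (x : QOp q) : f x = g x := by
  have : f = g := (basis q).ext fun x => by rw [basis_apply]; exact h _ _ _ _
  rw [this]

theorem bilinear_ext {E : Type*} [AddCommGroup E] [Module ℂ E]
    {f g : QOp q →ₗ[ℂ] QOp q →ₗ[ℂ] E}
    (h : ∀ r k i j r' k' i' j', f (mono q r k i j) (mono q r' k' i' j') =
      g (mono q r k i j) (mono q r' k' i' j')) (x y : QOp q) : f x y = g x y := by
  refine linear_ext (f := f x) (g := g x) (fun r' k' i' j' => ?_) y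
  exact linear_ext (f := f.flip (mono q r' k' i' j')) (g := g.flip (mono q r' k' i' j'))
    (fun r k i j => h r k i j r' k' i' j') x

theorem mulLin_assoc (x y z : QOp q) :
    mulLin q (mulLin q x y) z = mulLin q x (mulLin q y z) := by
  refine linear_ext (f := mulLin q (mulLin q x y)) (g := (mulLin q x).comp (mulLin q y))
    (fun r k i j => ?_) z
  refine bilinear_ext (f := (mulLin q).compr₂ ((mulLin q).flip (mono q r k i j)))
    (g := (mulLin q).compl₂ ((mulLin q).flip (mono q r k i j))) ?_ x y
  intro a b c d a' b' c' d'
  simp only [LinearMap.compr₂_apply, LinearMap.compl₂_apply, LinearMap.flip_apply, mulLin_mono]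
  by_cases h1 : d = c' <;> by_cases h2 : d' = i <;> simp [h1, h2, mulLin_mono]
  rw [smul_smul, smul_smul, ← zpow_add₀ q.ne_zero, ← zpow_add₀ q.ne_zero, add_assoc, add_assoc]
  congr 2
  ring

noncomputable instance : NonUnitalRing (QOp q) where
  left_distrib x y z := map_add (mulLin q x) y z
  right_distrib x y z := by
    change mulLin q (x + y) z = mulLin q x z + mulLin q y z
    simp
  zero_mul x := by
    change mulLin q 0 x = 0
    simp
  mul_zero x := map_zero (mulLin q x)
  mul_assoc x y z := mulLin_assoc x y z

instance : IsScalarTower ℂ (QOp q) (QOp q) := ⟨fun c x y => by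
  change mulLin q (c • x) y = c • mulLin q x y
  simp⟩

instance : SMulCommClass ℂ (QOp q) (QOp q) := ⟨fun c x y => by
  change c • mulLin q x y = mulLin q x (c • y)
  simp⟩

/-- The parity of `M_{ij}`: `M_{11}`, `M_{22}` are even and `M_{12}`, `M_{21}` are odd. -/
def mParity (i j : Fin 2) : ZMod 2 := if i = j then 0 else 1

theorem mParity_add (i j k : Fin 2) : mParity i j + mParity j k = mParity i k := by
  revert i j k; decide

/-- The sign `1` for the matrix index `1` and `-1` for the matrix index `2`. -/
def mSign (i : Fin 2) : ℂ := if i = 0 then 1 else -1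

theorem mSign_eq (i j : Fin 2) : mSign i = sgn (mParity i j) * mSign j := by
  have h : ∀ k : Fin 2, k = 0 ∨ k = 1 := by decide
  rcases h i with rfl | rfl <;> rcases h j with rfl | rfl <;> simp [mSign, mParity, sgn]

/-- The parity involution. -/
noncomputable def parity (q : ℂˣ) : QOp q →ₗ[ℂ] QOp q :=
  (basis q).constr ℂ fun x =>
    sgn (mParity x.2.2.1 x.2.2.2) • mono q x.1 x.2.1 x.2.2.1 x.2.2.2

@[simp] theorem parity_mono (r k : ℤ) (i j : Fin 2) :
    parity q (mono q r k i j) = sgn (mParity i j) • mono q r k i j := by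
  simp [parity, constr_mono]

/-- The derivation `z d/dz`: it multiplies `z^r f(T_q) M_{ij}` by `r`. -/
noncomputable def zdz (q : ℂˣ) : QOp q →ₗ[ℂ] QOp q :=
  (basis q).constr ℂ fun x => (x.1 : ℂ) • mono q x.1 x.2.1 x.2.2.1 x.2.2.2

@[simp] theorem zdz_mono (r k : ℤ) (i j : Fin 2) :
    zdz q (mono q r k i j) = (r : ℂ) • mono q r k i j := by
  simp [zdz, constr_mono]

/-- The supertrace `Str_0`, extended by zero to the terms with `z^r`, `r ≠ 0`: the constant
coefficient of the `M_{11}` entry minus that of the `M_{22}` entry. -/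
noncomputable def str₀ (q : ℂˣ) : QOp q →ₗ[ℂ] ℂ :=
  (basis q).constr ℂ fun x =>
    if x.1 = 0 ∧ x.2.1 = 0 ∧ x.2.2.1 = x.2.2.2 then mSign x.2.2.1 else 0

@[simp] theorem str₀_mono (r k : ℤ) (i j : Fin 2) :
    str₀ q (mono q r k i j) =
      if r = 0 ∧ k = 0 ∧ i = j then mSign i else 0 := by
  simp [str₀, constr_mono]

theorem str₀_mul_comm (x y : QOp q) : str₀ q (x * y) = str₀ q (y * parity q x) := by
  refine bilinear_ext (f := (mulLin q).compr₂ (str₀ q))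
    (g := ((mulLin q).flip.comp (parity q)).compr₂ (str₀ q)) ?_ x y
  intro r k i j r' k' i' j'
  simp only [LinearMap.compr₂_apply, LinearMap.comp_apply, LinearMap.flip_apply, parity_mono,
    map_smul, LinearMap.smul_apply, mulLin_mono]
  by_cases h1 : j = i'
  · by_cases h2 : j' = i
    · subst h1 h2
      simp only [if_true, map_smul, str₀_mono, and_true]
      by_cases h3 : r + r' = 0 ∧ k + k' = 0
      · have h4 : r' + r = 0 ∧ k' + k = 0 := ⟨by omega, by omega⟩
        have h5 : k * r' = k' * r := by
          rw [show k' = -k by omega, show r' = -r by omega]; ring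
        rw [if_pos h3, if_pos h4, h5]
        rw [mSign_eq j' j, smul_eq_mul, smul_eq_mul, smul_eq_mul]
        ring
      · have h4 : ¬(r' + r = 0 ∧ k' + k = 0) := by omega
        rw [if_neg h3, if_neg h4]; simp
    · have h3 : ¬(i = j') := fun e => h2 e.symm
      simp [h1, h2, h3]
  · by_cases h2 : j' = i
    · have h3 : ¬(i' = j) := fun e => h1 e.symm
      simp [h1, h2, h3]
    · simp [h1, h2]

/-- The data of the central extension by `ℂ`. The cocycle is `(x, y) ↦ Str_0 ((z d/dz x) y)`. -/
noncomputable def traceData (q : ℂˣ) : TraceData (QOp q) ℂ where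
  σ := parity q
  σ_σ x := by
    refine linear_ext (f := (parity q).comp (parity q)) (g := LinearMap.id) (fun r k i j => ?_) x
    simp [smul_smul, sgn_mul_self]
  σ_mul x y := by
    refine bilinear_ext (f := (mulLin q).compr₂ (parity q))
      (g := (mulLin q).compl₁₂ (parity q) (parity q)) ?_ x y
    intro r k i j r' k' i' j'
    simp only [LinearMap.compr₂_apply, LinearMap.compl₁₂_apply, parity_mono, map_smul,
      LinearMap.smul_apply, mulLin_mono]
    by_cases h1 : j = i'
    · subst h1
      simp only [if_true, map_smul, parity_mono]
      rw [smul_comm, smul_smul (sgn (mParity j j'))]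
      congr 2
      rw [← sgn_add, add_comm, mParity_add]
    · simp [h1]
  D := zdz q
  D_mul x y := by
    refine bilinear_ext (f := (mulLin q).compr₂ (zdz q))
      (g := (mulLin q).comp (zdz q) + (mulLin q).compl₂ (zdz q)) ?_ x y
    intro r k i j r' k' i' j'
    simp only [LinearMap.compr₂_apply, LinearMap.compl₂_apply, LinearMap.add_apply, zdz_mono,
      map_smul, LinearMap.smul_apply, mulLin_mono, LinearMap.comp_apply]
    by_cases h1 : j = i'
    · simp only [if_pos h1, map_smul, zdz_mono]
      push_cast
      module
    · simp [h1]
  σ_D x := by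
    refine linear_ext (f := (parity q).comp (zdz q)) (g := (zdz q).comp (parity q))
      (fun r k i j => ?_) x
    simp only [LinearMap.comp_apply, zdz_mono, parity_mono, map_smul]
    rw [smul_comm]
  I := ⊤
  D_mem _ := trivial
  mul_mem_left _ _ _ := trivial
  mul_mem_right _ _ _ := trivial
  str := str₀ q
  str_add x y _ _ := map_add _ x y
  str_smul c x _ := map_smul _ c x
  str_σ x _ := by
    refine linear_ext (f := (str₀ q).comp (parity q)) (g := str₀ q) (fun r k i j => ?_) x
    by_cases h : i = j <;> simp [h, sgn, mParity]
  str_D x := by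
    refine linear_ext (f := (str₀ q).comp (zdz q)) (g := 0) (fun r k i j => ?_) x
    by_cases h : r = 0 <;> simp [h]
  str_comm α β x y hx hy _ := by
    have h1 := str₀_mul_comm x y
    have h2 := str₀_mul_comm y x
    rw [hx, mul_smul_comm, map_smul] at h1
    rw [hy, mul_smul_comm, map_smul] at h2
    rcases ZMod2_cases β with rfl | rfl
    · rw [mul_zero, h2]; simp [sgn]
    · rw [mul_one, h1]

/-- For `r > 0` the cocycle is
`Str_0 ((1 + σ + ⋯ + σ^{r-1}) (σ^{-r} (f(T_q) M_{ij}) g(T_q) M_{i'j'}))` on `z^r f(T_q) M_{ij}`,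
`z^{-r} g(T_q) M_{i'j'}`, where `σ` substitutes `q T_q` for `T_q`; written out for
`f = w^k`, `g = w^{k'}`. -/
theorem cocycle_eq_sum (r : ℕ) (k k' : ℤ) (i j i' j' : Fin 2) :
    (traceData q).cocycle (mono q r k i j) (mono q (-r) k' i' j') =
      if k + k' = 0 ∧ j = i' ∧ i = j' then
        mSign i * ∑ n ∈ Finset.range r,
          ((q : ℂ) ^ (-(r : ℤ) + n)) ^ k * ((q : ℂ) ^ (n : ℤ)) ^ k' else 0 := by
  change str₀ q (zdz q (mono q r k i j) * mono q (-r) k' i' j') = _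
  rw [zdz_mono, smul_mul_assoc, map_smul, mono_mul_mono]
  by_cases h : k + k' = 0 ∧ j = i' ∧ i = j'
  · rw [if_pos h]
    obtain ⟨h1, rfl, rfl⟩ := h
    rw [if_pos rfl, map_smul, str₀_mono, if_pos ⟨by ring, h1, rfl⟩]
    have : ∀ n ∈ Finset.range r, ((q : ℂ) ^ (-(r : ℤ) + n)) ^ k * ((q : ℂ) ^ (n : ℤ)) ^ k' =
        (q : ℂ) ^ (k * -(r : ℤ)) := by
      intro n _
      rw [← zpow_mul, ← zpow_mul, ← zpow_add₀ q.ne_zero, show k' = -k by omega]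
      congr 1; ring
    rw [Finset.sum_congr rfl this]
    simp only [smul_eq_mul, Finset.sum_const, Finset.card_range, nsmul_eq_mul, Int.cast_natCast]
    ring
  · rw [if_neg h]
    by_cases h1 : j = i'
    · rw [if_pos h1, map_smul, str₀_mono, if_neg]
      · simp
      · rintro ⟨_, h2, h3⟩
        exact h ⟨h2, h1, h3⟩
    · rw [if_neg h1]; simp

end QOp

/-- The central extension of the Lie superalgebra of quantum pseudo-differential operators by the
line spanned by `C = (0, 1)`. -/
def SHat (q : ℂˣ) : Type := QOp q × ℂ

namespace SHat

noncomputable instance (q : ℂˣ) : AddCommGroup (SHat q) :=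
  inferInstanceAs (AddCommGroup (QOp q × ℂ))
noncomputable instance (q : ℂˣ) : Module ℂ (SHat q) := inferInstanceAs (Module ℂ (QOp q × ℂ))
noncomputable instance (q : ℂˣ) : LieSuperalgebra (SHat q) := (QOp.traceData q).lieSuperalgebra

end SHat

/-! The homomorphism from quantum pseudo-differential operators to matrices. -/

/-- `q^{c t} = ∑_{l ≤ m} (c log q)^l t^l / l!` in `R_m`, where `ℓ` is the chosen value of `log q`. -/
noncomputable def qPowT (ℓ : ℂ) (m : ℕ) (c : ℂ) : TruncPoly m :=
  ∑ l ∈ Finset.range (m + 1), ((c * ℓ) ^ l / (l.factorial : ℂ)) •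
    (Ideal.Quotient.mk (Ideal.span {(Polynomial.X : Polynomial ℂ) ^ (m + 1)}) Polynomial.X) ^ l

theorem qPowT_eq_exp (ℓ : ℂ) (m : ℕ) (c : ℂ) :
    qPowT ℓ m c = IsNilpotent.exp ((c * ℓ) • (Ideal.Quotient.mk
      (Ideal.span {(Polynomial.X : Polynomial ℂ) ^ (m + 1)}) Polynomial.X)) := by
  have h : ((c * ℓ) • (Ideal.Quotient.mk
      (Ideal.span {(Polynomial.X : Polynomial ℂ) ^ (m + 1)}) Polynomial.X)) ^ (m + 1) = 0 := by
    rw [smul_pow, ← map_pow, Ideal.Quotient.eq_zero_iff_mem.2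
      (Ideal.mem_span_singleton_self _), smul_zero]
  rw [IsNilpotent.exp_eq_sum h, qPowT]
  refine Finset.sum_congr rfl fun l _ => ?_
  rw [smul_pow, div_eq_inv_mul, mul_smul]
  generalize (c * ℓ) ^ l • (_ : TruncPoly m) = y
  rw [← Rat.cast_smul_eq_qsmul ℂ]
  simp

theorem qPowT_add (ℓ : ℂ) (m : ℕ) (c d : ℂ) :
    qPowT ℓ m (c + d) = qPowT ℓ m c * qPowT ℓ m d := by
  have h : ∀ c : ℂ, IsNilpotent ((c * ℓ) • (Ideal.Quotient.mk
      (Ideal.span {(Polynomial.X : Polynomial ℂ) ^ (m + 1)}) Polynomial.X)) := fun c =>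
    ⟨m + 1, by rw [smul_pow, ← map_pow, Ideal.Quotient.eq_zero_iff_mem.2
      (Ideal.mem_span_singleton_self _), smul_zero]⟩
  rw [qPowT_eq_exp, qPowT_eq_exp, qPowT_eq_exp, add_mul, add_smul,
    IsNilpotent.exp_add_of_commute (Commute.all _ _) (h c) (h d)]

/-- `E_{ij}` (`i`, `j` integers) tensored with `M_{ab}` is the matrix unit with doubled indices
`pos a i`, `pos b j`: the index `j ∈ ℤ` goes to `j` in the first block and to `j - 1/2` in the
second one. -/
def pos (e : Fin 2) (n : ℤ) : ℤ := 2 * n - ((e : ℕ) : ℤ)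

theorem pos_inj {e e' : Fin 2} {n n' : ℤ} : pos e n = pos e' n' ↔ e = e' ∧ n = n' := by
  have h1 := e.isLt
  have h2 := e'.isLt
  rw [Fin.ext_iff]
  unfold pos
  omega

theorem exists_pos (p : ℤ) : ∃ e n, p = pos e n := by
  rcases Int.even_or_odd' p with ⟨n, h | h⟩
  · exact ⟨0, n, by simp [pos, h]⟩
  · exact ⟨1, n + 1, by simp [pos, h]; ring⟩

theorem pos_nonpos {e : Fin 2} {n : ℤ} : pos e n ≤ 0 ↔ n ≤ 0 := by
  have h1 := e.isLt
  unfold pos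
  omega

theorem pos_div (e : Fin 2) (n : ℤ) : (pos e n + ((e : ℕ) : ℤ)) / 2 = n := by
  unfold pos; omega

section Hom

variable (q : ℂˣ) (ℓ a : ℂ) (m : ℕ)

/-- The value `(s q^{-n+t})^k = s^k q^{-nk} q^{kt}` of `w^k` at `s q^{-n+t}`, with
`s = q^a = exp (a log q)`. -/
noncomputable def evalPow (k n : ℤ) : TruncPoly m :=
  (Complex.exp (ℓ * a) ^ k * (q : ℂ) ^ (-n * k)) • qPowT ℓ m k

/-- The matrix `∑_n (s q^{-n+t})^k E_{n-r,n} ⊗ M_{ij}`, the image of `z^r T_q^k M_{ij}`. -/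
noncomputable def phiMono (r k : ℤ) (i j : Fin 2) : Band (TruncPoly m) where
  entry p l :=
    let n := (l + ((j : ℕ) : ℤ)) / 2
    if l = pos j n ∧ p = pos i (n - r) then evalPow q ℓ a m k n else 0
  isBand := by
    refine ⟨2 * |r| + 1, fun p l h => ?_⟩
    have h1 : l = pos j ((l + ((j : ℕ) : ℤ)) / 2) ∧ p = pos i ((l + ((j : ℕ) : ℤ)) / 2 - r) := by
      by_contra h2
      exact h (if_neg h2)
    obtain ⟨h1, h2⟩ := h1
    generalize (l + ((j : ℕ) : ℤ)) / 2 = n at h1 h2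
    subst h1 h2
    have := i.isLt
    have := j.isLt
    have := le_abs_self r
    have := neg_abs_le r
    rw [abs_le]
    unfold pos
    omega

theorem phiMono_entry (r k : ℤ) (i j e : Fin 2) (p n : ℤ) :
    (phiMono q ℓ a m r k i j).entry p (pos e n) =
      if e = j ∧ p = pos i (n - r) then evalPow q ℓ a m k n else 0 := by
  change (if pos e n = pos j ((pos e n + ((j : ℕ) : ℤ)) / 2) ∧
    p = pos i ((pos e n + ((j : ℕ) : ℤ)) / 2 - r) then _ else _) = _
  by_cases h : e = j
  · subst h
    rw [pos_div]
    simp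
  · rw [if_neg, if_neg]
    · exact fun h' => h h'.1
    · exact fun h' => h (pos_inj.1 h'.1).1

/-- The embedding `φ_s^{[m]}` of the associative superalgebras. -/
noncomputable def phi : QOp q →ₗ[ℂ] Band (TruncPoly m) :=
  (QOp.basis q).constr ℂ fun x => phiMono q ℓ a m x.1 x.2.1 x.2.2.1 x.2.2.2

theorem phi_mono (r k : ℤ) (i j : Fin 2) :
    phi q ℓ a m (QOp.mono q r k i j) = phiMono q ℓ a m r k i j := by
  simp [phi, QOp.constr_mono]

theorem evalPow_mul (k k' r n : ℤ) :
    evalPow q ℓ a m k (n - r) * evalPow q ℓ a m k' n =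
      ((q : ℂ) ^ (k * r)) • evalPow q ℓ a m (k + k') n := by
  unfold evalPow
  rw [smul_mul_smul_comm, ← qPowT_add, smul_smul, Int.cast_add]
  congr 1
  rw [zpow_add₀ (Complex.exp_ne_zero _), show -(n - r) * k = k * r + -n * k by ring,
    show -n * (k + k') = -n * k + -n * k' by ring, zpow_add₀ q.ne_zero, zpow_add₀ q.ne_zero]
  ring

theorem phiMono_mul (r k r' k' : ℤ) (i j i' j' : Fin 2) :
    phiMono q ℓ a m r k i j * phiMono q ℓ a m r' k' i' j' =
      if j = i' then ((q : ℂ) ^ (k * r')) • phiMono q ℓ a m (r + r') (k + k') i j' else 0 := by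
  ext p l
  obtain ⟨e, n, rfl⟩ := exists_pos l
  rw [Band.mul_entry_eq_sum' _ _ p (pos e n) {pos i' (n - r')}]
  · rw [Finset.sum_singleton, phiMono_entry, phiMono_entry]
    by_cases h1 : j = i'
    · subst h1
      simp only [if_true, true_and, Band.smul_entry, phiMono_entry, sub_sub, add_comm r' r]
      by_cases h2 : e = j' <;> by_cases h3 : p = pos i (n - (r + r')) <;>
        simp [h2, h3, evalPow_mul]
    · have h2 : ¬(i' = j) := fun h => h1 h.symm
      simp [h1, h2]
  · intro u hu
    rw [phiMono_entry] at hu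
    by_contra h
    exact hu (if_neg fun h' => h (by simp [h'.2]))

theorem phi_mul (x y : QOp q) : phi q ℓ a m (x * y) = phi q ℓ a m x * phi q ℓ a m y := by
  refine QOp.bilinear_ext (f := (QOp.mulLin q).compr₂ (phi q ℓ a m))
    (g := (LinearMap.mul ℂ (Band (TruncPoly m))).compl₁₂ (phi q ℓ a m) (phi q ℓ a m)) ?_ x y
  intro r k i j r' k' i' j'
  simp only [LinearMap.compr₂_apply, LinearMap.compl₁₂_apply, QOp.mulLin_mono, phi_mono,
    LinearMap.mul_apply', phiMono_mul]
  by_cases h : j = i' <;> simp [h, phi_mono]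

theorem phi_parity (x : QOp q) : phi q ℓ a m (QOp.parity q x) = Band.parity (phi q ℓ a m x) := by
  refine QOp.linear_ext (f := (phi q ℓ a m).comp (QOp.parity q))
    (g := Band.parity.comp (phi q ℓ a m)) (fun r k i j => ?_) x
  simp only [LinearMap.comp_apply, QOp.parity_mono, map_smul, phi_mono]
  ext p l
  obtain ⟨e, n, rfl⟩ := exists_pos l
  rw [Band.smul_entry, Band.parity_entry, phiMono_entry]
  by_cases h : e = j ∧ p = pos i (n - r)
  · obtain ⟨rfl, rfl⟩ := h
    rw [if_pos ⟨rfl, rfl⟩]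
    congr 2
    have h2 : (2 : ZMod 2) = 0 := by decide
    have h : ∀ k : Fin 2, k = 0 ∨ k = 1 := by decide
    simp only [pos]
    push_cast
    rcases h i with rfl | rfl <;> rcases h e with rfl | rfl <;> simp [QOp.mParity, h2]
  · rw [if_neg h]; simp

/-- The central term `-(-1)^i q^{ak} / (1 - q^k) ∑_l (k log q)^l t^l / l!` of the image of
`T_q^k M_{ii}`, `k ≠ 0`; the other basis elements have no central term. -/
noncomputable def kappa : QOp q →ₗ[ℂ] TruncPoly m :=
  (QOp.basis q).constr ℂ fun x =>
    if x.1 = 0 ∧ x.2.1 ≠ 0 ∧ x.2.2.1 = x.2.2.2 then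
      (QOp.mSign x.2.2.1 * (Complex.exp (ℓ * a) ^ x.2.1 / (1 - (q : ℂ) ^ x.2.1))) •
        qPowT ℓ m x.2.1
    else 0

theorem kappa_mono (r k : ℤ) (i j : Fin 2) :
    kappa q ℓ a m (QOp.mono q r k i j) = if r = 0 ∧ k ≠ 0 ∧ i = j then
      (QOp.mSign i * (Complex.exp (ℓ * a) ^ k / (1 - (q : ℂ) ^ k))) • qPowT ℓ m k else 0 := by
  simp [kappa, QOp.constr_mono]

/-- The map `φ̂_s^{[m]}`. It sends `C` to `1 ∈ R_m`. -/
noncomputable def phiHatLin : SHat q →ₗ[ℂ] GlHat m :=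
  LinearMap.prod ((phi q ℓ a m).comp (LinearMap.fst ℂ (QOp q) ℂ))
    ((kappa q ℓ a m).comp (LinearMap.fst ℂ (QOp q) ℂ) +
      (LinearMap.toSpanSingleton ℂ (TruncPoly m) 1).comp (LinearMap.snd ℂ (QOp q) ℂ))

/-- The summand `([n ≤ 0] - [n + r ≤ 0]) y^n`. -/
noncomputable def window (y : ℂ) (r n : ℤ) : ℂ :=
  ((if n ≤ 0 then 1 else 0) - (if n + r ≤ 0 then 1 else 0)) * y ^ n

theorem window_finite (y : ℂ) (r : ℤ) : (Function.support (window y r)).Finite := by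
  refine (Set.finite_Icc (-|r|) |r|).subset fun n hn => ?_
  have h := left_ne_zero_of_mul hn
  have h1 := le_abs_self r
  have h2 := neg_abs_le r
  rw [Set.mem_Icc]
  by_contra h3
  apply h
  split_ifs <;> first | omega | simp

theorem window_succ (y : ℂ) (r : ℤ) :
    ∑ᶠ n, window y (r + 1) n = (∑ᶠ n, window y r n) + y ^ (-r) := by
  have h : ∀ n, window y (r + 1) n = window y r n + (if n = -r then y ^ (-r) else 0) := by
    intro n
    unfold window
    by_cases hn : n = -r
    · subst hn
      rw [if_pos rfl, if_neg (by omega : ¬(-r + (r + 1) ≤ 0)), if_pos (by omega : -r + r ≤ 0)]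
      ring
    · have h1 : (n + (r + 1) ≤ 0) ↔ (n + r ≤ 0) := by omega
      simp [hn, h1]
  rw [finsum_congr h, finsum_add_distrib (window_finite y r)]
  · congr 1
    rw [finsum_eq_single _ (-r)]
    · simp
    · intro n hn; simp [hn]
  · refine (Set.finite_singleton (-r)).subset fun n hn => ?_
    by_contra h
    exact hn (if_neg h)

theorem window_zero (y : ℂ) : ∑ᶠ n, window y 0 n = 0 := by
  simp [window]

theorem finsum_window (y : ℂ) (hy : y ≠ 0) (r : ℤ) :
    (1 - y⁻¹) * ∑ᶠ n, window y r n = 1 - y ^ (-r) := by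
  induction r using Int.induction_on with
  | zero => simp [window_zero]
  | succ r ih =>
    rw [window_succ, mul_add, ih, show (-((r : ℤ) + 1)) = -(r : ℤ) + (-1) by ring,
      zpow_add₀ hy, zpow_neg_one]
    ring
  | pred r ih =>
    have h := window_succ y (-(r : ℤ) - 1)
    rw [sub_add_cancel] at h
    rw [h, mul_add, show (-(-(r : ℤ) - 1)) = (r : ℤ) + 1 by ring, zpow_add₀ hy, zpow_one,
      neg_neg] at ih
    rw [show (-(-(r : ℤ) - 1)) = (r : ℤ) + 1 by ring, zpow_add₀ hy, zpow_one]
    have h2 : y⁻¹ * y = 1 := inv_mul_cancel₀ hy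
    linear_combination ih + y ^ (r : ℤ) * h2

theorem finsum_window_one (r : ℤ) : ∑ᶠ n, window 1 r n = r := by
  induction r using Int.induction_on with
  | zero => simp [window_zero]
  | succ r ih => rw [window_succ, ih]; simp
  | pred r ih =>
    have h := window_succ 1 (-(r : ℤ) - 1)
    rw [sub_add_cancel, ih] at h
    simp at h
    push_cast
    linear_combination -h

theorem sgn_pos (e : Fin 2) (n : ℤ) : sgn ((pos e n : ℤ) : ZMod 2) = QOp.mSign e := by
  have h2 : (2 : ZMod 2) = 0 := by decide
  have h : ∀ k : Fin 2, k = 0 ∨ k = 1 := by decide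
  rcases h e with rfl | rfl <;> simp [pos, h2, sgn, QOp.mSign]

/-- The diagonal entries of `[J, A] B` for the images `A`, `B` of two basis elements. -/
theorem diag_entry (r k r' k' : ℤ) (i j i' j' e : Fin 2) (n : ℤ) :
    (Band.adJ (phiMono q ℓ a m r k i j) * phiMono q ℓ a m r' k' i' j').entry (pos e n) (pos e n) =
      if e = i ∧ i = j' ∧ j = i' ∧ r' = -r then
        ((q : ℂ) ^ (-(k * r)) * Complex.exp (ℓ * a) ^ (k + k') *
          window ((q : ℂ) ^ (-(k + k'))) r n) • qPowT ℓ m ((k + k' : ℤ) : ℂ) else 0 := by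
  rw [Band.mul_entry_eq_sum' _ _ (pos e n) (pos e n) {pos i' (n - r')}]
  · rw [Finset.sum_singleton, phiMono_entry, Band.adJ_entry, phiMono_entry]
    simp only [pos_nonpos, pos_inj]
    by_cases h : e = i ∧ i = j' ∧ j = i' ∧ r' = -r
    · obtain ⟨rfl, rfl, rfl, rfl⟩ := h
      simp only [sub_neg_eq_add, add_sub_cancel_right, if_true, and_self]
      have h1 := evalPow_mul q ℓ a m k k' (-r) n
      rw [sub_neg_eq_add] at h1
      rw [mul_assoc, h1, evalPow, smul_smul, window]
      have h2 : ((if n ≤ 0 then (1 : TruncPoly m) else 0) - (if n + r ≤ 0 then 1 else 0)) =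
          algebraMap ℂ (TruncPoly m)
            ((if n ≤ 0 then 1 else 0) - (if n + r ≤ 0 then 1 else 0)) := by
        split_ifs <;> simp
      rw [h2, ← Algebra.smul_def, smul_smul]
      congr 1
      rw [← zpow_mul, show -n * (k + k') = -(k + k') * n by ring, show k * -r = -(k * r) by ring]
      ring
    · rw [if_neg h]
      by_cases h1 : e = j'
      · by_cases h2 : i' = j ∧ e = i ∧ n = n - r' - r
        · exact absurd ⟨h2.2.1, h2.2.1 ▸ h1, h2.1.symm, by omega⟩ h
        · rw [if_neg h2]; simp
      · simp [h1]
  · intro u hu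
    rw [phiMono_entry] at hu
    by_contra h
    exact hu (if_neg fun h' => h (by simp [h'.2]))

theorem str_phi (r k r' k' : ℤ) (i j i' j' : Fin 2) :
    Band.str (Band.adJ (phiMono q ℓ a m r k i j) * phiMono q ℓ a m r' k' i' j') =
      if i = j' ∧ j = i' ∧ r' = -r then
        (QOp.mSign i * ((q : ℂ) ^ (-(k * r)) * Complex.exp (ℓ * a) ^ (k + k') *
          ∑ᶠ n, window ((q : ℂ) ^ (-(k + k'))) r n)) • qPowT ℓ m ((k + k' : ℤ) : ℂ) else 0 := by
  have h0 : ∀ p, p ∉ Set.range (pos i) → sgn ((p : ℤ) : ZMod 2) •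
      (Band.adJ (phiMono q ℓ a m r k i j) * phiMono q ℓ a m r' k' i' j').entry p p = 0 := by
    intro p hp
    obtain ⟨e, n, rfl⟩ := exists_pos p
    rw [diag_entry, if_neg, smul_zero]
    rintro ⟨rfl, _⟩
    exact hp ⟨n, rfl⟩
  have h1 : Band.str (Band.adJ (phiMono q ℓ a m r k i j) * phiMono q ℓ a m r' k' i' j') =
      ∑ᶠ p ∈ Set.range (pos i), sgn ((p : ℤ) : ZMod 2) •
        (Band.adJ (phiMono q ℓ a m r k i j) * phiMono q ℓ a m r' k' i' j').entry p p := by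
    refine finsum_congr fun p => ?_
    by_cases hp : p ∈ Set.range (pos i)
    · simp only [hp, finsum_true]
    · rw [h0 p hp]; simp
  rw [h1, finsum_mem_range (fun n n' h => (pos_inj.1 h).2)]
  simp only [sgn_pos, diag_entry, true_and]
  by_cases h : i = j' ∧ j = i' ∧ r' = -r
  · simp only [if_pos h]
    simp only [smul_smul]
    rw [← finsum_smul']
    · congr 1
      simp only [← smul_eq_mul, ← smul_finsum]
    · exact (window_finite _ _).subset fun n hn =>
        right_ne_zero_of_mul (right_ne_zero_of_mul hn)
  · simp only [if_neg h]; simp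

theorem one_sub_zpow_ne_zero (hq : ‖(q : ℂ)‖ ≠ 1) (k : ℤ) (hk : k ≠ 0) : 1 - (q : ℂ) ^ k ≠ 0 := by
  intro h
  have h1 : ‖(q : ℂ)‖ ^ k = 1 := by rw [← norm_zpow, ← sub_eq_zero.1 h, norm_one]
  rcases (zpow_eq_one_iff_of_ne_zero₀ hk).1 h1 with h2 | ⟨h2, _⟩
  · exact hq h2
  · have := norm_nonneg (q : ℂ); linarith

/-- Compatibility of the central terms with the two cocycles. -/
theorem kappa_superComm (hq : ‖(q : ℂ)‖ ≠ 1) (x y : QOp q) :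
    kappa q ℓ a m (superComm (QOp.parity q) x y) + (QOp.traceData q).cocycle x y • 1 =
      (Band.traceData (TruncPoly m)).cocycle (phi q ℓ a m x) (phi q ℓ a m y) := by
  refine QOp.bilinear_ext
    (f := ((QOp.traceData q).extBracket.compl₁₂ (LinearMap.inl ℂ (QOp q) ℂ)
      (LinearMap.inl ℂ (QOp q) ℂ)).compr₂ ((kappa q ℓ a m).comp (LinearMap.fst ℂ (QOp q) ℂ) +
      (LinearMap.toSpanSingleton ℂ (TruncPoly m) 1).comp (LinearMap.snd ℂ (QOp q) ℂ)))
    (g := (Band.traceData (TruncPoly m)).cocycle.compl₁₂ (phi q ℓ a m) (phi q ℓ a m)) ?_ x y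
  intro r k i j r' k' i' j'
  change kappa q ℓ a m (superComm (QOp.parity q) (QOp.mono q r k i j) (QOp.mono q r' k' i' j')) +
    QOp.str₀ q (QOp.zdz q (QOp.mono q r k i j) * QOp.mono q r' k' i' j') • (1 : TruncPoly m) =
    Band.str (Band.adJ (phi q ℓ a m (QOp.mono q r k i j)) * phi q ℓ a m (QOp.mono q r' k' i' j'))
  rw [superComm_of_homogeneous _ (QOp.mParity i j) (QOp.mParity i' j') _ _
    (QOp.parity_mono _ _ _ _) (QOp.parity_mono _ _ _ _), phi_mono, phi_mono, str_phi,
    QOp.zdz_mono, smul_mul_assoc, map_smul, QOp.mono_mul_mono, QOp.mono_mul_mono]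
  by_cases h : i = j' ∧ j = i' ∧ r' = -r
  · obtain ⟨rfl, rfl, rfl⟩ := h
    simp only [if_true, and_self, map_sub, map_smul, kappa_mono, QOp.str₀_mono, true_and,
      add_neg_cancel, neg_add_cancel, and_true]
    by_cases hK : k + k' = 0
    · have h1 : k' + k = 0 := by omega
      simp only [hK, h1, neg_zero, zpow_zero, finsum_window_one, ne_eq, not_true, if_false,
        smul_zero, sub_zero, zero_add, if_true]
      have h2 : qPowT ℓ m ((0 : ℤ) : ℂ) = 1 := by
        rw [qPowT_eq_exp]; simp
      rw [h2]
      congr 1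
      rw [smul_eq_mul, smul_eq_mul, show k * -r = -(k * r) by ring]
      ring
    · have h1 : ¬(k' + k = 0) := by omega
      have h3 := one_sub_zpow_ne_zero q hq _ hK
      have h4 := finsum_window ((q : ℂ) ^ (-(k + k'))) (zpow_ne_zero _ q.ne_zero) r
      rw [← zpow_neg, neg_neg, ← zpow_mul, neg_mul_neg] at h4
      have h5 : ∑ᶠ n, window ((q : ℂ) ^ (-(k + k'))) r n =
          (1 - (q : ℂ) ^ ((k + k') * r)) / (1 - (q : ℂ) ^ (k + k')) := by
        rw [eq_div_iff h3, mul_comm]; exact h4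
      have h6 : (q : ℂ) ^ (k' * r) = (q : ℂ) ^ (-(k * r)) * (q : ℂ) ^ ((k + k') * r) := by
        rw [← zpow_add₀ q.ne_zero]; congr 1; ring
      have h8 : ∀ i j, QOp.mParity i j * QOp.mParity j i = QOp.mParity i j := by decide
      have h7 := QOp.mSign_eq i j
      simp only [hK, ne_eq, not_false_eq_true, if_true, if_false, smul_zero, zero_smul,
        add_zero, h5, add_comm k' k, h8, smul_smul]
      rw [← sub_smul]
      congr 1
      rw [h6, h7, show k * -r = -(k * r) by ring]
      field_simp
  · rw [if_neg h]
    by_cases h1 : j = i' <;> by_cases h2 : j' = i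
    · have h3 : ¬(r + r' = 0) := fun e => h ⟨h2.symm, h1, by omega⟩
      have h4 : ¬(r' + r = 0) := fun e => h3 (by omega)
      simp [h1, h2, kappa_mono, h3, h4]
    · have h3 : ¬(i = j') := fun e => h2 e.symm
      simp [h1, h2, h3, kappa_mono]
    · have h3 : ¬(i' = j) := fun e => h1 e.symm
      simp [h1, h2, h3, kappa_mono]
    · simp [h1, h2]

/-- The homomorphism `φ̂_s^{[m]}` of Lie superalgebras, with `s = q^a = exp (a log q)`. -/
noncomputable def phiHat (hq : ‖(q : ℂ)‖ ≠ 1) : SuperHom (SHat q) (GlHat m) where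
  toLin := phiHatLin q ℓ a m
  map_parity x := by
    change (phi q ℓ a m (QOp.parity q x.1), kappa q ℓ a m (QOp.parity q x.1) + x.2 • 1) =
      (Band.parity (phi q ℓ a m x.1), kappa q ℓ a m x.1 + x.2 • (1 : TruncPoly m))
    rw [phi_parity]
    congr 2
    refine QOp.linear_ext (f := (kappa q ℓ a m).comp (QOp.parity q)) (g := kappa q ℓ a m)
      (fun r k i j => ?_) x.1
    simp only [LinearMap.comp_apply, QOp.parity_mono, map_smul, kappa_mono]
    by_cases h : i = j
    · simp [h, QOp.mParity, sgn]
    · simp [h]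
  map_bracket x y := by
    change (phi q ℓ a m (superComm (QOp.parity q) x.1 y.1),
      kappa q ℓ a m (superComm (QOp.parity q) x.1 y.1) +
        (QOp.traceData q).cocycle x.1 y.1 • (1 : TruncPoly m)) =
      (superComm Band.parity (phi q ℓ a m x.1) (phi q ℓ a m y.1),
        (Band.traceData (TruncPoly m)).cocycle (phi q ℓ a m x.1) (phi q ℓ a m y.1))
    rw [kappa_superComm q ℓ a m hq]
    congr 1
    simp only [superComm, map_add, map_sub, map_smul, phi_mul, phi_parity]

end Hom

/-! Direct sums of Lie superalgebras and outer tensor products of modules. -/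

section Pi

variable {ι : Type*} {g : ι → Type*} [∀ i, AddCommGroup (g i)] [∀ i, Module ℂ (g i)]
  [∀ i, LieSuperalgebra (g i)]

/-- The direct sum of finitely many Lie superalgebras, with componentwise bracket. -/
noncomputable instance : LieSuperalgebra (∀ i, g i) where
  parity := LinearMap.pi fun i => LieSuperalgebra.parity ∘ₗ LinearMap.proj i
  parity_parity x := funext fun i => LieSuperalgebra.parity_parity (x i)
  bracket := LinearMap.mk₂ ℂ (fun x y i => LieSuperalgebra.bracket (x i) (y i))
    (fun x x' y => funext fun i => by simp) (fun c x y => funext fun i => by simp)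
    (fun x y y' => funext fun i => by simp) (fun c x y => funext fun i => by simp)
  parity_bracket x y := funext fun i => LieSuperalgebra.parity_bracket (x i) (y i)
  bracket_skew α β x y hx hy := funext fun i =>
    LieSuperalgebra.bracket_skew α β (x i) (y i) (congrFun hx i) (congrFun hy i)
  bracket_jacobi α β x y z hx hy := funext fun i =>
    LieSuperalgebra.bracket_jacobi α β (x i) (y i) (z i) (congrFun hx i) (congrFun hy i)

end Pi

open scoped TensorProduct

section Tensor

variable {N : ℕ} {g L : Fin N → Type*} [∀ i, AddCommGroup (g i)] [∀ i, Module ℂ (g i)]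
  [∀ i, LieSuperalgebra (g i)] [∀ i, AddCommGroup (L i)] [∀ i, Module ℂ (L i)]

/-- The operator `P^α ⊗ ⋯ ⊗ P^α ⊗ T ⊗ 1 ⊗ ⋯ ⊗ 1` on `L_1 ⊗ ⋯ ⊗ L_N`, with `T` at the place `i` and
`P` the parity involutions. -/
noncomputable def koszulOp (P : ∀ j, Module.End ℂ (L j)) (α : ZMod 2) (i : Fin N) :
    Module.End ℂ (L i) →ₗ[ℂ] Module.End ℂ (⨂[ℂ] j, L j) :=
  (PiTensorProduct.mapMultilinear ℂ L L).toLinearMap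
    (fun j => if j < i ∧ α = 1 then P j else LinearMap.id) i

theorem koszulOp_tprod (P : ∀ j, Module.End ℂ (L j)) (α : ZMod 2) (i : Fin N)
    (T : Module.End ℂ (L i)) (v : ∀ j, L j) :
    koszulOp P α i T (PiTensorProduct.tprod ℂ v) = PiTensorProduct.tprod ℂ
      (Function.update (fun j => if j < i ∧ α = 1 then P j (v j) else v j) i (T (v i))) := by
  simp only [koszulOp, MultilinearMap.toLinearMap_apply, PiTensorProduct.mapMultilinear_apply,
    PiTensorProduct.map_tprod]
  congr 1
  funext j
  by_cases h : j = i
  · subst h; simp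
  · rw [Function.update_of_ne h, Function.update_of_ne h]
    split_ifs <;> rfl

/-- The action of `x ∈ g_i` on `L_1 ⊗ ⋯ ⊗ L_N`. If `x` is homogeneous then
`x (v_1 ⊗ ⋯ ⊗ v_N) = (-1)^{|x| (|v_1| + ⋯ + |v_{i-1}|)} v_1 ⊗ ⋯ ⊗ x v_i ⊗ ⋯ ⊗ v_N`; for general `x`
the two terms are the contributions of the even and the odd part of `x`. -/
noncomputable def tensorActionAt (ρ : ∀ i, SuperRep (g i) (L i)) (i : Fin N) :
    g i →ₗ[ℂ] Module.End ℂ (⨂[ℂ] j, L j) :=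
  koszulOp (fun j => (ρ j).parity) 0 i ∘ₗ (ρ i).action ∘ₗ
      ((2⁻¹ : ℂ) • (LinearMap.id + LieSuperalgebra.parity)) +
    koszulOp (fun j => (ρ j).parity) 1 i ∘ₗ (ρ i).action ∘ₗ
      ((2⁻¹ : ℂ) • (LinearMap.id - LieSuperalgebra.parity))

theorem tensorActionAt_of_homogeneous (ρ : ∀ i, SuperRep (g i) (L i)) (i : Fin N) (α : ZMod 2)
    (x : g i) (hx : LieSuperalgebra.parity x = sgn α • x) :
    tensorActionAt ρ i x = koszulOp (fun j => (ρ j).parity) α i ((ρ i).action x) := by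
  have h2 : (2⁻¹ : ℂ) • (x + x) = x := by rw [← two_smul ℂ x, smul_smul]; norm_num
  rcases ZMod2_cases α with rfl | rfl
  · have h : LieSuperalgebra.parity x = x := by rw [hx]; simp [sgn]
    simp only [tensorActionAt, LinearMap.add_apply, LinearMap.comp_apply, LinearMap.smul_apply,
      LinearMap.sub_apply, LinearMap.id_apply, h, h2, sub_self, smul_zero, map_zero, add_zero]
  · have h : LieSuperalgebra.parity x = -x := by rw [hx]; simp [sgn]
    simp [tensorActionAt, h, h2]

/-- The action of `⨁ g_i` on `L_1 ⊗ ⋯ ⊗ L_N`. -/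
noncomputable def tensorAction (ρ : ∀ i, SuperRep (g i) (L i)) :
    (∀ i, g i) →ₗ[ℂ] Module.End ℂ (⨂[ℂ] j, L j) :=
  ∑ i, tensorActionAt ρ i ∘ₗ LinearMap.proj i

theorem end_ext {A B : Module.End ℂ (⨂[ℂ] j, L j)}
    (h : ∀ v : ∀ j, L j, A (PiTensorProduct.tprod ℂ v) = B (PiTensorProduct.tprod ℂ v)) :
    A = B :=
  PiTensorProduct.ext (MultilinearMap.ext h)

theorem action_parity_comm (ρ : ∀ i, SuperRep (g i) (L i)) (i : Fin N) (α : ZMod 2)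
    (x : g i) (hx : LieSuperalgebra.parity x = sgn α • x) (v : L i) :
    (ρ i).action x ((ρ i).parity v) = sgn α • (ρ i).parity ((ρ i).action x v) := by
  rw [(ρ i).parity_action, hx, map_smul, LinearMap.smul_apply, smul_smul, sgn_mul_self, one_smul]

theorem tensorActionAt_same (ρ : ∀ i, SuperRep (g i) (L i)) (i : Fin N) (α β : ZMod 2)
    (x y : g i) (hx : LieSuperalgebra.parity x = sgn α • x)
    (hy : LieSuperalgebra.parity y = sgn β • y) :
    tensorActionAt ρ i (LieSuperalgebra.bracket x y) =
      tensorActionAt ρ i x * tensorActionAt ρ i y -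
        sgn (α * β) • (tensorActionAt ρ i y * tensorActionAt ρ i x) := by
  have hxy : LieSuperalgebra.parity (LieSuperalgebra.bracket x y) =
      sgn (α + β) • LieSuperalgebra.bracket x y := by
    rw [LieSuperalgebra.parity_bracket, hx, hy, map_smul, map_smul, LinearMap.smul_apply,
      smul_smul, sgn_add, mul_comm]
  have h1 : ∀ (α β : ZMod 2) (S T : Module.End ℂ (L i)),
      koszulOp (fun j => (ρ j).parity) α i S * koszulOp (fun j => (ρ j).parity) β i T =
        koszulOp (fun j => (ρ j).parity) (α + β) i (S * T) := by
    intro α β S T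
    refine end_ext fun v => ?_
    rw [Module.End.mul_apply, koszulOp_tprod, koszulOp_tprod, koszulOp_tprod]
    congr 1
    funext j
    by_cases hj : j = i
    · subst hj; simp
    · simp only [Function.update_of_ne hj]
      have h2 : (1 + 1 : ZMod 2) ≠ 1 := by decide
      by_cases hji : j < i
      · rcases ZMod2_cases α with rfl | rfl <;> rcases ZMod2_cases β with rfl | rfl <;>
          simp [hji, h2, (ρ j).parity_parity]
      · simp [hji]
  rw [tensorActionAt_of_homogeneous ρ i _ _ hxy, tensorActionAt_of_homogeneous ρ i _ _ hx,
    tensorActionAt_of_homogeneous ρ i _ _ hy, h1, h1, add_comm β α, ← map_smul, ← map_sub]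
  congr 1
  ext v
  simp only [(ρ i).action_bracket α β x y hx hy]
  rfl

theorem tensorActionAt_comm_lt (ρ : ∀ i, SuperRep (g i) (L i)) (i j : Fin N) (hij : i < j)
    (α β : ZMod 2) (x : g i) (y : g j) (hx : LieSuperalgebra.parity x = sgn α • x)
    (hy : LieSuperalgebra.parity y = sgn β • y) :
    tensorActionAt ρ i x * tensorActionAt ρ j y =
      sgn (α * β) • (tensorActionAt ρ j y * tensorActionAt ρ i x) := by
  rw [tensorActionAt_of_homogeneous ρ i _ _ hx, tensorActionAt_of_homogeneous ρ j _ _ hy]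
  refine end_ext fun v => ?_
  rw [LinearMap.smul_apply, Module.End.mul_apply, Module.End.mul_apply, koszulOp_tprod,
    koszulOp_tprod, koszulOp_tprod, koszulOp_tprod]
  have hne : j ≠ i := ne_of_gt hij
  have hji : ¬(j < i) := not_lt_of_gt hij
  set w : ∀ k, L k := Function.update (fun k => if k < j ∧ β = 1 then (ρ k).parity
    (Function.update (fun k => if k < i ∧ α = 1 then (ρ k).parity (v k) else v k) i
      ((ρ i).action x (v i)) k) else
    Function.update (fun k => if k < i ∧ α = 1 then (ρ k).parity (v k) else v k) i
      ((ρ i).action x (v i)) k) j ((ρ j).action y (Function.update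
      (fun k => if k < i ∧ α = 1 then (ρ k).parity (v k) else v k) i
      ((ρ i).action x (v i)) j)) with hw
  have h1 : PiTensorProduct.tprod ℂ w =
      PiTensorProduct.tprod ℂ (Function.update w i (w i)) := by
    rw [Function.update_eq_self]
  rw [h1, ← MultilinearMap.map_update_smul]
  congr 1
  funext k
  by_cases hk : k = i
  · subst hk
    simp only [Function.update_self, Function.update_of_ne hne.symm, hw]
    rcases ZMod2_cases β with rfl | rfl
    · simp [sgn]
    · simp only [hij, true_and, if_true, mul_one]
      exact action_parity_comm ρ k α x hx _
  · rw [Function.update_of_ne hk, Function.update_of_ne hk]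
    by_cases hk' : k = j
    · subst hk'
      simp [hw, hne, hji]
    · simp only [hw, Function.update_of_ne hk', Function.update_of_ne hk]
      split_ifs <;> rfl

theorem tensorActionAt_comm (ρ : ∀ i, SuperRep (g i) (L i)) (i j : Fin N) (hij : i ≠ j)
    (α β : ZMod 2) (x : g i) (y : g j) (hx : LieSuperalgebra.parity x = sgn α • x)
    (hy : LieSuperalgebra.parity y = sgn β • y) :
    tensorActionAt ρ i x * tensorActionAt ρ j y =
      sgn (α * β) • (tensorActionAt ρ j y * tensorActionAt ρ i x) := by
  rcases lt_or_gt_of_ne hij with h | h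
  · exact tensorActionAt_comm_lt ρ i j h α β x y hx hy
  · rw [tensorActionAt_comm_lt ρ j i h β α y x hy hx, smul_smul, mul_comm β α, sgn_mul_self,
      one_smul]

/-- The outer tensor product `L_1 ⊗ ⋯ ⊗ L_N`, a module over `⨁ g_i`. -/
noncomputable def tensorRep (ρ : ∀ i, SuperRep (g i) (L i)) :
    SuperRep (∀ i, g i) (⨂[ℂ] j, L j) where
  action := tensorAction ρ
  parity := PiTensorProduct.map fun j => (ρ j).parity
  parity_parity v := by
    have h : (PiTensorProduct.map fun j => (ρ j).parity) ∘ₗ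
        (PiTensorProduct.map fun j => (ρ j).parity) = LinearMap.id (R := ℂ) := by
      refine end_ext fun v => ?_
      simp [PiTensorProduct.map_tprod, (ρ _).parity_parity]
    exact LinearMap.congr_fun h v
  parity_action x v := by
    have key : ∀ i (y : g i), (PiTensorProduct.map fun j => (ρ j).parity) *
        tensorActionAt ρ i y = tensorActionAt ρ i (LieSuperalgebra.parity y) *
          (PiTensorProduct.map fun j => (ρ j).parity) := by
      intro i y
      have h : ∀ (α : ZMod 2) (T T' : Module.End ℂ (L i)),
          (∀ u, (ρ i).parity (T u) = T' ((ρ i).parity u)) →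
          (PiTensorProduct.map fun j => (ρ j).parity) * koszulOp (fun j => (ρ j).parity) α i T =
          koszulOp (fun j => (ρ j).parity) α i T' *
            (PiTensorProduct.map fun j => (ρ j).parity) := by
        intro α T T' hT
        refine end_ext fun v => ?_
        rw [Module.End.mul_apply, Module.End.mul_apply, koszulOp_tprod, PiTensorProduct.map_tprod,
          PiTensorProduct.map_tprod, koszulOp_tprod]
        congr 1
        funext k
        by_cases hk : k = i
        · subst hk; simp [hT]
        · simp only [Function.update_of_ne hk]
          split_ifs <;> rfl
      simp only [tensorActionAt, LinearMap.add_apply, LinearMap.comp_apply, mul_add, add_mul]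
      rw [h 0 _ _ fun u => (ρ i).parity_action _ u, h 1 _ _ fun u => (ρ i).parity_action _ u]
      simp [LieSuperalgebra.parity_parity]
    have h2 := congrArg (fun A => A v) (Finset.sum_congr (rfl : Finset.univ = Finset.univ)
      fun i (_ : i ∈ Finset.univ) => key i (x i))
    simp only [LinearMap.sum_apply, Module.End.mul_apply] at h2
    simp only [tensorAction, LinearMap.sum_apply, LinearMap.comp_apply, LinearMap.proj_apply,
      map_sum]
    exact h2
  action_bracket α β x y hx hy v := by
    have hx' : ∀ i, LieSuperalgebra.parity (x i) = sgn α • x i := fun i => congrFun hx i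
    have hy' : ∀ i, LieSuperalgebra.parity (y i) = sgn β • y i := fun i => congrFun hy i
    have h : tensorAction ρ (LieSuperalgebra.bracket x y) =
        tensorAction ρ x * tensorAction ρ y -
          sgn (α * β) • (tensorAction ρ y * tensorAction ρ x) := by
      simp only [tensorAction, LinearMap.sum_apply, LinearMap.comp_apply, LinearMap.proj_apply]
      rw [Finset.sum_mul_sum, Finset.sum_mul_sum, Finset.sum_comm (s := Finset.univ) (f := fun i j =>
        tensorActionAt ρ i (y i) * tensorActionAt ρ j (x j)), Finset.smul_sum,
        ← Finset.sum_sub_distrib]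
      refine Finset.sum_congr rfl fun i _ => ?_
      rw [Finset.smul_sum, ← Finset.sum_sub_distrib, Finset.sum_eq_single i]
      · exact tensorActionAt_same ρ i α β (x i) (y i) (hx' i) (hy' i)
      · intro j _ hj
        rw [tensorActionAt_comm ρ i j hj.symm α β (x i) (y j) (hx' i) (hy' j), sub_self]
      · exact fun h => absurd (Finset.mem_univ i) h
    exact LinearMap.congr_fun h v

end Tensor

/-- The Lie superalgebra `⨁_i gl^_{∞|∞}[m_i]`. -/
abbrev GlHatVec {N : ℕ} (m : Fin N → ℕ) : Type := ∀ i, GlHat (m i)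

/-- The principal gradation of `⨁_i gl^_{∞|∞}[m_i]`; `gr m n` is the part of degree `n / 2`. -/
noncomputable def GlHatVec.gr {N : ℕ} (m : Fin N → ℕ) (n : ℤ) : Submodule ℂ (GlHatVec m) :=
  Submodule.pi Set.univ fun i => GlHat.gr (m i) n

/-- The homomorphism `⨁_i φ̂_{s_i}^{[m_i]}`, with `s_i = q^{a_i}`. -/
noncomputable def phiHatVec (q : ℂˣ) (hq : ‖(q : ℂ)‖ ≠ 1) (ℓ : ℂ) {N : ℕ} (a : Fin N → ℂ)
    (m : Fin N → ℕ) : SuperHom (SHat q) (GlHatVec m) where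
  toLin := LinearMap.pi fun i => (phiHat q ℓ (a i) (m i) hq).toLin
  map_parity x := funext fun i => (phiHat q ℓ (a i) (m i) hq).map_parity x
  map_bracket x y := funext fun i => (phiHat q ℓ (a i) (m i) hq).map_bracket x y

end QPDO

open QPDO

/-! All degrees below are doubled. For `n ≠ 0` the degree-`n` part of the big algebra consists of
the sequences `c = (c_i(p))` of entries on the `n`-th diagonal, that is, of an infinite product of
rings `R_{m_i}`, with one factor for each component `i` and each column `p`. The image of the
quantum pseudo-differential operators contains the sequences `f(w)` cut down to the columns of one
block, where `f` is a polynomial and the symbol `w` of `T_q` takes the value `s_i q^{-k+t}` in the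
columns numbered `k`.

Part (1) is a density argument. Fix finitely many homogeneous parts of `V`. The sequences `c` whose
`n`-th diagonal kills these parts form an ideal of the product ring (`annihilator_mul`), because for
`n ≠ 0` multiplication by any sequence is the adjoint action of a diagonal matrix. By
quasifiniteness the infinite-dimensional space of polynomials maps into a finite-dimensional space
of operators, so the ideal contains `P(w)` for some `P ≠ 0`. The points `s_i q^{-k}` are pairwise
distinct, so `P(w)` is a unit outside finitely many places, and modulo the ideal only the values of
`c` at these places count. Hermite interpolation produces polynomials in `w` with the same values
there; it applies because `w` generates each local ring `R_{m_i}`, which uses `log q ≠ 0`. Thus on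
finitely many homogeneous parts every diagonal of non-zero degree acts like some element of the
image (`exists_phiHatVec_action_eq`). A vector has finitely many components, so a stable subspace,
graded or not, is stable under all parts of non-zero degree. Every element of degree `0`, centre
included, is one bracket of elements of degrees `1` and `-1`.

For part (2) it remains to see that the tensor product is quasifinite and irreducible over the big
algebra. The grading is inner: `D = -∑ p E_pp` acts on the parts of a highest weight module by
distinct scalars, so every submodule is graded. A non-zero submodule of the tensor product has a
non-zero vector of greatest total degree, and the positive part of each factor kills it. Contracting
such a vector with functionals in all factors but one gives singular vectors of one irreducible
factor, hence multiples of its highest weight vector. The vector is therefore a multiple of the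
tensor product of the highest weight vectors, which generates everything. -/

namespace QPDO

/-! ### Matrices supported on one diagonal -/

namespace Band

variable {R : Type*} [CommRing R]

/-- The matrix supported on the diagonal `{(p, p + n)}`, with entry `c q` in column `q`. -/
def shift (n : ℤ) (c : ℤ → R) : Band R where
  entry p q := if q = p + n then c q else 0
  isBand := ⟨|n|, fun p q h => by
    have h1 : q = p + n := by
      by_contra h0
      exact h (if_neg h0)
    rw [h1, show p - (p + n) = -n by ring, abs_neg]⟩

theorem shift_entry (n : ℤ) (c : ℤ → R) (p q : ℤ) :
    (shift n c).entry p q = if q = p + n then c q else 0 := rfl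

theorem shift_mul (n k : ℤ) (c d : ℤ → R) :
    shift n c * shift k d = shift (n + k) fun q => c (q - k) * d q := by
  ext p q
  rw [mul_entry_eq_sum' _ _ p q {q - k}]
  · rw [Finset.sum_singleton, shift_entry, shift_entry, shift_entry,
      if_pos (sub_add_cancel q k).symm]
    by_cases h : q = p + (n + k)
    · rw [if_pos h, if_pos (by omega)]
    · rw [if_neg h, if_neg (by omega), zero_mul]
  · intro l hl
    by_contra h
    refine hl (if_neg fun h1 => h ?_)
    rw [Finset.mem_singleton, h1]
    ring

theorem shift_add (n : ℤ) (c d : ℤ → R) : shift n (c + d) = shift n c + shift n d := by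
  ext p q
  simp only [shift_entry, add_entry, Pi.add_apply]
  split_ifs <;> simp

theorem shift_sub (n : ℤ) (c d : ℤ → R) : shift n (c - d) = shift n c - shift n d := by
  ext p q
  simp only [shift_entry, sub_entry, Pi.sub_apply]
  split_ifs <;> simp

theorem shift_zero (n : ℤ) : shift n (0 : ℤ → R) = 0 := by
  ext p q
  simp [shift_entry]

theorem exists_shift {n : ℤ} {A : Band R} (h : ∀ p q, q - p ≠ n → A.entry p q = 0) :
    A = shift n fun q => A.entry (q - n) q := by
  ext p q
  rw [shift_entry]
  by_cases hq : q = p + n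
  · rw [if_pos hq, show q - n = p by omega]
  · rw [if_neg hq, h p q (by omega)]

theorem exists_sum_shift (A : Band R) : ∃ s : Finset ℤ,
    A = ∑ n ∈ s, shift n fun q => A.entry (q - n) q := by
  obtain ⟨b, hb⟩ := A.isBand
  refine ⟨Finset.Icc (-b) b, ?_⟩
  -- Reading off an entry is made an additive map so that it passes through the finite sum of
  -- diagonals.
  let ev : ∀ p q : ℤ, Band R →+ R := fun p q =>
    { toFun := fun B => B.entry p q, map_zero' := rfl, map_add' := fun _ _ => rfl }
  ext p q
  change ev p q A = ev p q _
  rw [map_sum]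
  change A.entry p q = ∑ n ∈ _, if q = p + n then A.entry (q - n) q else 0
  have h1 : ∀ n : ℤ, (q = p + n) ↔ (n = q - p) := fun n => by omega
  simp only [h1, Finset.sum_ite_eq', sub_sub_cancel]
  by_cases h : A.entry p q = 0
  · simp [h]
  · have h2 := abs_le.1 (hb p q h)
    rw [if_pos (Finset.mem_Icc.2 (by omega))]

theorem adJ_shift [Algebra ℂ R] (n : ℤ) (c : ℤ → R) :
    adJ (shift n c) =
      shift n fun q => ((if q - n ≤ 0 then 1 else 0) - (if q ≤ 0 then 1 else 0)) * c q := by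
  ext p q
  rw [adJ_entry, shift_entry, shift_entry]
  by_cases h : q = p + n
  · rw [if_pos h, if_pos h, show q - n = p by omega]
  · rw [if_neg h, if_neg h, mul_zero]

variable [Algebra ℂ R]

theorem shift_smul (a : ℂ) (n : ℤ) (c : ℤ → R) : shift n (a • c) = a • shift n c := by
  ext p q
  simp only [shift_entry, smul_entry, Pi.smul_apply]
  split_ifs <;> simp

theorem parity_shift (n : ℤ) (c : ℤ → R) :
    parity (shift n c) = sgn (n : ZMod 2) • shift n c := by
  ext p q
  rw [parity_entry, smul_entry, shift_entry]
  by_cases h : q = p + n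
  · have h1 : ((p - q : ℤ) : ZMod 2) = n := by
      rw [h, show p - (p + n) = -n by ring, Int.cast_neg, ZMod.neg_eq_self_mod_two]
    rw [h1]
  · rw [if_neg h, smul_zero, smul_zero]

theorem str_shift_of_ne {n : ℤ} (hn : n ≠ 0) (c : ℤ → R) : str (shift n c) = 0 := by
  unfold str
  refine (finsum_congr fun p => ?_).trans finsum_zero
  rw [shift_entry, if_neg (by omega), smul_zero]

theorem superComm_shift (n k : ℤ) (c d : ℤ → R) :
    superComm parity (shift n c) (shift k d) = shift (n + k) fun q =>
      c (q - k) * d q - sgn ((n : ZMod 2) * (k : ZMod 2)) • (d (q - n) * c q) := by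
  rw [superComm_of_homogeneous _ _ _ _ _ (parity_shift n c) (parity_shift k d), shift_mul,
    shift_mul, add_comm k n, ← shift_smul, ← shift_sub]
  rfl

end Band

/-! ### The principal gradation and its grading element -/

namespace GlHat

variable {m : ℕ}

/-- The element of the central extension with matrix `A` and central part `z`. -/
def mk (A : Band (TruncPoly m)) (z : TruncPoly m) : GlHat m := (A, z)

theorem mk_add (A B : Band (TruncPoly m)) (z w : TruncPoly m) :
    mk A z + mk B w = mk (A + B) (z + w) := rfl

theorem smul_mk (a : ℂ) (A : Band (TruncPoly m)) (z : TruncPoly m) :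
    a • mk A z = mk (a • A) (a • z) := rfl

theorem bracket_mk (A B : Band (TruncPoly m)) (z w : TruncPoly m) :
    LieSuperalgebra.bracket (mk A z) (mk B w) =
      mk (superComm Band.parity A B) (Band.str (Band.adJ A * B)) := rfl

theorem parity_mk (A : Band (TruncPoly m)) (z : TruncPoly m) :
    LieSuperalgebra.parity (mk A z) = mk (Band.parity A) z := rfl

theorem mk_shift_mem (n : ℤ) (c : ℤ → TruncPoly m) (z : TruncPoly m) (hz : n ≠ 0 → z = 0) :
    mk (Band.shift n c) z ∈ gr m n :=
  ⟨fun p q h => if_neg (by omega), hz⟩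

theorem exists_of_mem_gr {n : ℤ} {x : GlHat m} (hx : x ∈ gr m n) :
    ∃ c z, (n ≠ 0 → z = 0) ∧ x = mk (Band.shift n c) z :=
  ⟨_, x.2, hx.2, Prod.ext (Band.exists_shift hx.1) rfl⟩

theorem bracket_mk_shift (n k : ℤ) (c d : ℤ → TruncPoly m) (z w : TruncPoly m) :
    LieSuperalgebra.bracket (mk (Band.shift n c) z) (mk (Band.shift k d) w) =
      mk (Band.shift (n + k) fun q =>
        c (q - k) * d q - sgn ((n : ZMod 2) * (k : ZMod 2)) • (d (q - n) * c q))
        (Band.str (Band.shift (n + k) fun q =>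
          ((if q - k - n ≤ 0 then 1 else 0) - (if q - k ≤ 0 then 1 else 0)) * c (q - k) * d q)) := by
  rw [bracket_mk, Band.superComm_shift, Band.adJ_shift, Band.shift_mul]

/-- The element `-∑_p p E_{pp}`, which acts on the part of degree `n` by `n`. -/
noncomputable def degreeElement (m : ℕ) : GlHat m :=
  mk (Band.shift 0 fun q => -(q : TruncPoly m)) 0

end GlHat

/-- A `ℤ`-gradation of a Lie superalgebra such that the part of degree `n` has parity `n` modulo
two, and `D` is an inner grading element. -/
structure InnerGrading {g : Type*} [AddCommGroup g] [Module ℂ g] [LieSuperalgebra g]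
    (gr : ℤ → Submodule ℂ g) (D : g) : Prop where
  parity_eq : ∀ n, ∀ x ∈ gr n, LieSuperalgebra.parity x = sgn (n : ZMod 2) • x
  bracket_mem : ∀ n k, ∀ x ∈ gr n, ∀ y ∈ gr k, LieSuperalgebra.bracket x y ∈ gr (n + k)
  mem : D ∈ gr 0
  bracket_eq : ∀ n, ∀ x ∈ gr n, LieSuperalgebra.bracket D x = (n : ℂ) • x
  iSup_eq_top : ⨆ n, gr n = ⊤

/-- The cocycle of parts of degrees `n` and `k` is the supertrace of a matrix on the diagonal `n +
k`, so it vanishes unless `n + k = 0`. Bracketing with the diagonal matrix `D` multiplies the `n`-th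
diagonal by `-(q - n) + q = n`, and gives no central term because `J` commutes with `D`. -/
theorem GlHat.innerGrading (m : ℕ) : InnerGrading (GlHat.gr m) (GlHat.degreeElement m) where
  parity_eq n x hx := by
    obtain ⟨c, z, hz, rfl⟩ := GlHat.exists_of_mem_gr hx
    rw [GlHat.parity_mk, Band.parity_shift, GlHat.smul_mk]
    by_cases hn : n = 0
    · subst hn; simp [sgn]
    · rw [hz hn, smul_zero]
  bracket_mem n k x hx y hy := by
    obtain ⟨c, z, hz, rfl⟩ := GlHat.exists_of_mem_gr hx
    obtain ⟨d, w, hw, rfl⟩ := GlHat.exists_of_mem_gr hy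
    rw [GlHat.bracket_mk_shift]
    exact GlHat.mk_shift_mem _ _ _ fun h => Band.str_shift_of_ne h _
  mem := GlHat.mk_shift_mem _ _ _ fun _ => rfl
  bracket_eq n x hx := by
    obtain ⟨c, z, hz, rfl⟩ := GlHat.exists_of_mem_gr hx
    rw [GlHat.degreeElement, GlHat.bracket_mk_shift, GlHat.smul_mk, ← Band.shift_smul, zero_add]
    congr 1
    · congr 1
      funext q
      simp only [Int.cast_zero, zero_mul, sgn, if_true, one_smul, Pi.smul_apply, sub_zero]
      rw [Algebra.smul_def, map_intCast]
      push_cast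
      ring
    · by_cases hn : n = 0
      · subst hn
        have h0 : Band.shift (R := TruncPoly m) 0 (fun q => 0) = 0 := Band.shift_zero 0
        simp [h0, Band.str]
      · rw [hz hn, smul_zero, Band.str_shift_of_ne hn]
  iSup_eq_top := by
    rw [eq_top_iff]
    rintro ⟨A, z⟩ -
    obtain ⟨s, hs⟩ := A.exists_sum_shift
    let inc : Band (TruncPoly m) →+ GlHat m :=
      { toFun := fun A => GlHat.mk A 0, map_zero' := rfl
        map_add' := fun A B => by rw [GlHat.mk_add, add_zero] }
    have h : ((A, z) : GlHat m) = inc A + GlHat.mk (Band.shift 0 0) z := by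
      change GlHat.mk A z = GlHat.mk A 0 + _
      rw [GlHat.mk_add, Band.shift_zero, add_zero, zero_add]
    rw [h, hs, map_sum]
    refine add_mem (sum_mem fun n _ => ?_) ?_
    · exact Submodule.mem_iSup_of_mem n (GlHat.mk_shift_mem _ _ _ fun _ => rfl)
    · exact Submodule.mem_iSup_of_mem 0 (GlHat.mk_shift_mem _ _ _ fun h => absurd rfl h)

theorem GlHatVec.mem_gr {N : ℕ} {m : Fin N → ℕ} {n : ℤ} {x : GlHatVec m} :
    x ∈ GlHatVec.gr m n ↔ ∀ i, x i ∈ GlHat.gr (m i) n := by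
  simp [GlHatVec.gr, Submodule.mem_pi]

theorem GlHatVec.single_mem_gr {N : ℕ} {m : Fin N → ℕ} {n : ℤ} (i : Fin N) {x : GlHat (m i)}
    (hx : x ∈ GlHat.gr (m i) n) : (Pi.single i x : GlHatVec m) ∈ GlHatVec.gr m n := by
  rw [GlHatVec.mem_gr]
  intro j
  by_cases h : j = i
  · subst h; simpa using hx
  · rw [Pi.single_eq_of_ne h]; exact zero_mem _

theorem GlHatVec.innerGrading {N : ℕ} (m : Fin N → ℕ) :
    InnerGrading (GlHatVec.gr m) fun i => GlHat.degreeElement (m i) where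
  parity_eq n x hx := funext fun i =>
    (GlHat.innerGrading (m i)).parity_eq n _ (GlHatVec.mem_gr.1 hx i)
  bracket_mem n k x hx y hy := GlHatVec.mem_gr.2 fun i =>
    (GlHat.innerGrading (m i)).bracket_mem n k _ (GlHatVec.mem_gr.1 hx i) _
      (GlHatVec.mem_gr.1 hy i)
  mem := GlHatVec.mem_gr.2 fun i => (GlHat.innerGrading (m i)).mem
  bracket_eq n x hx := funext fun i =>
    (GlHat.innerGrading (m i)).bracket_eq n _ (GlHatVec.mem_gr.1 hx i)
  iSup_eq_top := by
    rw [eq_top_iff]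
    intro x _
    rw [← Finset.univ_sum_single x]
    refine sum_mem fun i _ => ?_
    have h : (⊤ : Submodule ℂ (GlHat (m i))) ≤
        (⨆ n, GlHatVec.gr m n).comap (LinearMap.single ℂ (fun j => GlHat (m j)) i) := by
      rw [← (GlHat.innerGrading (m i)).iSup_eq_top]
      exact iSup_le fun n y hy => Submodule.mem_iSup_of_mem n (GlHatVec.single_mem_gr i hy)
    exact h trivial

end QPDO

/-! ### Difference equations, nilpotent elements and interpolation -/

namespace QPDO

open Polynomial

/-- Summation in both directions from `0`. At least one of the two interval sums is always empty, so
one formula serves both signs of `k`. -/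
theorem exists_primitive {R : Type*} [AddCommGroup R] (b : ℤ → R) (r : R) :
    ∃ F : ℤ → R, F 0 = r ∧ ∀ k, F k - F (k - 1) = b k := by
  refine ⟨fun k => r + ∑ j ∈ Finset.Ioc 0 k, b j - ∑ j ∈ Finset.Ioc k 0, b j, by simp, ?_⟩
  intro k
  beta_reduce
  rcases le_or_gt k 0 with hk | hk
  · have h : Finset.Ioc (k - 1) 0 = insert k (Finset.Ioc k 0) := by
      ext j; simp only [Finset.mem_Ioc, Finset.mem_insert]; omega
    rw [h, Finset.sum_insert (by simp), Finset.Ioc_eq_empty (by omega : ¬(0 : ℤ) < k),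
      Finset.Ioc_eq_empty (by omega : ¬(0 : ℤ) < k - 1)]
    abel
  · have h : Finset.Ioc 0 k = insert k (Finset.Ioc 0 (k - 1)) := by
      ext j; simp only [Finset.mem_Ioc, Finset.mem_insert]; omega
    rw [h, Finset.sum_insert (by simp), Finset.Ioc_eq_empty (by omega : ¬k < 0),
      Finset.Ioc_eq_empty (by omega : ¬k - 1 < 0)]
    abel

/-- On each residue class modulo `n` this is a difference equation of step one, solved by a
primitive in the quotient `p / n`; Euclidean division also covers negative `n`. This is where
diagonals with `n ≠ 0` differ from the main diagonal. -/
theorem exists_sub_shift_eq {R : Type*} [AddCommGroup R] {n : ℤ} (hn : n ≠ 0) (b : ℤ → R) :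
    ∃ h : ℤ → R, ∀ p, h (p - n) - h p = b p := by
  choose F _ hF using fun r : ℤ => exists_primitive (fun k => -b (r + n * k)) 0
  refine ⟨fun p => F (p % n) (p / n), fun p => ?_⟩
  have h1 : (p - n) % n = p % n := Int.sub_emod_right p n
  have h2 : (p - n) / n = p / n - 1 := by
    rw [show p - n = p + (-1) * n by ring, Int.add_mul_ediv_right _ _ hn]; ring
  have h3 := hF (p % n) (p / n)
  rw [Int.emod_add_mul_ediv] at h3
  simp only [h1, h2]
  rw [← neg_sub, h3, neg_neg]

/-- Twisting by `(-1)^k` turns the sum into a difference. The free initial value `r` will carry the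
central component of an element of degree `0`. -/
theorem exists_add_shift_eq {R : Type*} [AddCommGroup R] [Module ℂ R] (d : ℤ → R) (r : R) :
    ∃ x : ℤ → R, x 0 = r ∧ ∀ p, x p + x (p - 1) = d p := by
  obtain ⟨F, h0, hF⟩ := exists_primitive (fun k => ((-1 : ℂ) ^ k) • d k) r
  refine ⟨fun k => ((-1 : ℂ) ^ k) • F k, by simpa using h0, fun p => ?_⟩
  have h1 : (-1 : ℂ) ^ (p - 1) = -(-1) ^ p := by
    rw [zpow_sub₀ (by norm_num), zpow_one, div_neg, div_one]
  have h2 : ((-1 : ℂ) ^ p) * (-1) ^ p = 1 := by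
    rw [← mul_zpow]; simp
  simp only [h1]
  rw [neg_smul, ← sub_eq_add_neg, ← smul_sub, hF, smul_smul, h2, one_smul]

/-- If the constants and a nilpotent element `δ = w - w₀` generate `R` in the sense that
`R = ℂ + δ R`, then every element of `R` is a polynomial in `w`. -/
theorem aeval_surjective_of_nilpotent {R : Type*} [CommRing R] [Algebra ℂ R] (w : R) (w₀ : ℂ)
    {M : ℕ} (hM : (w - algebraMap ℂ R w₀) ^ M = 0)
    (h : ∀ x : R, ∃ (z : ℂ) (y : R), x = algebraMap ℂ R z + (w - algebraMap ℂ R w₀) * y) (x : R) :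
    ∃ f : ℂ[X], aeval w f = x := by
  -- Successive approximation: `x` is a polynomial in `w` up to a remainder in `δ^k R`, which
  -- vanishes for `k = M`.
  have key : ∀ k : ℕ, ∃ (f : ℂ[X]) (y : R),
      x = aeval w f + (w - algebraMap ℂ R w₀) ^ k * y := by
    intro k
    induction k with
    | zero => exact ⟨0, x, by simp⟩
    | succ k ih =>
      obtain ⟨f, y, hf⟩ := ih
      obtain ⟨z, y', hy⟩ := h y
      refine ⟨f + (X - C w₀) ^ k * C z, y', ?_⟩
      rw [hf, map_add, map_mul, map_pow, map_sub, aeval_X, aeval_C, aeval_C]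
      nth_rewrite 1 [hy]
      ring
  obtain ⟨f, y, hf⟩ := key M
  exact ⟨f, by rw [hf, hM, zero_mul, add_zero]⟩

/-- By Taylor expansion at `w₀`, `f(w)` is the non-zero constant `f(w₀)` plus a multiple of the
nilpotent `w - w₀`. -/
theorem isUnit_aeval {R : Type*} [CommRing R] [Algebra ℂ R] {w : R} {w₀ : ℂ}
    (hw : IsNilpotent (w - algebraMap ℂ R w₀)) {f : ℂ[X]} (hf : f.eval w₀ ≠ 0) :
    IsUnit (aeval w f) := by
  obtain ⟨g, hg⟩ := X_sub_C_dvd_sub_C_eval (a := w₀) (p := f)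
  have h1 : aeval w f = algebraMap ℂ R (f.eval w₀) + (w - algebraMap ℂ R w₀) * aeval w g := by
    have := congrArg (aeval w) hg
    simp only [map_sub, map_mul, aeval_X, aeval_C] at this
    rw [← this]; ring
  rw [h1]
  exact ((Commute.all _ _).isNilpotent_mul_right hw).isUnit_add_left_of_commute
    ((isUnit_iff_ne_zero.2 hf).map _) (Commute.all _ _)

/-- Hermite interpolation. -/
theorem exists_interpolation {ι : Type*} [Finite ι] {R : ι → Type*} [∀ i, CommRing (R i)]
    [∀ i, Algebra ℂ (R i)] (w : ∀ i, R i) (w₀ : ι → ℂ) (hw₀ : Function.Injective w₀) (M : ι → ℕ)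
    (hM : ∀ i, (w i - algebraMap ℂ (R i) (w₀ i)) ^ M i = 0)
    (h : ∀ i, ∀ x : R i, ∃ f : ℂ[X], aeval (w i) f = x) (x : ∀ i, R i) :
    ∃ f : ℂ[X], ∀ i, aeval (w i) f = x i := by
  choose g hg using fun i => h i (x i)
  -- Chinese remainder theorem for the pairwise coprime powers `(X - w₀ i)^{M i}`. Evaluation at `w
  -- i` annihilates the `i`-th of them, so a congruence becomes an equality of values.
  obtain ⟨f, hf⟩ := Ideal.exists_forall_sub_mem_ideal
    (I := fun i => Ideal.span {(X - C (w₀ i)) ^ M i}) (fun i j hij => by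
      simp only [Function.onFun]
      rw [Ideal.isCoprime_span_singleton_iff]
      exact (pairwise_coprime_X_sub_C hw₀ hij).pow) g
  refine ⟨f, fun i => ?_⟩
  obtain ⟨k, hk⟩ := Ideal.mem_span_singleton.1 (hf i)
  have := congrArg (aeval (w i)) hk
  simp only [map_sub, map_mul, map_pow, aeval_X, aeval_C, hM, zero_mul, hg] at this
  exact sub_eq_zero.1 this

/-- The truncated series of `exp (ℓ ε)` is `1 + ε u` with `u = ℓ + (nilpotent)`, a unit because `ℓ ≠
0`. -/
theorem exists_exp_sum_eq {R : Type*} [CommRing R] [Algebra ℂ R] (ℓ : ℂ) (hℓ : ℓ ≠ 0) (m : ℕ)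
    (ε : R) (hε : ε ^ (m + 1) = 0) (x : R)
    (hx : x = ∑ l ∈ Finset.range (m + 1), algebraMap ℂ R (ℓ ^ l / (l.factorial : ℂ)) * ε ^ l) :
    ∃ u : R, IsUnit u ∧ x = 1 + ε * u := by
  set c : ℕ → R := fun l => algebraMap ℂ R (ℓ ^ l / (l.factorial : ℂ)) with hc
  -- A vanishing term is appended so that division by `ε` leaves the constant term `ℓ` in `u` even
  -- for `m = 0`.
  have h1 : x = ∑ l ∈ Finset.range (m + 2), c l * ε ^ l := by
    rw [Finset.sum_range_succ, hε, mul_zero, add_zero, hx]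
  refine ⟨∑ l ∈ Finset.range (m + 1), c (l + 1) * ε ^ l, ?_, ?_⟩
  · rw [Finset.sum_range_succ', pow_zero, mul_one]
    have h2 : ∑ l ∈ Finset.range m, c (l + 1 + 1) * ε ^ (l + 1) =
        ε * ∑ l ∈ Finset.range m, c (l + 1 + 1) * ε ^ l := by
      rw [Finset.mul_sum]
      exact Finset.sum_congr rfl fun l _ => by ring
    rw [h2]
    refine ((Commute.all _ _).isNilpotent_mul_right
      ⟨m + 1, hε⟩).isUnit_add_right_of_commute (IsUnit.map _ (isUnit_iff_ne_zero.2 ?_))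
      (Commute.all _ _)
    simpa using hℓ
  · rw [h1, Finset.sum_range_succ', Finset.mul_sum, add_comm]
    congr 1
    · simp [hc]
    · exact Finset.sum_congr rfl fun l _ => by ring

/-! ### The values of the symbol of `T_q` -/

section Evaluation

variable (q : ℂˣ) (ℓ a : ℂ) (m : ℕ)

/-- The class of `t` in `R_m`. -/
noncomputable def truncVar (m : ℕ) : TruncPoly m :=
  Ideal.Quotient.mk (Ideal.span {(X : ℂ[X]) ^ (m + 1)}) X

theorem truncVar_pow : truncVar m ^ (m + 1) = 0 := by
  rw [truncVar, ← map_pow]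
  exact Ideal.Quotient.eq_zero_iff_mem.2 (Ideal.mem_span_singleton_self _)

theorem exists_eq_add_truncVar_mul (x : TruncPoly m) :
    ∃ (z : ℂ) (y : TruncPoly m), x = algebraMap ℂ _ z + truncVar m * y := by
  obtain ⟨f, rfl⟩ := Ideal.Quotient.mk_surjective x
  refine ⟨f.coeff 0, Ideal.Quotient.mk _ f.divX, ?_⟩
  nth_rewrite 1 [← f.X_mul_divX_add]
  rw [map_add, map_mul, add_comm]
  rfl

theorem smul_eq_algebraMap_mul (z : ℂ) (x : TruncPoly m) : z • x = algebraMap ℂ _ z * x :=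
  Algebra.smul_def z x

theorem exists_qPowT_one_eq (hℓ : ℓ ≠ 0) : ∃ u : TruncPoly m, IsUnit u ∧
    qPowT ℓ m 1 = 1 + truncVar m * u := by
  refine exists_exp_sum_eq ℓ hℓ m (truncVar m) (truncVar_pow m) _ ?_
  rw [qPowT]
  refine Finset.sum_congr rfl fun l _ => ?_
  rw [one_mul, smul_eq_algebraMap_mul]
  rfl

theorem qPowT_zero : qPowT ℓ m 0 = 1 := by
  rw [qPowT_eq_exp]; simp

/-- The rule `evalPow_mul` with no shift is plain multiplicativity in the exponent. Consequently the
entries of the images of the operators with `k ≥ 0` are polynomials in the single element `evalPow q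
ℓ a m 1 n`. -/
theorem evalPow_eq_pow (k : ℕ) (n : ℤ) : evalPow q ℓ a m k n = evalPow q ℓ a m 1 n ^ k := by
  induction k with
  | zero => simp [evalPow, qPowT_zero]
  | succ k ih =>
    have h := evalPow_mul q ℓ a m k 1 0 n
    rw [sub_zero, mul_zero, zpow_zero, one_smul, ih] at h
    rw [pow_succ, h]
    norm_cast

/-- The value of `w` at `t = 0`. -/
noncomputable def evalPoint (n : ℤ) : ℂ := Complex.exp (ℓ * a) * (q : ℂ) ^ (-n)

theorem evalPoint_ne_zero (n : ℤ) : evalPoint q ℓ a n ≠ 0 :=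
  mul_ne_zero (Complex.exp_ne_zero _) (zpow_ne_zero _ q.ne_zero)

/-- With `w₀ = s q^{-n}` one has `w - w₀ = w₀ (q^t - 1)`, and `q^t - 1` is `t` times a unit as `log
q ≠ 0`. So `w - w₀` is nilpotent, and it generates the same ideal as `t`, which makes every element
of `R_m` a polynomial in `w`. -/
theorem exists_evalPow_one_sub (hℓ : ℓ ≠ 0) (n : ℤ) : ∃ u : TruncPoly m, IsUnit u ∧
    evalPow q ℓ a m 1 n - algebraMap ℂ _ (evalPoint q ℓ a n) = truncVar m * u := by
  obtain ⟨u, hu, h⟩ := exists_qPowT_one_eq ℓ m hℓ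
  refine ⟨algebraMap ℂ _ (evalPoint q ℓ a n) * u,
    ((isUnit_iff_ne_zero.2 (evalPoint_ne_zero q ℓ a n)).map _).mul hu, ?_⟩
  rw [evalPow, Int.cast_one, h, zpow_one, mul_one, smul_eq_algebraMap_mul]
  change algebraMap ℂ _ (evalPoint q ℓ a n) * _ - _ = _
  ring

theorem evalPow_sub_pow (hℓ : ℓ ≠ 0) (n : ℤ) :
    (evalPow q ℓ a m 1 n - algebraMap ℂ _ (evalPoint q ℓ a n)) ^ (m + 1) = 0 := by
  obtain ⟨u, -, h⟩ := exists_evalPow_one_sub q ℓ a m hℓ n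
  rw [h, mul_pow, truncVar_pow, zero_mul]

theorem aeval_evalPow_surjective (hℓ : ℓ ≠ 0) (n : ℤ) (x : TruncPoly m) :
    ∃ f : ℂ[X], aeval (evalPow q ℓ a m 1 n) f = x := by
  refine aeval_surjective_of_nilpotent _ _ (evalPow_sub_pow q ℓ a m hℓ n) (fun x => ?_) x
  obtain ⟨u, ⟨u, rfl⟩, h⟩ := exists_evalPow_one_sub q ℓ a m hℓ n
  obtain ⟨z, y, hy⟩ := exists_eq_add_truncVar_mul m x
  refine ⟨z, (u⁻¹ : (TruncPoly m)ˣ) * y, ?_⟩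
  rw [h, hy, mul_assoc, Units.mul_inv_cancel_left]

/-- For one `i` a coincidence would make `q` a root of unity, against `|q| ≠ 1`. For distinct `i`,
`j` it would put `a_i - a_j` into `ℤ + τ⁻¹ ℤ`. -/
theorem evalPoint_injective {N : ℕ} (a : Fin N → ℂ) (hq : ‖(q : ℂ)‖ ≠ 1)
    (hℓ : Complex.exp ℓ = (q : ℂ))
    (ha : ∀ i j : Fin N, i ≠ j → ∀ n k : ℤ,
      a i - a j ≠ (n : ℂ) + (ℓ / (2 * (Real.pi : ℂ) * Complex.I))⁻¹ * (k : ℂ)) :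
    Function.Injective fun x : Fin N × ℤ => evalPoint q ℓ (a x.1) x.2 := by
  have hℓ0 : ℓ ≠ 0 := by
    rintro rfl
    rw [Complex.exp_zero] at hℓ
    rw [← hℓ] at hq
    simp at hq
  have hz : ∀ n : ℤ, (q : ℂ) ^ n = Complex.exp (n * ℓ) := fun n => by
    rw [← hℓ, Complex.exp_int_mul]
  rintro ⟨i, n⟩ ⟨j, k⟩ h
  simp only [evalPoint] at h
  by_cases hij : i = j
  · subst hij
    have h1 := mul_left_cancel₀ (Complex.exp_ne_zero _) h
    have h2 : (q : ℂ) ^ (k - n) = 1 := by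
      rw [show k - n = -n - -k by ring, zpow_sub₀ q.ne_zero, h1, div_self]
      exact zpow_ne_zero _ q.ne_zero
    have h3 : k - n = 0 := by
      by_contra h4
      exact one_sub_zpow_ne_zero q hq _ h4 (by rw [h2, sub_self])
    rw [show n = k by omega]
  · exfalso
    rw [hz, hz, ← Complex.exp_add, ← Complex.exp_add, Complex.exp_eq_exp_iff_exists_int] at h
    obtain ⟨z, hz⟩ := h
    -- Equality of the exponentials means `ℓ a_i - n ℓ = ℓ a_j - k ℓ + 2πi z`; division by `ℓ` gives
    -- `a_i - a_j = (n - k) + τ⁻¹ z`.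
    refine ha i j hij (n - k) z ?_
    push_cast at hz ⊢
    rw [inv_div, div_mul_eq_mul_div, ← sub_eq_iff_eq_add', eq_div_iff hℓ0]
    linear_combination hz

end Evaluation

end QPDO

/-! ### Density of the quantum pseudo-differential operators in non-zero degrees -/

namespace QPDO

open Polynomial

/-- The matrices supported on the `n`-th diagonal, in each component. -/
noncomputable def diagonalMap {N : ℕ} (m : Fin N → ℕ) (n : ℤ) :
    (∀ i, ℤ → TruncPoly (m i)) →ₗ[ℂ] GlHatVec m where
  toFun c i := GlHat.mk (Band.shift n (c i)) 0
  map_add' c d := funext fun i => by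
    rw [Pi.add_apply, Pi.add_apply, GlHat.mk_add, Band.shift_add, add_zero]
  map_smul' z c := funext fun i => by
    rw [Pi.smul_apply, Pi.smul_apply, GlHat.smul_mk, Band.shift_smul, smul_zero]
    rfl

section

variable {N : ℕ} {m : Fin N → ℕ}

theorem diagonalMap_apply (n : ℤ) (c : ∀ i, ℤ → TruncPoly (m i)) (i : Fin N) :
    diagonalMap m n c i = GlHat.mk (Band.shift n (c i)) 0 := rfl

theorem diagonalMap_mem (n : ℤ) (c : ∀ i, ℤ → TruncPoly (m i)) :
    diagonalMap m n c ∈ GlHatVec.gr m n :=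
  GlHatVec.mem_gr.2 fun i => GlHat.mk_shift_mem n (c i) 0 fun _ => rfl

theorem exists_diagonalMap_eq {n : ℤ} (hn : n ≠ 0) {x : GlHatVec m} (hx : x ∈ GlHatVec.gr m n) :
    ∃ c, x = diagonalMap m n c := by
  choose c z hz h using fun i => GlHat.exists_of_mem_gr (GlHatVec.mem_gr.1 hx i)
  refine ⟨c, funext fun i => ?_⟩
  rw [h i, hz i hn, diagonalMap_apply]

/-- For `n ≠ 0`, multiplying the entries on the `n`-th diagonal by any given numbers is the adjoint
action of a diagonal matrix. -/
theorem exists_bracket_eq_mul {n : ℤ} (hn : n ≠ 0) (b : ∀ i, ℤ → TruncPoly (m i)) :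
    ∃ h, ∀ c, LieSuperalgebra.bracket (diagonalMap m 0 h) (diagonalMap m n c) =
      diagonalMap m n (b * c) := by
  -- Bracketing with the diagonal matrix `h` multiplies the entry in column `p` by `h (p - n) - h
  -- p`, so this difference must equal `b p`.
  choose h hh using fun i => exists_sub_shift_eq hn (b i)
  refine ⟨h, fun c => funext fun i => ?_⟩
  change LieSuperalgebra.bracket (diagonalMap m 0 h i) (diagonalMap m n c i) = _
  rw [diagonalMap_apply, diagonalMap_apply, diagonalMap_apply, GlHat.bracket_mk_shift, zero_add,
    Band.str_shift_of_ne hn]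
  congr 2
  funext p
  have h1 := hh i p
  simp only [Int.cast_zero, zero_mul, sgn, if_true, one_smul, sub_zero, Pi.mul_apply]
  rw [← h1]
  ring

/-- Every element of degree `0` is a single bracket of elements of degrees `1 / 2` and `-1 / 2`. -/
theorem exists_bracket_eq_of_mem_zero {x : GlHatVec m} (hx : x ∈ GlHatVec.gr m 0) :
    ∃ c d, x = LieSuperalgebra.bracket (diagonalMap m 1 c) (diagonalMap m (-1) d) := by
  choose e z _ h using fun i => GlHat.exists_of_mem_gr (GlHatVec.mem_gr.1 hx i)
  choose y hy0 hy using fun i => exists_add_shift_eq (e i) (z i)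
  -- Both elements are odd, so their bracket is an anticommutator, with entry `y p + y (p - 1)` in
  -- column `p`. The cutoff `J` lets only `p = 0` contribute to the cocycle, with value `y 0`, and
  -- this initial value was chosen to be the central component.
  refine ⟨fun i p => y i (p - 1), fun i _ => 1, funext fun i => ?_⟩
  change _ = LieSuperalgebra.bracket (diagonalMap m 1 _ i) (diagonalMap m (-1) _ i)
  rw [h i, diagonalMap_apply, diagonalMap_apply, GlHat.bracket_mk_shift, add_neg_cancel]
  congr 1
  · congr 1
    funext p
    have h1 : sgn (((1 : ℤ) : ZMod 2) * ((-1 : ℤ) : ZMod 2)) = -1 := by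
      have h2 : ((1 : ℤ) : ZMod 2) * ((-1 : ℤ) : ZMod 2) = 1 := by decide
      rw [h2]
      simp [sgn]
    rw [h1, neg_one_smul, sub_neg_eq_add, mul_one, one_mul, ← hy i p,
      show p - -1 - 1 = p by ring]
  · unfold Band.str
    rw [finsum_eq_single _ 0]
    · simp [Band.shift_entry, sgn, hy0]
    · intro p hp
      have h1 : p ≤ 0 ↔ p < 0 := by omega
      simp [Band.shift_entry, h1]

/-- The projection to the columns whose index has the form `pos e n`. -/
noncomputable def columnIndicator (m : Fin N → ℕ) (e : Fin 2) : ∀ i, ℤ → TruncPoly (m i) :=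
  fun _ p => if p = pos e ((p + 1) / 2) then 1 else 0

/-- Rounding down makes one formula serve both blocks: `pos e n + 1` is `2n + 1` or `2n`. -/
theorem pos_add_one_div (e : Fin 2) (n : ℤ) : (pos e n + 1) / 2 = n := by
  have := e.isLt
  unfold pos
  omega

theorem columnIndicator_pos (e e' : Fin 2) (i : Fin N) (n : ℤ) :
    columnIndicator m e i (pos e' n) = if e' = e then 1 else 0 := by
  simp [columnIndicator, pos_add_one_div, pos_inj]

variable (q : ℂˣ) (hq : ‖(q : ℂ)‖ ≠ 1) (ℓ : ℂ) (a : Fin N → ℂ)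

/-- The values of the symbol `w` of `T_q` in the columns. -/
noncomputable def symbol (m : Fin N → ℕ) : ∀ i, ℤ → TruncPoly (m i) :=
  fun i p => evalPow q ℓ (a i) (m i) 1 ((p + 1) / 2)

theorem symbol_pos (e : Fin 2) (i : Fin N) (n : ℤ) :
    symbol q ℓ a m i (pos e n) = evalPow q ℓ (a i) (m i) 1 n := by
  rw [symbol, pos_add_one_div]

theorem aeval_symbol (f : ℂ[X]) (i : Fin N) (p : ℤ) :
    aeval (symbol q ℓ a m) f i p = aeval (symbol q ℓ a m i p) f := by
  have h := aeval_algHom_apply ((Pi.evalAlgHom ℂ (fun _ : ℤ => TruncPoly (m i)) p).comp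
    (Pi.evalAlgHom ℂ (fun i => ℤ → TruncPoly (m i)) i)) (symbol q ℓ a m) f
  exact h.symm

theorem exists_phiHatVec_monomial {n : ℤ} (hn : n ≠ 0) (e : Fin 2) (k : ℕ) :
    ∃ y, (phiHatVec q hq ℓ a m).toLin y =
      diagonalMap m n (columnIndicator m e * symbol q ℓ a m ^ k) := by
  -- The doubled degree `n` and the column block `e` determine the row block and the power of `z`:
  -- the image of `z^{-r} T_q^k M_{ie}` has its entries at `(pos i (c + r), pos e c)`, hence on the
  -- diagonal `-e - pos i r`.
  obtain ⟨i, r, hr⟩ := exists_pos (-(n + ((e : ℕ) : ℤ)))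
  refine ⟨((QOp.mono q (-r) k i e, 0) : QOp q × ℂ), funext fun j => ?_⟩
  have he := e.isLt
  have hi := i.isLt
  -- A central term needs `r = 0` and `i = e`, that is, degree `0`.
  have h1 : ¬(-r = 0 ∧ (k : ℤ) ≠ 0 ∧ i = e) := by
    rintro ⟨h, -, rfl⟩
    unfold pos at hr
    omega
  change ((phi q ℓ (a j) (m j) (QOp.mono q (-r) k i e),
    kappa q ℓ (a j) (m j) (QOp.mono q (-r) k i e) + (0 : ℂ) • 1) : Band _ × TruncPoly (m j)) =
      (_, 0)
  rw [phi_mono, kappa_mono, if_neg h1, zero_smul, add_zero]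
  congr 1
  ext u p
  obtain ⟨e', c, rfl⟩ := exists_pos p
  rw [phiMono_entry, Band.shift_entry, Pi.mul_apply, Pi.mul_apply, columnIndicator_pos,
    Pi.pow_apply, Pi.pow_apply, symbol_pos, ← evalPow_eq_pow]
  by_cases h : e' = e
  · subst h
    have h2 : (u = pos i (c + r)) ↔ (pos e' c = u + n) := by
      unfold pos at hr ⊢
      omega
    simp [h2]
  · simp [h]

theorem exists_phiHatVec_aeval {n : ℤ} (hn : n ≠ 0) (e : Fin 2) (f : ℂ[X]) :
    ∃ y, (phiHatVec q hq ℓ a m).toLin y =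
      diagonalMap m n (columnIndicator m e * aeval (symbol q ℓ a m) f) := by
  induction f using Polynomial.induction_on' with
  | add f g hf hg =>
    obtain ⟨y, hy⟩ := hf
    obtain ⟨z, hz⟩ := hg
    exact ⟨y + z, by rw [map_add, hy, hz, ← map_add, ← mul_add, ← map_add]⟩
  | monomial k c =>
    obtain ⟨y, hy⟩ := exists_phiHatVec_monomial q hq ℓ a (m := m) hn e k
    exact ⟨c • y, by rw [map_smul, hy, ← map_smul, aeval_monomial, ← Algebra.smul_def,
      mul_smul_comm]⟩

end

section

variable {N : ℕ} {m : Fin N → ℕ} {V : Type*} [AddCommGroup V] [Module ℂ V]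
  (ρ : SuperRep (GlHatVec m) V) (deg : ℤ → Submodule ℂ V)
  {n : ℤ} (S : Finset ℤ)

/-- The annihilating sequences form an ideal: multiplication by `b` is the bracket with an element
of degree `0`, and such an element maps each `deg j` into itself, so both terms of the
supercommutator vanish on `deg j`. -/
theorem annihilator_mul (hdeg : SuperRep.IsGrading (GlHatVec.gr m) ρ deg) (hn : n ≠ 0) (b c : ∀ i, ℤ → TruncPoly (m i))
    (h : ∀ j ∈ S, ∀ v ∈ deg j, ρ.action (diagonalMap m n c) v = 0) :
    ∀ j ∈ S, ∀ v ∈ deg j, ρ.action (diagonalMap m n (b * c)) v = 0 := by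
  intro j hj v hv
  obtain ⟨d, hd⟩ := exists_bracket_eq_mul hn b
  have hG := GlHatVec.innerGrading m
  have hv' : ρ.action (diagonalMap m 0 d) v ∈ deg j := by
    have := hdeg.2 0 j _ (diagonalMap_mem 0 d) v hv
    rwa [zero_add] at this
  rw [← hd, ρ.action_bracket _ _ _ _ (hG.parity_eq 0 _ (diagonalMap_mem 0 d))
    (hG.parity_eq n _ (diagonalMap_mem n c)), h j hj v hv, h j hj _ hv', map_zero, smul_zero,
    sub_zero]

/-- Some non-zero polynomial in the symbol of `T_q` acts by zero, on the `n`-th diagonal, on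
finitely many given homogeneous parts of `V`. -/
theorem exists_annihilating_polynomial (q : ℂˣ) (ℓ : ℂ) (a : Fin N → ℂ)
    (hdeg : SuperRep.IsGrading (GlHatVec.gr m) ρ deg) (hfin : ∀ j, FiniteDimensional ℂ (deg j)) :
    ∃ P : ℂ[X], P ≠ 0 ∧ ∀ j ∈ S, ∀ v ∈ deg j,
      ρ.action (diagonalMap m n (aeval (symbol q ℓ a m) P)) v = 0 := by
  let Φ : ∀ j, (∀ i, ℤ → TruncPoly (m i)) →ₗ[ℂ] deg j →ₗ[ℂ] deg (n + j) := fun j =>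
    LinearMap.mk₂ ℂ (fun c v => ⟨ρ.action (diagonalMap m n c) v,
        hdeg.2 n j _ (diagonalMap_mem n c) v v.2⟩)
      (fun c d v => Subtype.ext (by simp)) (fun z c v => Subtype.ext (by simp))
      (fun c v w => Subtype.ext (by simp)) (fun z c v => Subtype.ext (by simp))
  let Ψ : ℂ[X] →ₗ[ℂ] ∀ j : S, deg j →ₗ[ℂ] deg (n + j) :=
    (LinearMap.pi fun j : S => Φ j) ∘ₗ (aeval (symbol q ℓ a m)).toLinearMap
  -- The target is a finite product of spaces of maps between finite-dimensional spaces, while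
  -- `ℂ[X]` is infinite-dimensional.
  have h1 : ¬Function.Injective Ψ := fun h =>
    Polynomial.not_finite (R := ℂ) (Module.Finite.of_injective Ψ h)
  rw [← LinearMap.ker_eq_bot, ← Ne, Submodule.ne_bot_iff] at h1
  obtain ⟨P, hP, hP0⟩ := h1
  refine ⟨P, hP0, fun j hj v hv => ?_⟩
  have h2 := LinearMap.congr_fun (congrFun (LinearMap.mem_ker.1 hP) ⟨j, hj⟩) ⟨v, hv⟩
  exact congrArg Subtype.val h2

/-- The density statement. Let `P(w)` annihilate the chosen parts. A sequence `d` from the image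
that agrees with `c` wherever `P(w)` fails to be a unit differs from `c` by a multiple of `P(w)`,
and so acts on these parts in the same way. -/
theorem exists_phiHatVec_action_eq (q : ℂˣ) (hq : ‖(q : ℂ)‖ ≠ 1) (ℓ : ℂ)
    (hℓ : Complex.exp ℓ = (q : ℂ)) (a : Fin N → ℂ)
    (ha : ∀ i j : Fin N, i ≠ j → ∀ n k : ℤ,
      a i - a j ≠ (n : ℂ) + (ℓ / (2 * (Real.pi : ℂ) * Complex.I))⁻¹ * (k : ℂ))
    (hdeg : SuperRep.IsGrading (GlHatVec.gr m) ρ deg) (hfin : ∀ j, FiniteDimensional ℂ (deg j))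
    (hn : n ≠ 0) (c : ∀ i, ℤ → TruncPoly (m i)) :
    ∃ y, ∀ j ∈ S, ∀ v ∈ deg j, ρ.action (diagonalMap m n c) v =
      ρ.action ((phiHatVec q hq ℓ a m).toLin y) v := by
  have hℓ0 : ℓ ≠ 0 := by
    rintro rfl
    rw [Complex.exp_zero] at hℓ
    rw [← hℓ] at hq
    simp at hq
  have hinj := evalPoint_injective q ℓ a hq hℓ ha
  obtain ⟨P, hP0, hP⟩ := exists_annihilating_polynomial ρ deg (n := n) S q ℓ a hdeg hfin
  -- The exceptional places: those where the value of `P(w)` at `t = 0` vanishes. They are finitely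
  -- many since `P` has finitely many roots and distinct places give distinct points.
  set F : Set (Fin N × ℤ) := {x | P.eval (evalPoint q ℓ (a x.1) x.2) = 0} with hF
  have hFfin : F.Finite :=
    (P.roots.toFinset.finite_toSet.preimage hinj.injOn).subset fun x hx => by
      have h0 : P.eval (evalPoint q ℓ (a x.1) x.2) = 0 := hx
      simpa [hP0] using h0
  have := hFfin.to_subtype
  -- The columns `pos 0 k` and `pos 1 k` share the value of `w`, so each block gets its own
  -- interpolating polynomial; the two are glued with the column indicators.
  have hf : ∀ e : Fin 2, ∃ f : ℂ[X], ∀ x : F,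
      aeval (evalPow q ℓ (a x.1.1) (m x.1.1) 1 x.1.2) f = c x.1.1 (pos e x.1.2) := fun e =>
    exists_interpolation (fun x : F => evalPow q ℓ (a x.1.1) (m x.1.1) 1 x.1.2)
      (fun x => evalPoint q ℓ (a x.1.1) x.1.2) (hinj.comp Subtype.val_injective)
      (fun x => m x.1.1 + 1) (fun x => evalPow_sub_pow q ℓ _ _ hℓ0 _)
      (fun x => aeval_evalPow_surjective q ℓ _ _ hℓ0 _) (fun x => c x.1.1 (pos e x.1.2))
  choose f hf using hf
  choose y hy using fun e => exists_phiHatVec_aeval q hq ℓ a (m := m) hn e (f e)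
  set d : ∀ i, ℤ → TruncPoly (m i) :=
    ∑ e, columnIndicator m e * aeval (symbol q ℓ a m) (f e) with hd
  have hd' : ∀ i e k, d i (pos e k) = aeval (evalPow q ℓ (a i) (m i) 1 k) (f e) := by
    intro i e k
    simp only [hd, Finset.sum_apply, Pi.mul_apply, columnIndicator_pos, aeval_symbol, symbol_pos,
      ite_mul, one_mul, zero_mul, Finset.sum_ite_eq, Finset.mem_univ, if_true]
  -- Divisibility can be checked column by column: at the places of `F` the difference is zero, and
  -- elsewhere `P(w)` is invertible.
  have hcd : ∃ b, c - d = b * aeval (symbol q ℓ a m) P := by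
    have : ∀ i p, ∃ b, c i p - d i p = b * aeval (symbol q ℓ a m i p) P := by
      intro i p
      obtain ⟨e, k, rfl⟩ := exists_pos p
      rw [symbol_pos, hd']
      by_cases hx : ((i, k) : Fin N × ℤ) ∈ F
      · exact ⟨0, by rw [zero_mul, hf e ⟨_, hx⟩, sub_self]⟩
      · obtain ⟨u, hu⟩ := isUnit_aeval (R := TruncPoly (m i))
          ⟨m i + 1, evalPow_sub_pow q ℓ (a i) (m i) hℓ0 k⟩ hx
        exact ⟨_ * (u⁻¹ : (TruncPoly (m i))ˣ), by rw [← hu, Units.inv_mul_cancel_right]⟩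
    choose b hb using this
    exact ⟨b, funext fun i => funext fun p => by
      rw [Pi.mul_apply, Pi.mul_apply, aeval_symbol]; exact hb i p⟩
  obtain ⟨b, hb⟩ := hcd
  refine ⟨∑ e, y e, fun j hj v hv => ?_⟩
  have h1 := annihilator_mul ρ deg S hdeg hn b _ hP j hj v hv
  rw [← hb, map_sub, map_sub, LinearMap.sub_apply, sub_eq_zero] at h1
  have h2 : (phiHatVec q hq ℓ a m).toLin (∑ e, y e) = diagonalMap m n d := by
    simp only [hd, map_sum, hy]
  rw [h1, h2]

/-- Every subspace stable under the quantum pseudo-differential operators is stable under the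
infinite matrices. -/
theorem isSubmodule_of_pullback (q : ℂˣ) (hq : ‖(q : ℂ)‖ ≠ 1) (ℓ : ℂ)
    (hℓ : Complex.exp ℓ = (q : ℂ)) (a : Fin N → ℂ)
    (ha : ∀ i j : Fin N, i ≠ j → ∀ n k : ℤ,
      a i - a j ≠ (n : ℂ) + (ℓ / (2 * (Real.pi : ℂ) * Complex.I))⁻¹ * (k : ℂ))
    (hρ : SuperRep.IsQuasifinite (GlHatVec.gr m) ρ) (U : Submodule ℂ V)
    (hU : (ρ.pullback (phiHatVec q hq ℓ a m)).IsSubmodule U) : ρ.IsSubmodule U := by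
  obtain ⟨deg, hdeg, hfin⟩ := hρ
  have hG := GlHatVec.innerGrading m
  have h1 : ∀ n : ℤ, n ≠ 0 → ∀ c, ∀ u ∈ U, ρ.action (diagonalMap m n c) u ∈ U := by
    intro n hn c u hu
    have hu' : u ∈ ⨆ j, deg j := by rw [hdeg.1.submodule_iSup_eq_top]; trivial
    obtain ⟨f, hf, hfu⟩ := (Submodule.mem_iSup_iff_exists_finsupp _ _).1 hu'
    -- The finite set of degrees is the support of `u`. The operator `y` depends on `u`, which is
    -- harmless: it acts on `u` itself as the diagonal does, and the components of `u` need not lie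
    -- in `U`.
    obtain ⟨y, hy⟩ := exists_phiHatVec_action_eq ρ deg f.support q hq ℓ hℓ a ha hdeg hfin hn c
    have h2 : ρ.action (diagonalMap m n c) u = ρ.action ((phiHatVec q hq ℓ a m).toLin y) u := by
      rw [← hfu, Finsupp.sum, map_sum, map_sum]
      exact Finset.sum_congr rfl fun j hj => hy j hj _ (hf j)
    rw [h2]
    exact hU y u hu
  let T : Submodule ℂ (GlHatVec m) :=
    { carrier := {x | ∀ u ∈ U, ρ.action x u ∈ U}
      zero_mem' := fun u _ => by rw [map_zero]; exact zero_mem _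
      add_mem' := fun hx hy u hu => by rw [map_add]; exact add_mem (hx u hu) (hy u hu)
      smul_mem' := fun z x hx u hu => by rw [map_smul]; exact U.smul_mem z (hx u hu) }
  have hT : (⊤ : Submodule ℂ (GlHatVec m)) ≤ T := by
    rw [← hG.iSup_eq_top]
    refine iSup_le fun n x hx => ?_
    by_cases hn : n = 0
    -- Degree `0` is reached through a bracket of degrees `1` and `-1`, both already known to
    -- preserve `U`.
    · subst hn
      obtain ⟨c, d, rfl⟩ := exists_bracket_eq_of_mem_zero hx
      intro u hu
      rw [ρ.action_bracket _ _ _ _ (hG.parity_eq 1 _ (diagonalMap_mem 1 c))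
        (hG.parity_eq (-1) _ (diagonalMap_mem (-1) d))]
      exact sub_mem (h1 1 one_ne_zero c _ (h1 (-1) (by decide) d u hu))
        (U.smul_mem _ (h1 (-1) (by decide) d _ (h1 1 one_ne_zero c u hu)))
    · obtain ⟨c, rfl⟩ := exists_diagonalMap_eq hn hx
      exact h1 n hn c
  exact fun x u hu => hT (Submodule.mem_top (x := x)) u hu

end

end QPDO

/-! ### Highest weight modules over an algebra with an inner grading -/

namespace QPDO

/-- Applying `f - μ k` removes the `k`-th vector and rescales the others by non-zero factors, so
induction on the number of vectors applies. -/
theorem mem_of_sum_eigenvectors_mem {ι V : Type*} [AddCommGroup V] [Module ℂ V]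
    (f : Module.End ℂ V) (U : Submodule ℂ V) (hU : ∀ u ∈ U, f u ∈ U) (μ : ι → ℂ)
    (hμ : Function.Injective μ) (s : Finset ι) (v : ι → V) (hv : ∀ i ∈ s, f (v i) = μ i • v i)
    (h : ∑ i ∈ s, v i ∈ U) : ∀ i ∈ s, v i ∈ U := by
  classical
  induction s using Finset.induction_on generalizing v with
  | empty => simp
  | insert k s hk ih =>
    have h1 : f (∑ i ∈ insert k s, v i) - μ k • ∑ i ∈ insert k s, v i =
        ∑ i ∈ s, (μ i - μ k) • v i := by
      rw [map_sum, Finset.smul_sum, ← Finset.sum_sub_distrib, Finset.sum_insert hk,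
        hv k (Finset.mem_insert_self _ _), sub_self, zero_add]
      exact Finset.sum_congr rfl fun i hi => by
        rw [hv i (Finset.mem_insert_of_mem hi), sub_smul]
    have h2 := ih (fun i => (μ i - μ k) • v i) (fun i hi => by
      rw [map_smul, hv i (Finset.mem_insert_of_mem hi), smul_comm])
      (h1 ▸ sub_mem (hU _ h) (U.smul_mem _ h))
    have h3 : ∀ i ∈ s, v i ∈ U := fun i hi => by
      have h4 : μ i - μ k ≠ 0 := sub_ne_zero.2 fun e => hk (hμ e ▸ hi)
      exact (U.smul_mem_iff h4).1 (h2 i hi)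
    intro i hi
    rcases Finset.mem_insert.1 hi with rfl | hi
    · rw [Finset.sum_insert hk] at h
      exact (Submodule.add_mem_iff_left U (sum_mem h3)).1 h
    · exact h3 i hi

/-- A subspace stable under an operator with distinct eigenvalues on the parts of a direct sum
decomposition is the direct sum of its intersections with the parts. -/
theorem eq_iSup_inf_of_stable {ι V : Type*} [AddCommGroup V] [Module ℂ V]
    (f : Module.End ℂ V) (deg : ι → Submodule ℂ V) (hdeg : ⨆ i, deg i = ⊤) (μ : ι → ℂ)
    (hμ : Function.Injective μ) (hf : ∀ i, ∀ v ∈ deg i, f v = μ i • v)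
    (U : Submodule ℂ V) (hU : ∀ u ∈ U, f u ∈ U) : U = ⨆ i, U ⊓ deg i := by
  refine le_antisymm (fun u hu => ?_) (iSup_le fun i => inf_le_left)
  have hu' : u ∈ ⨆ i, deg i := by rw [hdeg]; trivial
  obtain ⟨v, hv, hvu⟩ := (Submodule.mem_iSup_iff_exists_finsupp _ _).1 hu'
  have h := mem_of_sum_eigenvectors_mem f U hU μ hμ v.support v (fun i _ => hf i _ (hv i))
    (by rw [← hvu] at hu; exact hu)
  rw [← hvu]
  exact sum_mem fun i hi => Submodule.mem_iSup_of_mem i ⟨h i hi, hv i⟩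

namespace SuperRep

variable {g V : Type*} [AddCommGroup g] [Module ℂ g] [LieSuperalgebra g] [AddCommGroup V]
  [Module ℂ V] {gr : ℤ → Submodule ℂ g} {D : g} {ρ : SuperRep g V} {deg : ℤ → Submodule ℂ V}
  {wt : Module.Dual ℂ (gr 0)}

theorem isSubmodule_of_homogeneous (hG : InnerGrading gr D) (U : Submodule ℂ V)
    (h : ∀ n, ∀ x ∈ gr n, ∀ u ∈ U, ρ.action x u ∈ U) : ρ.IsSubmodule U := by
  let T : Submodule ℂ g :=
    { carrier := {x | ∀ u ∈ U, ρ.action x u ∈ U}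
      zero_mem' := fun u _ => by rw [map_zero]; exact zero_mem _
      add_mem' := fun hx hy u hu => by rw [map_add]; exact add_mem (hx u hu) (hy u hu)
      smul_mem' := fun z x hx u hu => by rw [map_smul]; exact U.smul_mem z (hx u hu) }
  have hT : (⊤ : Submodule ℂ g) ≤ T := by
    rw [← hG.iSup_eq_top]
    exact iSup_le fun n x hx => h n x hx
  exact fun x u hu => hT (Submodule.mem_top (x := x)) u hu

theorem action_action (hG : InnerGrading gr D) {n k : ℤ} {x y : g} (hx : x ∈ gr n)
    (hy : y ∈ gr k) (v : V) : ρ.action x (ρ.action y v) =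
      ρ.action (LieSuperalgebra.bracket x y) v +
        sgn ((n : ZMod 2) * (k : ZMod 2)) • ρ.action y (ρ.action x v) := by
  rw [ρ.action_bracket _ _ x y (hG.parity_eq n x hx) (hG.parity_eq k y hy), sub_add_cancel]

theorem action_D_action (hG : InnerGrading gr D) {n : ℤ} {x : g} (hx : x ∈ gr n) {c : ℂ} {v : V}
    (hv : ρ.action D v = c • v) : ρ.action D (ρ.action x v) = (c + n) • ρ.action x v := by
  rw [action_action hG hG.mem hx, hG.bracket_eq n x hx, hv, map_smul, map_smul,
    LinearMap.smul_apply, Int.cast_zero, zero_mul, sgn, if_pos rfl, one_smul, add_smul, add_comm]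

theorem parity_D (hG : InnerGrading gr D) : LieSuperalgebra.parity D = D := by
  rw [hG.parity_eq 0 D hG.mem]
  simp [sgn]

theorem add_intCast_injective (c : ℂ) : Function.Injective fun n : ℤ => c + (n : ℂ) :=
  (add_right_injective c).comp Int.cast_injective

namespace IsHighestWeight

/-- The subspaces on the left lie in the `deg n`, and their sum contains the highest weight vector
and is stable under the negative part, hence is everything. As the `deg n` are independent, each
inclusion is an equality. The conditional packs two facts: the degrees are non-positive, and `D`
acts on `deg n` by the scalar `wt D + n`. -/
theorem eigenspace_inf (hG : InnerGrading gr D) (h : IsHighestWeight gr ρ deg wt) (n : ℤ) :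
    (if n ≤ 0 then deg n ⊓ (ρ.action D).eigenspace (wt ⟨D, hG.mem⟩ + n) else ⊥) = deg n := by
  obtain ⟨hdeg, v, -, hv0, hvwt, -, hgen⟩ := h
  set S : ℤ → Submodule ℂ V := fun n =>
    if n ≤ 0 then deg n ⊓ (ρ.action D).eigenspace (wt ⟨D, hG.mem⟩ + n) else ⊥ with hS
  have hS1 : ∀ n ≤ 0, S n = deg n ⊓ (ρ.action D).eigenspace (wt ⟨D, hG.mem⟩ + n) :=
    fun n hn => if_pos hn
  have hle : S ≤ deg := fun n => by
    by_cases hn : n ≤ 0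
    · rw [hS1 n hn]; exact inf_le_left
    · simp [hS, hn]
  have htop : ⨆ n, S n = ⊤ := by
    refine hgen _ (Submodule.mem_iSup_of_mem 0 ?_) fun n hn x hx => ?_
    · rw [hS1 0 le_rfl]
      refine ⟨by rw [hv0]; exact Submodule.mem_span_singleton_self v, ?_⟩
      rw [SetLike.mem_coe, Module.End.mem_eigenspace_iff, Int.cast_zero, add_zero]
      exact hvwt ⟨D, hG.mem⟩
    · change ⨆ n, S n ≤ (⨆ n, S n).comap (ρ.action x)
      refine iSup_le fun k w hw => ?_
      by_cases hk : k ≤ 0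
      · rw [hS1 k hk] at hw
        refine Submodule.mem_iSup_of_mem (n + k) ?_
        rw [hS1 _ (by omega)]
        refine ⟨hdeg.2 n k x hx w hw.1, ?_⟩
        rw [SetLike.mem_coe, Module.End.mem_eigenspace_iff,
          action_D_action hG hx (Module.End.mem_eigenspace_iff.1 hw.2)]
        push_cast
        congr 1
        ring
      · have h0 : w = 0 := by simpa [hS, hk] using hw
        rw [h0]
        exact zero_mem _
  exact congrFun ((hdeg.1.submodule_iSupIndep.le_iff_eq_of_iSup_eq_top htop).1 hle) n

theorem deg_eq_bot (hG : InnerGrading gr D) (h : IsHighestWeight gr ρ deg wt) {n : ℤ}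
    (hn : 0 < n) : deg n = ⊥ := by
  rw [← h.eigenspace_inf hG n, if_neg (by omega)]

theorem action_D (hG : InnerGrading gr D) (h : IsHighestWeight gr ρ deg wt) {n : ℤ} {v : V}
    (hv : v ∈ deg n) : ρ.action D v = (wt ⟨D, hG.mem⟩ + n) • v := by
  by_cases hn : n ≤ 0
  · rw [← h.eigenspace_inf hG n, if_pos hn] at hv
    exact Module.End.mem_eigenspace_iff.1 hv.2
  · rw [h.deg_eq_bot hG (by omega)] at hv
    rw [(Submodule.mem_bot ℂ).1 hv, map_zero, smul_zero]

/-- Eigenspaces for distinct eigenvalues are independent, and the smaller spaces `deg n` already sum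
to `V`. -/
theorem eigenspace_eq (hG : InnerGrading gr D) (h : IsHighestWeight gr ρ deg wt) (n : ℤ) :
    deg n = (ρ.action D).eigenspace (wt ⟨D, hG.mem⟩ + n) := by
  have hind := (ρ.action D).eigenspaces_iSupIndep.comp (add_intCast_injective (wt ⟨D, hG.mem⟩))
  exact congrFun ((hind.le_iff_eq_of_iSup_eq_top h.1.1.submodule_iSup_eq_top).1
    fun n v hv => Module.End.mem_eigenspace_iff.2 (h.action_D hG hv)) n

/-- A gradation is not required to be compatible with parity. Here compatibility follows because `D`
is even, so that parity preserves its eigenspaces. -/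
theorem parity_mem (hG : InnerGrading gr D) (h : IsHighestWeight gr ρ deg wt) {n : ℤ} {v : V}
    (hv : v ∈ deg n) : ρ.parity v ∈ deg n := by
  rw [h.eigenspace_eq hG, Module.End.mem_eigenspace_iff] at hv ⊢
  have h1 := ρ.parity_action D v
  rw [parity_D hG] at h1
  rw [← h1, hv, map_smul]

theorem eq_iSup_inf (hG : InnerGrading gr D) (h : IsHighestWeight gr ρ deg wt)
    (U : Submodule ℂ V) (hU : ∀ u ∈ U, ρ.action D u ∈ U) : U = ⨆ n, U ⊓ deg n :=
  eq_iSup_inf_of_stable (ρ.action D) deg h.1.1.submodule_iSup_eq_top _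
    (add_intCast_injective (wt ⟨D, hG.mem⟩)) (fun _ _ hv => h.action_D hG hv) U hU

end IsHighestWeight

/-- The vectors killed by the part of `g` of positive degree. -/
def singular (gr : ℤ → Submodule ℂ g) (ρ : SuperRep g V) : Submodule ℂ V where
  carrier := {v | ∀ n : ℤ, 0 < n → ∀ x ∈ gr n, ρ.action x v = 0}
  zero_mem' n _ x _ := map_zero _
  add_mem' hv hw n hn x hx := by rw [map_add, hv n hn x hx, hw n hn x hx, add_zero]
  smul_mem' c v hv n hn x hx := by rw [map_smul, hv n hn x hx, smul_zero]

/-- The smallest subspace that contains `S` and is stable under the part of `g` of negative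
degree. -/
def lowerClosure (gr : ℤ → Submodule ℂ g) (ρ : SuperRep g V) (S : Submodule ℂ V) :
    Submodule ℂ V :=
  sInf {W | S ≤ W ∧ ∀ n : ℤ, n < 0 → ∀ x ∈ gr n, ∀ w ∈ W, ρ.action x w ∈ W}

theorem le_lowerClosure (S : Submodule ℂ V) : S ≤ lowerClosure gr ρ S :=
  le_sInf fun _ hW => hW.1

theorem lowerClosure_le {S W : Submodule ℂ V} (hS : S ≤ W)
    (hW : ∀ n : ℤ, n < 0 → ∀ x ∈ gr n, ∀ w ∈ W, ρ.action x w ∈ W) : lowerClosure gr ρ S ≤ W :=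
  sInf_le ⟨hS, hW⟩

theorem lowerClosure_stable (S : Submodule ℂ V) {n : ℤ} (hn : n < 0) {x : g} (hx : x ∈ gr n)
    {w : V} (hw : w ∈ lowerClosure gr ρ S) : ρ.action x w ∈ lowerClosure gr ρ S := by
  rw [lowerClosure, Submodule.mem_sInf] at hw ⊢
  exact fun W hW => hW.2 n hn x hx w (hw W hW)

/-- If `S` is stable under the parts of `g` of non-negative degree, then it generates its closure
under the negative parts. -/
theorem isSubmodule_lowerClosure (hG : InnerGrading gr D) (S : Submodule ℂ V)
    (hS : ∀ n : ℤ, 0 ≤ n → ∀ x ∈ gr n, ∀ s ∈ S, ρ.action x s ∈ S) :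
    ρ.IsSubmodule (lowerClosure gr ρ S) := by
  set W := lowerClosure gr ρ S with hW
  -- The vectors of `W` that the non-negative parts send into `W`. They contain `S`; moving `x` past
  -- `y` shows that they are stable under the negative part, so they exhaust `W`.
  let W' : Submodule ℂ V :=
    { carrier := {w | w ∈ W ∧ ∀ n : ℤ, 0 ≤ n → ∀ x ∈ gr n, ρ.action x w ∈ W}
      zero_mem' := ⟨zero_mem _, fun n _ x _ => by rw [map_zero]; exact zero_mem _⟩
      add_mem' := fun hv hw => ⟨add_mem hv.1 hw.1, fun n hn x hx => by
        rw [map_add]; exact add_mem (hv.2 n hn x hx) (hw.2 n hn x hx)⟩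
      smul_mem' := fun c v hv => ⟨W.smul_mem c hv.1, fun n hn x hx => by
        rw [map_smul]; exact W.smul_mem c (hv.2 n hn x hx)⟩ }
  have h : W ≤ W' := by
    refine lowerClosure_le (fun s hs => ⟨le_lowerClosure S hs, fun n hn x hx =>
      le_lowerClosure S (hS n hn x hx s hs)⟩) fun k hk y hy w hw =>
        ⟨lowerClosure_stable S hk hy hw.1, fun n hn x hx => ?_⟩
    rw [action_action hG hx hy]
    refine add_mem ?_ (W.smul_mem _ (lowerClosure_stable S hk hy (hw.2 n hn x hx)))
    have hxy := hG.bracket_mem n k x hx y hy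
    rcases le_or_gt 0 (n + k) with h0 | h0
    · exact hw.2 _ h0 _ hxy
    · exact lowerClosure_stable S h0 hxy hw.1
  refine isSubmodule_of_homogeneous hG W fun n x hx w hw => ?_
  rcases le_or_gt 0 n with h0 | h0
  · exact (h hw).2 n h0 x hx
  · exact lowerClosure_stable S h0 hx hw

/-- The singular vectors of an irreducible highest weight module are the multiples of the highest
weight vector. -/
theorem singular_le (hG : InnerGrading gr D) (h : IsHighestWeight gr ρ deg wt)
    (hirr : ∀ U : Submodule ℂ V, ρ.IsSubmodule U → U = ⨆ n, U ⊓ deg n → U = ⊥ ∨ U = ⊤) :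
    singular gr ρ ≤ deg 0 := by
  -- The singular vectors are stable under `D`, so their space is graded and can be examined degree
  -- by degree.
  have hD : ∀ u ∈ singular gr ρ, ρ.action D u ∈ singular gr ρ := by
    intro u hu n hn x hx
    have h1 := action_action (ρ := ρ) hG hG.mem hx u
    rw [hu n hn x hx, map_zero, hG.bracket_eq n x hx, map_smul, LinearMap.smul_apply,
      hu n hn x hx, smul_zero, zero_add] at h1
    simpa [sgn] using h1.symm
  rw [h.eq_iSup_inf hG _ hD]
  refine iSup_le fun n => ?_
  rcases lt_trichotomy n 0 with hn | rfl | hn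
  · set S := singular gr ρ ⊓ deg n with hS
    have hst : ∀ k : ℤ, 0 ≤ k → ∀ x ∈ gr k, ∀ s ∈ S, ρ.action x s ∈ S := by
      intro k hk x hx s hs
      rcases hk.lt_or_eq with hk | rfl
      · rw [hs.1 k hk x hx]; exact zero_mem _
      · refine ⟨fun j hj y hy => ?_, by simpa using h.1.2 0 n x hx s hs.2⟩
        have hxy := hG.bracket_mem j 0 y hy x hx
        rw [action_action hG hy hx, hs.1 _ (by omega) _ hxy, hs.1 j hj y hy, map_zero, smul_zero,
          add_zero]
    have hsub := isSubmodule_lowerClosure hG S hst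
    -- Singular vectors of negative degree generate a submodule lying in negative degrees. It misses
    -- the highest weight vector, so irreducibility forces it to be zero.
    have hle : lowerClosure gr ρ S ≤ ⨆ k, ⨆ (_ : k < 0), deg k := by
      refine lowerClosure_le (inf_le_right.trans (le_iSup₂_of_le n hn le_rfl))
        fun j hj x hx => ?_
      change _ ≤ (⨆ k, ⨆ (_ : k < 0), deg k).comap (ρ.action x)
      exact iSup₂_le fun k hk w hw => Submodule.mem_iSup_of_mem (j + k)
        (Submodule.mem_iSup_of_mem (by omega) (h.1.2 j k x hx w hw))
    rcases hirr _ hsub (h.eq_iSup_inf hG _ fun u hu => hsub D u hu) with h0 | h0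
    · rw [eq_bot_iff.2 ((le_lowerClosure S).trans h0.le)]
      exact bot_le
    · exfalso
      obtain ⟨v, hv, hv0, -⟩ := h.2
      have hdis := h.1.1.submodule_iSupIndep 0
      refine hv ?_
      rw [← Submodule.mem_bot ℂ, ← hdis.eq_bot]
      refine ⟨by rw [hv0]; exact Submodule.mem_span_singleton_self v, ?_⟩
      have h1 : v ∈ ⨆ k, ⨆ (_ : k < 0), deg k := hle (h0 ▸ Submodule.mem_top)
      have h2 : (⨆ k, ⨆ (_ : k < 0), deg k) ≤ ⨆ k, ⨆ (_ : k ≠ 0), deg k :=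
        iSup_mono fun k => iSup_mono' fun hk => ⟨hk.ne, le_rfl⟩
      exact h2 h1
  · exact inf_le_right
  · rw [h.deg_eq_bot hG hn, inf_bot_eq]
    exact bot_le

end SuperRep

end QPDO

/-! ### Contractions and total degree on tensor products -/

namespace QPDO

open scoped TensorProduct
open PiTensorProduct

section Multilinear

variable {N : ℕ} {L : Fin N → Type*} [∀ i, AddCommGroup (L i)] [∀ i, Module ℂ (L i)]

/-- The functional `w_1 ⊗ ⋯ ⊗ w_N ↦ h_1(w_1) ⋯ h_N(w_N)`. -/
noncomputable def pureDual (h : ∀ j, Module.Dual ℂ (L j)) : Module.Dual ℂ (⨂[ℂ] j, L j) :=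
  lift ((MultilinearMap.mkPiAlgebra ℂ (Fin N) ℂ).compLinearMap h)

theorem pureDual_tprod (h : ∀ j, Module.Dual ℂ (L j)) (w : ∀ j, L j) :
    pureDual h (tprod ℂ w) = ∏ j, h j (w j) := by
  simp [pureDual]

/-- The pure functionals separate the points of the tensor product. -/
theorem ext_pureDual {u u' : ⨂[ℂ] j, L j} (h : ∀ f, pureDual f u = pureDual f u') : u = u' := by
  let b := fun j => Module.Basis.ofVectorSpace ℂ (L j)
  refine (Basis.piTensorProduct b).ext_elem fun p => ?_
  -- The coordinates in a product basis are themselves pure functionals.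
  have key : ((Basis.piTensorProduct b).coord p) = pureDual fun j => (b j).coord (p j) := by
    refine PiTensorProduct.ext (MultilinearMap.ext fun w => ?_)
    simp only [LinearMap.compMultilinearMap_apply, pureDual_tprod, Module.Basis.coord_apply,
      Basis.piTensorProduct_repr_tprod_apply]
  have h1 := h fun j => (b j).coord (p j)
  rwa [← key] at h1

theorem prod_erase_update_self (f : ∀ j, Module.Dual ℂ (L j)) (w : ∀ j, L j) (i : Fin N)
    (z : L i) : ∏ k ∈ Finset.univ.erase i, f k (Function.update w i z k) =
      ∏ k ∈ Finset.univ.erase i, f k (w k) :=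
  Finset.prod_congr rfl fun k hk => by rw [Function.update_of_ne (Finset.ne_of_mem_erase hk)]

theorem prod_erase_update_of_ne (f : ∀ j, Module.Dual ℂ (L j)) (w : ∀ j, L j) {i j : Fin N}
    (hj : j ≠ i) (z : L j) : ∏ k ∈ Finset.univ.erase i, f k (Function.update w j z k) =
      f j z * ∏ k ∈ (Finset.univ.erase i).erase j, f k (w k) := by
  rw [← Finset.mul_prod_erase _ _ (Finset.mem_erase.2 ⟨hj, Finset.mem_univ j⟩),
    Function.update_self]
  congr 1
  exact Finset.prod_congr rfl fun k hk => by
    rw [Function.update_of_ne (Finset.ne_of_mem_erase hk)]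

/-- The multilinear map `(w_j) ↦ (∏_{j ≠ i} f_j(w_j)) w_i`. -/
noncomputable def contractMultilinear (i : Fin N) (f : ∀ j, Module.Dual ℂ (L j)) :
    MultilinearMap ℂ L (L i) where
  toFun w := (∏ j ∈ Finset.univ.erase i, f j (w j)) • w i
  map_update_add' := by
    intro inst w j x y
    obtain rfl : inst = instDecidableEqFin N := Subsingleton.elim _ _
    by_cases hj : j = i
    · subst hj
      simp only [prod_erase_update_self, Function.update_self, smul_add]
    · simp only [prod_erase_update_of_ne f w hj, Function.update_of_ne (Ne.symm hj), map_add, add_mul,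
        add_smul]
  map_update_smul' := by
    intro inst w j c x
    obtain rfl : inst = instDecidableEqFin N := Subsingleton.elim _ _
    by_cases hj : j = i
    · subst hj
      simp only [prod_erase_update_self, Function.update_self]
      rw [smul_comm]
    · simp only [prod_erase_update_of_ne f w hj, Function.update_of_ne (Ne.symm hj), map_smul,
        smul_eq_mul, mul_smul]

/-- Contraction with functionals in all factors but the `i`-th one. -/
noncomputable def contract (i : Fin N) (f : ∀ j, Module.Dual ℂ (L j)) :
    (⨂[ℂ] j, L j) →ₗ[ℂ] L i :=
  lift (contractMultilinear i f)

theorem contract_tprod (i : Fin N) (f : ∀ j, Module.Dual ℂ (L j)) (w : ∀ j, L j) :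
    contract i f (tprod ℂ w) = (∏ j ∈ Finset.univ.erase i, f j (w j)) • w i := by
  rw [contract, lift.tprod]
  rfl

/-- A pure functional can be evaluated in two stages, with the `i`-th factor last. This turns
conditions on contractions into conditions on pure functionals. -/
theorem pureDual_update (i : Fin N) (f : ∀ j, Module.Dual ℂ (L j)) (h : Module.Dual ℂ (L i))
    (u : ⨂[ℂ] j, L j) : pureDual (Function.update f i h) u = h (contract i f u) := by
  have key : pureDual (Function.update f i h) = h ∘ₗ contract i f := by
    refine PiTensorProduct.ext (MultilinearMap.ext fun w => ?_)
    simp only [LinearMap.compMultilinearMap_apply, LinearMap.comp_apply, pureDual_tprod,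
      contract_tprod, map_smul, smul_eq_mul]
    rw [← Finset.mul_prod_erase _ _ (Finset.mem_univ i), Function.update_self, mul_comm]
    congr 1
    exact Finset.prod_congr rfl fun k hk => by
      rw [Function.update_of_ne (Finset.ne_of_mem_erase hk)]
  rw [key, LinearMap.comp_apply]

/-- The parity involutions that the Koszul sign rule puts on the earlier factors are absorbed into
the functionals, because they square to the identity. Thus an operator at place `i` that kills `u`
also kills every contraction of `u` to the `i`-th factor, as `f` is arbitrary. -/
theorem contract_koszulOp (P : ∀ j, Module.End ℂ (L j)) (hP : ∀ j v, P j (P j v) = v)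
    (α : ZMod 2) (i : Fin N) (T : Module.End ℂ (L i)) (f : ∀ j, Module.Dual ℂ (L j))
    (u : ⨂[ℂ] j, L j) :
    contract i (fun j => if j < i ∧ α = 1 then f j ∘ₗ P j else f j) (koszulOp P α i T u) =
      T (contract i f u) := by
  have key : contract i (fun j => if j < i ∧ α = 1 then f j ∘ₗ P j else f j) ∘ₗ
      koszulOp P α i T = T ∘ₗ contract i f := by
    refine PiTensorProduct.ext (MultilinearMap.ext fun w => ?_)
    simp only [LinearMap.compMultilinearMap_apply, LinearMap.comp_apply, koszulOp_tprod,
      contract_tprod, map_smul, Function.update_self]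
    congr 1
    refine Finset.prod_congr rfl fun k hk => ?_
    rw [Function.update_of_ne (Finset.ne_of_mem_erase hk)]
    split_ifs with h
    · rw [LinearMap.comp_apply, hP]
    · rfl
  exact LinearMap.congr_fun key u

/-- If all contractions of `u` to the `i`-th factor are multiples of `v_i`, for all `i`, then `u` is
a multiple of `v_1 ⊗ ⋯ ⊗ v_N`. -/
theorem mem_span_tprod_of_contract (v : ∀ j, L j) (hv : ∀ j, v j ≠ 0) (u : ⨂[ℂ] j, L j)
    (hu : ∀ i f, contract i f u ∈ Submodule.span ℂ {v i}) :
    u ∈ Submodule.span ℂ {tprod ℂ v} := by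
  have hf : ∀ j, ∃ f : Module.Dual ℂ (L j), f (v j) = 1 := by
    intro j
    have h1 := (Module.forall_dual_apply_eq_zero_iff ℂ (v j)).not.2 (hv j)
    push Not at h1
    obtain ⟨f, hf⟩ := h1
    exact ⟨(f (v j))⁻¹ • f, by simp [hf]⟩
  choose f hf using hf
  -- The projection onto the line of `v j` along the kernel of `f j`. By hypothesis `π i` fixes all
  -- contractions to the `i`-th factor, so inserting it into a pure functional does not change the
  -- value at `u`.
  let π : ∀ j, Module.End ℂ (L j) := fun j => (f j).smulRight (v j)
  have h1 : ∀ i g h, pureDual (Function.update g i (h ∘ₗ π i)) u =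
      pureDual (Function.update g i h) u := by
    intro i g h
    rw [pureDual_update, pureDual_update, LinearMap.comp_apply]
    obtain ⟨c, hc⟩ := Submodule.mem_span_singleton.1 (hu i g)
    simp [← hc, π, hf]
  -- The projections are inserted one factor at a time; with all of them in place, `u` is fixed by
  -- `⨂ π`, whose image is the line of `⨂ v`.
  have h2 : ∀ (s : Finset (Fin N)) (h : ∀ j, Module.Dual ℂ (L j)),
      pureDual (fun j => if j ∈ s then h j ∘ₗ π j else h j) u = pureDual h u := by
    intro s h
    induction s using Finset.induction_on with
    | empty => simp
    | insert i s hi ih =>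
      have e1 : (fun j => if j ∈ insert i s then h j ∘ₗ π j else h j) =
          Function.update (fun j => if j ∈ s then h j ∘ₗ π j else h j) i (h i ∘ₗ π i) := by
        funext j
        by_cases hj : j = i
        · subst hj; simp
        · simp [hj]
      have e2 : (fun j => if j ∈ s then h j ∘ₗ π j else h j) =
          Function.update (fun j => if j ∈ s then h j ∘ₗ π j else h j) i (h i) := by
        rw [eq_comm, Function.update_eq_self_iff, if_neg hi]
      rw [e1, h1, ← e2, ih]
  have h3 : PiTensorProduct.map π u = u := by
    refine ext_pureDual fun h => ?_
    rw [← h2 Finset.univ h]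
    have key : pureDual h ∘ₗ PiTensorProduct.map π =
        pureDual fun j => if j ∈ Finset.univ then h j ∘ₗ π j else h j := by
      refine PiTensorProduct.ext (MultilinearMap.ext fun w => ?_)
      simp [pureDual_tprod]
    exact LinearMap.congr_fun key u
  have h4 : (⊤ : Submodule ℂ (⨂[ℂ] j, L j)) ≤
      (Submodule.span ℂ {tprod ℂ v}).comap (PiTensorProduct.map π) := by
    rw [← span_tprod_eq_top, Submodule.span_le]
    rintro _ ⟨w, rfl⟩
    rw [SetLike.mem_coe, Submodule.mem_comap, map_tprod]
    simp only [π, LinearMap.smulRight_apply]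
    rw [MultilinearMap.map_smul_univ]
    exact Submodule.smul_mem _ _ (Submodule.mem_span_singleton_self _)
  rw [← h3]
  exact h4 Submodule.mem_top

/-- The span of the tensors `v_1 ⊗ ⋯ ⊗ v_N` with `v_i` of degree `d_i`. -/
noncomputable def tensorBlock (deg : ∀ i, ℤ → Submodule ℂ (L i)) (d : Fin N → ℤ) :
    Submodule ℂ (⨂[ℂ] j, L j) :=
  Submodule.span ℂ {u | ∃ v : ∀ j, L j, (∀ j, v j ∈ deg j (d j)) ∧ tprod ℂ v = u}

/-- The total degree on a tensor product of graded spaces. -/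
noncomputable def tensorDeg (deg : ∀ i, ℤ → Submodule ℂ (L i)) (n : ℤ) :
    Submodule ℂ (⨂[ℂ] j, L j) :=
  ⨆ d : Fin N → ℤ, ⨆ _ : ∑ i, d i = n, tensorBlock deg d

variable {deg : ∀ i, ℤ → Submodule ℂ (L i)}

theorem tprod_mem_tensorBlock {d : Fin N → ℤ} {v : ∀ j, L j} (hv : ∀ j, v j ∈ deg j (d j)) :
    tprod ℂ v ∈ tensorBlock deg d :=
  Submodule.subset_span ⟨v, hv, rfl⟩

theorem tensorBlock_le_tensorDeg (d : Fin N → ℤ) :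
    tensorBlock deg d ≤ tensorDeg deg (∑ i, d i) :=
  le_iSup₂_of_le d rfl le_rfl

theorem finiteDimensional_tensorBlock (hfin : ∀ i n, FiniteDimensional ℂ (deg i n))
    (d : Fin N → ℤ) : FiniteDimensional ℂ (tensorBlock deg d) := by
  have h : tensorBlock deg d ≤
      LinearMap.range (PiTensorProduct.map fun i => (deg i (d i)).subtype) := by
    refine Submodule.span_le.2 ?_
    rintro _ ⟨v, hv, rfl⟩
    exact ⟨tprod ℂ fun j => ⟨v j, hv j⟩, by rw [map_tprod]; rfl⟩
  exact Submodule.finiteDimensional_of_le h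

theorem tensorBlock_eq_bot (hpos : ∀ i n, 0 < n → deg i n = ⊥) {d : Fin N → ℤ} {i : Fin N}
    (hd : 0 < d i) : tensorBlock deg d = ⊥ := by
  refine eq_bot_iff.2 (Submodule.span_le.2 ?_)
  rintro _ ⟨v, hv, rfl⟩
  have h := hv i
  rw [hpos i _ hd, Submodule.mem_bot] at h
  exact (MultilinearMap.map_coord_zero _ i h)

theorem tensorDeg_eq_bot (hpos : ∀ i n, 0 < n → deg i n = ⊥) {n : ℤ} (hn : 0 < n) :
    tensorDeg deg n = ⊥ := by
  refine eq_bot_iff.2 (iSup₂_le fun d hd => ?_)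
  obtain ⟨i, hi⟩ : ∃ i, 0 < d i := by
    by_contra! h
    have := Finset.sum_nonpos fun i (_ : i ∈ Finset.univ) => h i
    omega
  rw [tensorBlock_eq_bot hpos hi]

theorem finiteDimensional_tensorDeg (hpos : ∀ i n, 0 < n → deg i n = ⊥)
    (hfin : ∀ i n, FiniteDimensional ℂ (deg i n)) (n : ℤ) :
    FiniteDimensional ℂ (tensorDeg deg n) := by
  have := finiteDimensional_tensorBlock hfin
  -- Only non-positive degrees occur, so `∑ d_i = n` forces `n ≤ d_i ≤ 0`: finitely many blocks have
  -- total degree `n`.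
  have h : tensorDeg deg n ≤ (Finset.Icc (fun _ => n) (0 : Fin N → ℤ)).sup (tensorBlock deg) := by
    refine iSup₂_le fun d hd => ?_
    by_cases h0 : ∃ i, 0 < d i
    · obtain ⟨i, hi⟩ := h0
      rw [tensorBlock_eq_bot hpos hi]
      exact bot_le
    · push Not at h0
      refine Finset.le_sup (f := tensorBlock deg) (Finset.mem_Icc.2 ⟨fun i => ?_, h0⟩)
      rw [← hd, ← Finset.add_sum_erase _ _ (Finset.mem_univ i)]
      exact add_le_of_nonpos_right (Finset.sum_nonpos fun j _ => h0 j)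
  exact Submodule.finiteDimensional_of_le h

theorem iSup_tensorDeg (htop : ∀ i, ⨆ n, deg i n = ⊤) : ⨆ n, tensorDeg deg n = ⊤ := by
  -- Here `s` holds the factors that need not be homogeneous; multilinearity removes them one at a
  -- time.
  have key : ∀ (s : Finset (Fin N)) (v : ∀ j, L j), (∀ j, j ∉ s → ∃ d, v j ∈ deg j d) →
      tprod ℂ v ∈ ⨆ n, tensorDeg deg n := by
    intro s
    induction s using Finset.induction_on with
    | empty =>
      intro v hv
      choose d hd using fun j => hv j (Finset.notMem_empty j)
      exact Submodule.mem_iSup_of_mem _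
        (tensorBlock_le_tensorDeg d (tprod_mem_tensorBlock hd))
    | insert i s hi ih =>
      intro v hv
      have h : (⊤ : Submodule ℂ (L i)) ≤
          (⨆ n, tensorDeg deg n).comap ((PiTensorProduct.tprod ℂ).toLinearMap v i) := by
        rw [← htop i]
        refine iSup_le fun d w hw => ?_
        rw [Submodule.mem_comap, MultilinearMap.toLinearMap_apply]
        refine ih _ fun j hj => ?_
        by_cases hji : j = i
        · subst hji
          exact ⟨d, by rwa [Function.update_self]⟩
        · rw [Function.update_of_ne hji]
          exact hv j (by simp [hji, hj])
      have h1 := h (Submodule.mem_top (x := v i))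
      rwa [Submodule.mem_comap, MultilinearMap.toLinearMap_apply, Function.update_eq_self] at h1
  rw [eq_top_iff, ← span_tprod_eq_top, Submodule.span_le]
  rintro _ ⟨v, rfl⟩
  exact key Finset.univ v fun j hj => absurd (Finset.mem_univ j) hj

end Multilinear

end QPDO

/-! ### Tensor products of highest weight modules -/

namespace QPDO

open scoped TensorProduct
open PiTensorProduct

section TensorModule

variable {N : ℕ} {g L : Fin N → Type*} [∀ i, AddCommGroup (g i)] [∀ i, Module ℂ (g i)]
  [∀ i, LieSuperalgebra (g i)] [∀ i, AddCommGroup (L i)] [∀ i, Module ℂ (L i)]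
  {gr : ∀ i, ℤ → Submodule ℂ (g i)} {D : ∀ i, g i} {ρ : ∀ i, SuperRep (g i) (L i)}
  {deg : ∀ i, ℤ → Submodule ℂ (L i)} {wt : ∀ i, Module.Dual ℂ (gr i 0)}

theorem tensorRep_action_single (i : Fin N) (x : g i) :
    (tensorRep ρ).action (Pi.single i x) = tensorActionAt ρ i x := by
  change tensorAction ρ (Pi.single i x) = _
  rw [tensorAction, LinearMap.sum_apply, Finset.sum_eq_single i]
  · simp
  · intro j _ hj
    simp [Pi.single_eq_of_ne hj]
  · exact fun h => absurd (Finset.mem_univ i) h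

theorem tensorRep_action_eq_sum (x : ∀ i, g i) (u : ⨂[ℂ] j, L j) :
    (tensorRep ρ).action x u = ∑ i, tensorActionAt ρ i (x i) u := by
  change tensorAction ρ x u = _
  simp [tensorAction]

theorem tensorActionAt_tprod (hG : ∀ i, InnerGrading (gr i) (D i)) (i : Fin N) {n : ℤ} {x : g i}
    (hx : x ∈ gr i n) (v : ∀ j, L j) : tensorActionAt ρ i x (tprod ℂ v) =
      tprod ℂ (Function.update (fun j => if j < i ∧ (n : ZMod 2) = 1 then (ρ j).parity (v j)
        else v j) i ((ρ i).action x (v i))) := by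
  rw [tensorActionAt_of_homogeneous ρ i _ x ((hG i).parity_eq n x hx), koszulOp_tprod]

/-- On the factors other than the `i`-th only parity involutions can act, and these preserve the
homogeneous parts; so only the `i`-th degree moves. -/
theorem tensorActionAt_mem_tensorBlock (hG : ∀ i, InnerGrading (gr i) (D i))
    (h : ∀ i, SuperRep.IsHighestWeight (gr i) (ρ i) (deg i) (wt i)) (i : Fin N) {n : ℤ} {x : g i}
    (hx : x ∈ gr i n) (d : Fin N → ℤ) {u : ⨂[ℂ] j, L j} (hu : u ∈ tensorBlock deg d) :
    tensorActionAt ρ i x u ∈ tensorBlock deg (Function.update d i (n + d i)) := by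
  suffices h1 : tensorBlock deg d ≤
      (tensorBlock deg (Function.update d i (n + d i))).comap (tensorActionAt ρ i x) from h1 hu
  refine Submodule.span_le.2 ?_
  rintro _ ⟨v, hv, rfl⟩
  rw [SetLike.mem_coe, Submodule.mem_comap, tensorActionAt_tprod hG i hx]
  refine tprod_mem_tensorBlock fun j => ?_
  by_cases hj : j = i
  · subst hj
    rw [Function.update_self, Function.update_self]
    exact (h j).1.2 n (d j) x hx _ (hv j)
  · rw [Function.update_of_ne hj, Function.update_of_ne hj]
    split_ifs
    · exact (h j).parity_mem (hG j) (hv j)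
    · exact hv j

theorem tensorActionAt_mem_tensorDeg (hG : ∀ i, InnerGrading (gr i) (D i))
    (h : ∀ i, SuperRep.IsHighestWeight (gr i) (ρ i) (deg i) (wt i)) (i : Fin N) {n k : ℤ} {x : g i}
    (hx : x ∈ gr i n) {u : ⨂[ℂ] j, L j} (hu : u ∈ tensorDeg deg k) :
    tensorActionAt ρ i x u ∈ tensorDeg deg (n + k) := by
  suffices h1 : tensorDeg deg k ≤ (tensorDeg deg (n + k)).comap (tensorActionAt ρ i x) from h1 hu
  refine iSup₂_le fun d hd w hw => ?_
  have h1 : ∑ j, Function.update d i (n + d i) j = n + k := by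
    rw [← hd, ← Finset.add_sum_erase _ _ (Finset.mem_univ i), Function.update_self,
      ← Finset.add_sum_erase _ d (Finset.mem_univ i), add_assoc]
    congr 2
    exact Finset.sum_congr rfl fun j hj => by
      rw [Function.update_of_ne (Finset.ne_of_mem_erase hj)]
  rw [← h1]
  exact tensorBlock_le_tensorDeg _ (tensorActionAt_mem_tensorBlock hG h i hx d hw)

theorem tensorActionAt_D (hG : ∀ i, InnerGrading (gr i) (D i))
    (h : ∀ i, SuperRep.IsHighestWeight (gr i) (ρ i) (deg i) (wt i)) (i : Fin N) (d : Fin N → ℤ)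
    {u : ⨂[ℂ] j, L j} (hu : u ∈ tensorBlock deg d) :
    tensorActionAt ρ i (D i) u = (wt i ⟨D i, (hG i).mem⟩ + d i) • u := by
  rw [← Module.End.mem_eigenspace_iff]
  suffices h1 : tensorBlock deg d ≤ (tensorActionAt ρ i (D i)).eigenspace
    (wt i ⟨D i, (hG i).mem⟩ + d i) from h1 hu
  refine Submodule.span_le.2 ?_
  rintro _ ⟨v, hv, rfl⟩
  rw [SetLike.mem_coe, Module.End.mem_eigenspace_iff, tensorActionAt_tprod hG i (hG i).mem,
    (h i).action_D (hG i) (hv i)]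
  simp

theorem tensorRep_action_D (hG : ∀ i, InnerGrading (gr i) (D i))
    (h : ∀ i, SuperRep.IsHighestWeight (gr i) (ρ i) (deg i) (wt i)) {n : ℤ}
    {u : ⨂[ℂ] j, L j} (hu : u ∈ tensorDeg deg n) :
    (tensorRep ρ).action D u = (∑ i, wt i ⟨D i, (hG i).mem⟩ + n) • u := by
  rw [← Module.End.mem_eigenspace_iff]
  suffices h1 : tensorDeg deg n ≤ ((tensorRep ρ).action D).eigenspace
    (∑ i, wt i ⟨D i, (hG i).mem⟩ + n) from h1 hu
  refine iSup₂_le fun d hd w hw => ?_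
  rw [Module.End.mem_eigenspace_iff, tensorRep_action_eq_sum,
    Finset.sum_congr rfl fun i _ => tensorActionAt_D hG h i d hw, ← Finset.sum_smul,
    Finset.sum_add_distrib, ← hd]
  push_cast
  rfl

/-- The tensor product of quasifinite irreducible highest weight modules is quasifinite. -/
theorem isQuasifinite_tensorRep (hG : ∀ i, InnerGrading (gr i) (D i))
    (h : ∀ i, SuperRep.IsHighestWeight (gr i) (ρ i) (deg i) (wt i))
    (hfin : ∀ i n, FiniteDimensional ℂ (deg i n)) :
    SuperRep.IsQuasifinite (fun n => Submodule.pi Set.univ fun i => gr i n) (tensorRep ρ) := by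
  have hpos : ∀ i n, 0 < n → deg i n = ⊥ := fun i n hn => (h i).deg_eq_bot (hG i) hn
  refine ⟨tensorDeg deg, ⟨?_, fun n k x hx u hu => ?_⟩, finiteDimensional_tensorDeg hpos hfin⟩
  · refine DirectSum.isInternal_submodule_of_iSupIndep_of_iSup_eq_top ?_
      (iSup_tensorDeg fun i => (h i).1.1.submodule_iSup_eq_top)
    -- The total degrees are independent because they lie in eigenspaces of `D` for distinct
    -- eigenvalues.
    exact (((tensorRep ρ).action D).eigenspaces_iSupIndep.comp
      (SuperRep.add_intCast_injective _)).mono fun n u hu =>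
        Module.End.mem_eigenspace_iff.2 (tensorRep_action_D hG h hu)
  · rw [tensorRep_action_eq_sum]
    exact sum_mem fun i _ => tensorActionAt_mem_tensorDeg hG h i (hx i trivial) hu

/-- The tensor product of the highest weight vectors generates the tensor product. -/
theorem eq_top_of_tprod_mem (hG : ∀ i, InnerGrading (gr i) (D i))
    (h : ∀ i, SuperRep.IsHighestWeight (gr i) (ρ i) (deg i) (wt i))
    (U : Submodule ℂ (⨂[ℂ] j, L j)) (hU : (tensorRep ρ).IsSubmodule U)
    (h0 : ∀ v : ∀ j, L j, (∀ j, v j ∈ deg j 0) → tprod ℂ v ∈ U) : U = ⊤ := by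
  -- Induction on the set `s` of places where an arbitrary vector is allowed; the other places hold
  -- highest weight vectors up to scalars.
  have key : ∀ (s : Finset (Fin N)) (v : ∀ j, L j), (∀ j, j ∉ s → v j ∈ deg j 0) →
      tprod ℂ v ∈ U := by
    intro s
    induction s using Finset.induction_on with
    | empty => exact fun v hv => h0 v fun j => hv j (Finset.notMem_empty j)
    | insert i s hi ih =>
      intro v hv
      -- The vectors admissible at place `i` for every admissible choice of the others. Quantifying
      -- over all these choices is what makes `W` stable under the `i`-th algebra despite the Koszul
      -- signs.
      let W : Submodule ℂ (L i) :=
        ⨅ (w : ∀ j, L j) (_ : ∀ j, j ∉ insert i s → w j ∈ deg j 0),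
          U.comap ((PiTensorProduct.tprod ℂ).toLinearMap w i)
      have hW : ∀ y, y ∈ W ↔ ∀ w : ∀ j, L j, (∀ j, j ∉ insert i s → w j ∈ deg j 0) →
          tprod ℂ (Function.update w i y) ∈ U := by
        intro y
        simp only [W, Submodule.mem_iInf, Submodule.mem_comap, MultilinearMap.toLinearMap_apply]
      obtain ⟨v₀, -, hv₀, -, -, hgen⟩ := (h i).2
      have htop : W = ⊤ := by
        refine hgen W ((hW _).2 fun w hw => ih _ fun j hj => ?_) fun n _ x hx y hy =>
          (hW _).2 fun w hw => ?_
        · by_cases hji : j = i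
          · subst hji
            rw [Function.update_self, hv₀]
            exact Submodule.mem_span_singleton_self v₀
          · rw [Function.update_of_ne hji]
            exact hw j (by simp [hji, hj])
        -- The parity involutions are applied in advance to the earlier factors, so that those
        -- produced by the action of `x` cancel them.
        · have h1 := (hW y).1 hy
            (fun j => if j < i ∧ (n : ZMod 2) = 1 then (ρ j).parity (w j) else w j) fun j hj => by
              split_ifs
              · exact (h j).parity_mem (hG j) (hw j hj)
              · exact hw j hj
          have h2 := hU (Pi.single i x) _ h1
          rw [tensorRep_action_single, tensorActionAt_tprod hG i hx, Function.update_self] at h2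
          convert h2 using 2
          funext j
          by_cases hji : j = i
          · subst hji; simp
          · simp only [Function.update_of_ne hji]
            split_ifs with h3
            · rw [(ρ j).parity_parity]
            · rfl
      have h1 : v i ∈ W := htop ▸ Submodule.mem_top
      have h2 := (hW _).1 h1 v hv
      rwa [Function.update_eq_self] at h2
  rw [eq_top_iff, ← span_tprod_eq_top, Submodule.span_le]
  rintro _ ⟨v, rfl⟩
  exact key Finset.univ v fun j hj => absurd (Finset.mem_univ j) hj

/-- A tensor killed by the positive parts of all factors is a multiple of the tensor product of the
highest weight vectors. -/
theorem mem_span_tprod_of_singular (hG : ∀ i, InnerGrading (gr i) (D i))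
    (h : ∀ i, SuperRep.IsHighestWeight (gr i) (ρ i) (deg i) (wt i))
    (hirr : ∀ i, ∀ U : Submodule ℂ (L i), (ρ i).IsSubmodule U → U = ⨆ n, U ⊓ deg i n →
      U = ⊥ ∨ U = ⊤)
    (v : ∀ j, L j) (hv : ∀ j, v j ≠ 0) (hv0 : ∀ j, deg j 0 = Submodule.span ℂ {v j})
    (u : ⨂[ℂ] j, L j)
    (hu : ∀ i, ∀ n : ℤ, 0 < n → ∀ x ∈ gr i n, tensorActionAt ρ i x u = 0) :
    u ∈ Submodule.span ℂ {tprod ℂ v} := by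
  refine mem_span_tprod_of_contract v hv u fun i f => ?_
  rw [← hv0]
  refine SuperRep.singular_le (hG i) (h i) (hirr i) fun n hn x hx => ?_
  have h1 := hu i n hn x hx
  rw [tensorActionAt_of_homogeneous ρ i _ x ((hG i).parity_eq n x hx)] at h1
  rw [← contract_koszulOp (fun j => (ρ j).parity) (fun j => (ρ j).parity_parity) (n : ZMod 2), h1,
    map_zero]

/-- The outer tensor product of irreducible highest weight modules is irreducible. -/
theorem isIrreducible_tensorRep (hG : ∀ i, InnerGrading (gr i) (D i))
    (h : ∀ i, SuperRep.IsHighestWeight (gr i) (ρ i) (deg i) (wt i))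
    (hirr : ∀ i, ∀ U : Submodule ℂ (L i), (ρ i).IsSubmodule U → U = ⨆ n, U ⊓ deg i n →
      U = ⊥ ∨ U = ⊤) : (tensorRep ρ).IsIrreducible := by
  choose v hv hv0 _ _ _ using fun i => (h i).2
  refine ⟨⟨tprod ℂ v, 0, fun h0 => ?_⟩, fun U hU => or_iff_not_imp_left.2 fun hU0 => ?_⟩
  -- The tensor product of the highest weight vectors is non-zero: a pure functional detects it.
  · have hf : ∀ j, ∃ f : Module.Dual ℂ (L j), f (v j) ≠ 0 := by
      intro j
      have h1 := (Module.forall_dual_apply_eq_zero_iff ℂ (v j)).not.2 (hv j)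
      push Not at h1
      exact h1
    choose f hf using hf
    have h1 := pureDual_tprod f v
    rw [h0, map_zero] at h1
    exact Finset.prod_ne_zero_iff.2 (fun j _ => hf j) h1.symm
  · have hpos : ∀ i n, 0 < n → deg i n = ⊥ := fun i n hn => (h i).deg_eq_bot (hG i) hn
    have hUgr : U = ⨆ n, U ⊓ tensorDeg deg n :=
      eq_iSup_inf_of_stable ((tensorRep ρ).action D) _
        (iSup_tensorDeg fun i => (h i).1.1.submodule_iSup_eq_top) _
        (SuperRep.add_intCast_injective _) (fun _ _ hu => tensorRep_action_D hG h hu) U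
        fun u hu => hU D u hu
    -- `U` is graded and its degrees are at most `0`, so there is a greatest one; raising operators
    -- of any factor must kill the part of `U` of that degree.
    obtain ⟨n, hn, hmax⟩ := Int.exists_greatest_of_bdd (P := fun n => U ⊓ tensorDeg deg n ≠ ⊥)
      ⟨0, fun n hn => by
        by_contra! h0
        exact hn (by rw [tensorDeg_eq_bot hpos h0, inf_bot_eq])⟩ (by
        by_contra! h0
        exact hU0 (hUgr.trans (by simp only [h0, iSup_bot])))
    obtain ⟨u, hu, hu0⟩ := (Submodule.ne_bot_iff _).1 hn
    have hsing : ∀ i, ∀ k : ℤ, 0 < k → ∀ x ∈ gr i k, tensorActionAt ρ i x u = 0 := by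
      intro i k hk x hx
      have h1 : tensorActionAt ρ i x u ∈ U ⊓ tensorDeg deg (k + n) := by
        refine ⟨?_, tensorActionAt_mem_tensorDeg hG h i hx hu.2⟩
        rw [← tensorRep_action_single]
        exact hU _ u hu.1
      by_contra h2
      have := hmax (k + n) ((Submodule.ne_bot_iff _).2 ⟨_, h1, h2⟩)
      omega
    obtain ⟨c, hc⟩ := Submodule.mem_span_singleton.1
      (mem_span_tprod_of_singular hG h hirr v hv hv0 u hsing)
    have hc0 : c ≠ 0 := by
      rintro rfl
      exact hu0 (by rw [← hc, zero_smul])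
    refine eq_top_of_tprod_mem hG h U hU fun w hw => ?_
    have hw' : ∀ j, ∃ z : ℂ, z • v j = w j := fun j => by
      have := hw j
      rwa [hv0, Submodule.mem_span_singleton] at this
    choose z hz using hw'
    obtain rfl : (fun j => z j • v j) = w := funext hz
    rw [MultilinearMap.map_smul_univ]
    refine U.smul_mem _ ((U.smul_mem_iff hc0).1 ?_)
    rw [hc]
    exact hu.1

end TensorModule

end QPDO

/-! ### The theorem -/

open QPDO
theorem mainTheorem4
    (q : ℂˣ) (hq : ‖(q : ℂ)‖ ≠ 1)
    (logq : ℂ) (hlog : Complex.exp logq = (q : ℂ))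
    (τ : ℂ) (hτ : τ = logq / (2 * (Real.pi : ℂ) * Complex.I))
    {N : ℕ} (m : Fin N → ℕ) (a : Fin N → ℂ)
    (ha : ∀ i j : Fin N, i ≠ j → ∀ n k : ℤ, a i - a j ≠ (n : ℂ) + τ⁻¹ * (k : ℂ)) :
    (∀ (V : Type*) [AddCommGroup V] [Module ℂ V] (ρ : SuperRep (GlHatVec m) V),
      SuperRep.IsQuasifinite (GlHatVec.gr m) ρ →
      ∀ U : Submodule ℂ V,
        (ρ.pullback (phiHatVec q hq logq a m)).IsSubmodule U → ρ.IsSubmodule U) ∧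
    (∀ (L : Fin N → Type*) [∀ i, AddCommGroup (L i)] [∀ i, Module ℂ (L i)]
      (ρ : ∀ i, SuperRep (GlHat (m i)) (L i))
      (wt : ∀ i, Module.Dual ℂ (GlHat.gr (m i) 0)),
      (∀ i, SuperRep.IsQuasifiniteIrreducibleHighestWeight (GlHat.gr (m i)) (ρ i) (wt i)) →
      ((tensorRep ρ).pullback (phiHatVec q hq logq a m)).IsIrreducible) := by
  subst hτ
  refine ⟨fun V _ _ ρ hρ U hU => isSubmodule_of_pullback ρ q hq logq hlog a ha hρ U hU,
    fun L _ _ ρ wt h => ?_⟩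
  choose deg hdeg hfin hirr using h
  have hG := fun i => GlHat.innerGrading (m i)
  obtain ⟨hnt, hsub⟩ := isIrreducible_tensorRep hG hdeg hirr
  -- The tensor product is quasifinite, so part (1) makes each submodule over the quantum operators
  -- a submodule over the infinite matrices, where irreducibility is known.
  exact ⟨hnt, fun U hU => hsub U (isSubmodule_of_pullback (tensorRep ρ) q hq logq hlog a ha
    (isQuasifinite_tensorRep hG hdeg hfin) U hU)⟩
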